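/- Let $n\ge 2$ and $k\ge 1$ be integers. *Interactions.* For a finite set $X\subset\mathbb Z$ let $\mathcal A_X=\bigotimes_{x\in X}\mathrm{Mat}_n(\mathbb C)$, embedded in $\mathcal A_Y$ for $X\subset Y$ by tensoring with the identity, and let $\tau_j:\mathcal A_X\to\mathcal A_{X+j}$ be the shift. An interaction $\Phi$ assigns to each finite $X\subset\mathbb Z$ a self-adjoint $\Phi(X)\in\mathcal A_X$; its Hamiltonian is $H_\Lambda=\sum_{X\subset\Lambda}\Phi(X)$ for finite intervals $\Lambda\subset\mathbb Z$. For $m\in\mathbb N$ let $\mathcal J_m$ be the set of interactions with $\Phi(X)\ge 0$ and $\Phi(X+j)=\tau_j(\Phi(X))$ for all $X$ and $j$, and $\Phi(X)=0$ whenever $X$ has diameter larger than $m$; let $\mathcal J=\bigcup_m\mathcal J_m$. The Hamiltonian $H$ of $\Phi\in\mathcal J$ is *gapped* if there are $\gamma>0$ and $N_0\in\mathbb N$ such that for all finite intervals $\Lambda$ with $|\Lambda|\ge N_0$ the difference between the smallest and the next-smallest eigenvalue of $H_\Lambda$ is at least $\gamma$. *$C^1$-equivalence.* Gapped Hamiltonians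 $H_0,H_1$ of $\Phi_0,\Phi_1\in\mathcal J$ are *$C^1$-equivalent through a path in $\mathcal J_m$* if there is a path $\Phi:[0,1]\to\mathcal J_m$ with $\Phi(0)=\Phi_0$ and $\Phi(1)=\Phi_1$ such that 1. for each finite $X$ the map $t\mapsto\Phi(t)(X)\in\mathcal A_X$ is continuous and piecewise $C^1$ in norm; 2. there are $\gamma>0$, $N_0\in\mathbb N$ and finite intervals $I(t)=[a(t),b(t)]\subset\mathbb R$, with $a,b$ smooth on $[0,1]$, such that for all $t\in[0,1]$ and all finite intervals $\Lambda\subset\mathbb Z$ with $|\Lambda|\ge N_0$, the smallest eigenvalue of the Hamiltonian $H(t)_\Lambda$ of $\Phi(t)$ lies in $I(t)$ and the rest of its spectrum lies in $[b(t)+\gamma,\infty)$. *Parent Hamiltonians.* Let $B_{n,k}$ be the set of $n$-tuples $\mathbb B=(B_1,\dots,B_n)$ of complex $k\times k$ matrices for which the completely positive map $\widehat{\mathbb E}^{\mathbb B}(A)=\sum_{\mu=1}^nB_\mu AB_\mu^*$ on $\mathrm{Mat}_k(\mathbb C)$ has spectral radius $1$ and is primitive, i.e. for some $l\ge1$ the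 matrix $(\widehat{\mathbb E}^{\mathbb B})^l(A)$ is strictly positive for every nonzero $A\ge0$. With $(\psi_\mu)_{\mu=1}^n$ a fixed orthonormal basis of $\mathbb C^n$, let $G_m^{k,\mathbb B}$ be the orthogonal projection in $(\mathbb C^n)^{\otimes m}$ onto $$\Big\{\sum_{\mu_1,\dots,\mu_m=1}^n\mathrm{Tr}\big(CB_{\mu_m}^*\cdots B_{\mu_1}^*\big)\,\psi_{\mu_1}\otimes\cdots\otimes\psi_{\mu_m}\;:\;C\in\mathrm{Mat}_k(\mathbb C)\Big\},$$ and let $H_m^{k,\mathbb B}$ be the Hamiltonian of the interaction $\Phi_m^{k,\mathbb B}$ given by $\Phi_m^{k,\mathbb B}([x,x+m-1])=\tau_x(1-G_m^{k,\mathbb B})$ for $x\in\mathbb Z$ and $\Phi_m^{k,\mathbb B}(X)=0$ for all other $X$. **Lemma.** Let $\mathbb B,\mathbb B'\in B_{n,k}$ and let $m\ge k^4+1$. Then $\Phi_m^{k,\mathbb B},\Phi_m^{k,\mathbb B'}\in\mathcal J_m$, the Hamiltonians $H_m^{k,\mathbb B}$ and $H_m^{k,\mathbb B'}$ are gapped,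 and they are $C^1$-equivalent through a path in $\mathcal J_m$. -/

import Mathlib

open scoped ContDiff ComplexOrder

namespace SpinChain

/-! ## Local algebras, interactions and Hamiltonians of the spin chain -/

/-- The algebra of observables of a finite set `X` of sites, that is the tensor product over `X`
of copies of the `n × n` matrices, identified with the operators on the tensor product over `X`
of copies of `ℂⁿ`. They are written as matrices in the product basis, whose vectors are
indexed by the configurations `X → Fin n`. -/
abbrev LocalAlg (n : ℕ) (X : Finset ℤ) : Type := Matrix (X → Fin n) (X → Fin n) ℂ

/-- The embedding `A ↦ A ⊗ 1` of the algebra of `X` into the algebra of `Y ⊇ X`. -/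
def embed {n : ℕ} {X Y : Finset ℤ} (h : X ⊆ Y) (A : LocalAlg n X) : LocalAlg n Y :=
  Matrix.of fun σ σ' =>
    if ∀ y : Y, (y : ℤ) ∉ X → σ y = σ' y then
      A (fun x => σ ⟨x, h x.2⟩) (fun x => σ' ⟨x, h x.2⟩)
    else 0

/-- The translate `X + j` of a finite set of sites. -/
def shiftSet (j : ℤ) (X : Finset ℤ) : Finset ℤ := X.map (addRightEmbedding j)

theorem add_mem_shiftSet {j x : ℤ} {X : Finset ℤ} (hx : x ∈ X) : x + j ∈ shiftSet j X :=
  Finset.mem_map_of_mem (addRightEmbedding j) hx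

/-- The shift by `j`, from the algebra of `X` onto the algebra of `X + j`. -/
def shift {n : ℕ} (j : ℤ) {X : Finset ℤ} (A : LocalAlg n X) : LocalAlg n (shiftSet j X) :=
  Matrix.of fun σ σ' =>
    A (fun x => σ ⟨x + j, add_mem_shiftSet x.2⟩) (fun x => σ' ⟨x + j, add_mem_shiftSet x.2⟩)

/-- An interaction: a self-adjoint element of the algebra of `X` for every finite set `X` of
sites. -/
@[ext]
structure Interaction (n : ℕ) where
  toFun : (X : Finset ℤ) → LocalAlg n X
  isHermitian : ∀ X, (toFun X).IsHermitian

namespace Interaction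

variable {n : ℕ}

def IsPositive (Φ : Interaction n) : Prop := ∀ X, (Φ.toFun X).PosSemidef

def IsTranslationInvariant (Φ : Interaction n) : Prop :=
  ∀ (j : ℤ) (X : Finset ℤ), Φ.toFun (shiftSet j X) = shift j (Φ.toFun X)

/-- The interaction length is at most `m`: `Φ(X) = 0` for all `X` of diameter larger than `m`. -/
def LengthLE (Φ : Interaction n) (m : ℕ) : Prop :=
  ∀ X : Finset ℤ, (m : ℝ) < Metric.diam (X : Set ℤ) → Φ.toFun X = 0

/-- The Hamiltonian `H_Λ = ∑_{X ⊆ Λ} Φ(X)` associated with `Φ`. -/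
def hamiltonian (Φ : Interaction n) (Λ : Finset ℤ) : LocalAlg n Λ :=
  ∑ X ∈ Λ.powerset.attach, embed (Finset.mem_powerset.1 X.2) (Φ.toFun X.1)

/-- The Hamiltonian associated with `Φ` is gapped: for some `γ > 0`, on all long enough finite
intervals the difference between the smallest and the next-smallest eigenvalue is at
least `γ`. -/
def IsGapped (Φ : Interaction n) : Prop :=
  ∃ γ : ℝ, 0 < γ ∧ ∃ N₀ : ℕ, ∀ a b : ℤ, a ≤ b → N₀ ≤ (Finset.Icc a b).card →
    ∃ e : ℝ, IsLeast (spectrum ℝ (Φ.hamiltonian (Finset.Icc a b))) e ∧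
      ∀ μ ∈ spectrum ℝ (Φ.hamiltonian (Finset.Icc a b)), μ ≠ e → γ ≤ μ - e

end Interaction

/-- The positive translation invariant interactions of interaction length at most `m`. -/
def interactionsOfLength (n m : ℕ) : Set (Interaction n) :=
  {Φ | Φ.IsPositive ∧ Φ.IsTranslationInvariant ∧ Φ.LengthLE m}

/-- The positive translation invariant finite range interactions. -/
def finiteRangeInteractions (n : ℕ) : Set (Interaction n) :=
  {Φ | Φ.IsPositive ∧ Φ.IsTranslationInvariant ∧ ∃ m : ℕ, Φ.LengthLE m}

/-! ## `C¹`-equivalence -/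

/-- `f` is continuous and piecewise `C¹` on `[0,1]`: there is a finite partition
`0 = s₀ < s₁ < ⋯ < s_r = 1` such that `f` is `C¹` on each closed interval `[s_i, s_{i+1}]`
(with one-sided derivatives at its endpoints). -/
def IsPiecewiseC1 {E : Type*} [NormedAddCommGroup E] [NormedSpace ℝ E] (f : ℝ → E) : Prop :=
  ContinuousOn f (Set.Icc 0 1) ∧
    ∃ (r : ℕ) (s : ℕ → ℝ), s 0 = 0 ∧ s r = 1 ∧ (∀ i < r, s i < s (i + 1)) ∧
      ∀ i < r, ContDiffOn ℝ 1 f (Set.Icc (s i) (s (i + 1)))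

section

open scoped Matrix.Norms.L2Operator

/-- A path of interactions, of which only the part over `[0,1]` matters, is continuous and
piecewise `C¹` if all its components are so, for the operator norm. -/
def IsPiecewiseC1Path {n : ℕ} (Φ : ℝ → Interaction n) : Prop :=
  ∀ X : Finset ℤ, IsPiecewiseC1 fun t => (Φ t).toFun X

end

/-- Uniform gap along a path of interactions: there are `γ > 0`, `N₀` and intervals
`[a(t), b(t)]`, with endpoints smooth in `t ∈ [0,1]`, such that for all finite intervals `Λ` with
at least `N₀` sites the smallest eigenvalue of `H(t)_Λ` is in `[a(t), b(t)]` and the rest of its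
spectrum is in `[b(t) + γ, ∞)`. -/
def IsUniformlyGappedPath {n : ℕ} (Φ : ℝ → Interaction n) : Prop :=
  ∃ γ : ℝ, 0 < γ ∧ ∃ (N₀ : ℕ) (a b : ℝ → ℝ),
    ContDiffOn ℝ ∞ a (Set.Icc 0 1) ∧ ContDiffOn ℝ ∞ b (Set.Icc 0 1) ∧
    ∀ t ∈ Set.Icc (0 : ℝ) 1, ∀ x y : ℤ, x ≤ y → N₀ ≤ (Finset.Icc x y).card →
      ∃ e : ℝ, IsLeast (spectrum ℝ ((Φ t).hamiltonian (Finset.Icc x y))) e ∧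
        e ∈ Set.Icc (a t) (b t) ∧
        ∀ μ ∈ spectrum ℝ ((Φ t).hamiltonian (Finset.Icc x y)), μ ≠ e → b t + γ ≤ μ

/-- There is a continuous and piecewise `C¹` path, with a uniform gap, from `Φ₀` to `Φ₁` within
the positive translation invariant interactions of interaction length at most `m`. -/
def GappedPathConnected {n : ℕ} (m : ℕ) (Φ₀ Φ₁ : Interaction n) : Prop :=
  ∃ Φ : ℝ → Interaction n, (∀ t ∈ Set.Icc (0 : ℝ) 1, Φ t ∈ interactionsOfLength n m) ∧
    IsPiecewiseC1Path Φ ∧ Φ 0 = Φ₀ ∧ Φ 1 = Φ₁ ∧ IsUniformlyGappedPath Φ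

/-- `C¹`-equivalence of the Hamiltonians associated with `Φ₀` and `Φ₁`. -/
def C1Equivalent {n : ℕ} (Φ₀ Φ₁ : Interaction n) : Prop :=
  Φ₀ ∈ finiteRangeInteractions n ∧ Φ₁ ∈ finiteRangeInteractions n ∧
    Φ₀.IsGapped ∧ Φ₁.IsGapped ∧ ∃ m : ℕ, GappedPathConnected m Φ₀ Φ₁

/-- `C¹`-equivalence of the Hamiltonians associated with two interactions of interaction length at
most `m`, through a path of such interactions. -/
def C1EquivalentIn {n : ℕ} (m : ℕ) (Φ₀ Φ₁ : Interaction n) : Prop :=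
  Φ₀ ∈ interactionsOfLength n m ∧ Φ₁ ∈ interactionsOfLength n m ∧
    C1Equivalent Φ₀ Φ₁ ∧ GappedPathConnected m Φ₀ Φ₁

/-! ## Primitive maps -/

/-- Linear maps on the `k × k` matrices. -/
abbrev MatMap (k : ℕ) : Type := Module.End ℂ (Matrix (Fin k) (Fin k) ℂ)

/-- Complete positivity: applying `T` to each block of a positive semidefinite block matrix gives
a positive semidefinite block matrix. -/
def IsCompletelyPositive {k : ℕ} (T : MatMap k) : Prop :=
  ∀ (d : ℕ) (M : Matrix (Fin d) (Fin d) (Matrix (Fin k) (Fin k) ℂ)),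
    (Matrix.comp _ _ _ _ ℂ M).PosSemidef → (Matrix.comp _ _ _ _ ℂ (M.map T)).PosSemidef

/-- Primitivity: some power of `T` maps all nonzero positive semidefinite matrices to (strictly)
positive definite ones. -/
def IsPrimitive {k : ℕ} (T : MatMap k) : Prop :=
  ∃ l : ℕ, 0 < l ∧ ∀ A : Matrix (Fin k) (Fin k) ℂ, A.PosSemidef → A ≠ 0 → ((T ^ l) A).PosDef

/-- The primitive completely positive maps with spectral radius `1`. -/
def primitiveMaps (k : ℕ) : Set (MatMap k) :=
  {T | IsCompletelyPositive T ∧ IsPrimitive T ∧ spectralRadius ℂ T = 1}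

/-- The completely positive map `A ↦ ∑_μ B_μ A B_μ*`. -/
def krausMap {n k : ℕ} (B : Fin n → Matrix (Fin k) (Fin k) ℂ) : MatMap k :=
  ∑ μ, LinearMap.mulLeft ℂ (B μ) ∘ₗ LinearMap.mulRight ℂ (B μ).conjTranspose

/-- The set `B_{n,k}` of the `n`-tuples of `k × k` matrices whose map `A ↦ ∑_μ B_μ A B_μ*` is
primitive with spectral radius `1`. -/
def primitiveTuples (n k : ℕ) : Set (Fin n → Matrix (Fin k) (Fin k) ℂ) :=
  {B | krausMap B ∈ primitiveMaps k}

/-! ## Parent Hamiltonians -/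

/-- The map `Γ_N`, which sends `C` to the vector of `(ℂⁿ)^{⊗N}` whose coordinate at
`(μ_1, …, μ_N)` is `Tr (C B_{μ_N}* ⋯ B_{μ_1}*)`. -/
noncomputable def gammaMap {n k : ℕ} (B : Fin n → Matrix (Fin k) (Fin k) ℂ) (N : ℕ) :
    Matrix (Fin k) (Fin k) ℂ →ₗ[ℂ] EuclideanSpace ℂ (Fin N → Fin n) where
  toFun C := WithLp.toLp 2 fun μ =>
    (C * (List.ofFn fun i : Fin N => (B (μ i.rev)).conjTranspose).prod).trace
  map_add' C D := by
    ext μ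
    simp [add_mul]
  map_smul' c C := by
    ext μ
    simp

/-- The orthogonal projection `G_N` onto the range of `Γ_N`, as a matrix in the product basis. -/
noncomputable def groundProj {n k : ℕ} (B : Fin n → Matrix (Fin k) (Fin k) ℂ) (N : ℕ) :
    Matrix (Fin N → Fin n) (Fin N → Fin n) ℂ :=
  Matrix.toEuclideanCLM (n := Fin N → Fin n) (𝕜 := ℂ) |>.symm
    (LinearMap.range (gammaMap B N)).starProjection

theorem groundProj_isHermitian {n k : ℕ} (B : Fin n → Matrix (Fin k) (Fin k) ℂ) (N : ℕ) :
    (groundProj B N).IsHermitian := by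
  have h : IsSelfAdjoint (LinearMap.range (gammaMap B N)).starProjection :=
    isSelfAdjoint_starProjection _
  have h2 := (Matrix.toEuclideanCLM (n := Fin N → Fin n) (𝕜 := ℂ)).symm.map_star'
    (LinearMap.range (gammaMap B N)).starProjection
  rw [h.star_eq] at h2
  exact h2.symm

theorem add_mem_interval {X : Finset ℤ} {x : ℤ} {m : ℕ} (h : X = Finset.Icc x (x + m - 1))
    (i : Fin m) : x + (i : ℤ) ∈ X := by
  have := i.2
  rw [h, Finset.mem_Icc]
  omega

open Classical in
/-- The interaction `Φ_m`, given by `Φ_m(X) = τ_x (1 - G_m)` if `X = [x, x + m - 1]` for some `x`,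
and `Φ_m(X) = 0` otherwise. In the first case, the `i`-th tensor factor (`0 ≤ i < m`) is placed at
the site `x + i`. -/
noncomputable def parentInteraction {n k : ℕ} (B : Fin n → Matrix (Fin k) (Fin k) ℂ) (m : ℕ) :
    Interaction n where
  toFun X :=
    if h : ∃ x : ℤ, X = Finset.Icc x (x + m - 1) then
      (1 - groundProj B m).submatrix
        (fun σ i => σ ⟨h.choose + (i : ℤ), add_mem_interval h.choose_spec i⟩)
        (fun σ i => σ ⟨h.choose + (i : ℤ), add_mem_interval h.choose_spec i⟩)
    else 0
  isHermitian X := by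
    split_ifs with h
    · exact (Matrix.isHermitian_one.sub (groundProj_isHermitian B m)).submatrix _
    · exact Matrix.isHermitian_zero

end SpinChain

/-! The property that carries the proof is that the words of one length `L` in a tuple span all `k ×
k` matrices. The theorem splits into three facts: primitive tuples have it for `L = k ^ 4`, two
tuples that have it are joined by a smooth path of tuples that have it, and along such a path the
parent Hamiltonians with `m ≥ L + 1` have a uniform gap above the eigenvalue `0`.

Spanning. By Perron-Frobenius (`StrictlyPositive.exists_tendsto_pow`) the normalized powers of a
strictly positive map converge to a rank one map. In suitable coordinates the Gram matrix of long
words is then close to the identity (`exists_nearlyOrthonormal`), so the words of some length span.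
The quantum Wielandt argument (`pow_eq_top_of_wielandt`) turns "some length" into "every length from
`k ^ 4` on".

Path. On the complex line through the two tuples, spanning can fail only at the zeros of a nonzero
polynomial, and a suitable arc from `0` to `1` avoids these (`exists_smooth_path`). The ground state
projection is `M (Mᴴ M)⁻¹ Mᴴ` with `M` the matrix of `Γ`, injective along the path, so it is smooth
in the parameter.

Gap. The intersection property identifies the kernel of the chain Hamiltonian with the range of `Γ`,
so the smallest eigenvalue is always `0`. A long chain is covered by blocks of bounded length with
overlap `p`. Near orthonormality of the words on the overlap makes the kernels of neighbouring block
projections nearly orthogonal modulo their intersection (`block_estimate`). Hence the sum `A` of the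
block projections satisfies `A² ≥ A / 2`, while the Hamiltonian is at least a constant times `A` and
has the same kernel; this bounds its nonzero eigenvalues below (`spectrum_gap`). Near orthonormality
is an open condition, and the constant for the finitely many block lengths is uniform by
compactness, so the gap is uniform in the path parameter (`chainHam_uniform_gap`). -/

namespace SpinChain

open scoped MatrixOrder
open Matrix

/-! ### Operators acting on part of the sites. -/

section Emb

variable {d : ℕ} {ι κ ξ : Type*}

open Classical in
/-- The operator on the sites `κ` that acts as `A` on the sites `f '' ι` and as the identity on the
others. -/
noncomputable def emb (f : ι → κ) (A : Matrix (ι → Fin d) (ι → Fin d) ℂ) :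
    Matrix (κ → Fin d) (κ → Fin d) ℂ :=
  Matrix.of fun σ σ' => if ∀ y, y ∉ Set.range f → σ y = σ' y then A (σ ∘ f) (σ' ∘ f) else 0

theorem emb_apply_of {f : ι → κ} (A : Matrix (ι → Fin d) (ι → Fin d) ℂ) {σ σ' : κ → Fin d}
    (h : ∀ y, y ∉ Set.range f → σ y = σ' y) : emb f A σ σ' = A (σ ∘ f) (σ' ∘ f) := by
  simp only [emb, of_apply]
  rw [if_pos h]

theorem emb_apply_not {f : ι → κ} (A : Matrix (ι → Fin d) (ι → Fin d) ℂ) {σ σ' : κ → Fin d}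
    (h : ¬ ∀ y, y ∉ Set.range f → σ y = σ' y) : emb f A σ σ' = 0 := by
  simp only [emb, of_apply]
  rw [if_neg h]

theorem emb_add (f : ι → κ) (A A' : Matrix (ι → Fin d) (ι → Fin d) ℂ) :
    emb f (A + A') = emb f A + emb f A' := by
  ext σ σ'
  simp only [emb, of_apply, Matrix.add_apply]
  split_ifs <;> simp

theorem emb_smul {R : Type*} [SMulZeroClass R ℂ] (f : ι → κ) (c : R)
    (A : Matrix (ι → Fin d) (ι → Fin d) ℂ) :
    emb f (c • A) = c • emb f A := by
  ext σ σ'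
  simp only [emb, of_apply, Matrix.smul_apply]
  split_ifs <;> simp

theorem emb_zero (f : ι → κ) : emb f (0 : Matrix (ι → Fin d) (ι → Fin d) ℂ) = 0 := by
  ext σ σ'
  simp [emb]

theorem emb_sub (f : ι → κ) (A A' : Matrix (ι → Fin d) (ι → Fin d) ℂ) :
    emb f (A - A') = emb f A - emb f A' := by
  ext σ σ'
  simp only [emb, of_apply, Matrix.sub_apply]
  split_ifs <;> simp

theorem emb_sum {α : Type*} (f : ι → κ) (s : Finset α)
    (A : α → Matrix (ι → Fin d) (ι → Fin d) ℂ) :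
    emb f (∑ i ∈ s, A i) = ∑ i ∈ s, emb f (A i) := by
  classical
  induction s using Finset.induction_on with
  | empty => simp [emb_zero]
  | insert a s ha ih => rw [Finset.sum_insert ha, Finset.sum_insert ha, emb_add, ih]

theorem emb_conjTranspose (f : ι → κ) (A : Matrix (ι → Fin d) (ι → Fin d) ℂ) :
    emb f Aᴴ = (emb f A)ᴴ := by
  ext σ σ'
  rw [conjTranspose_apply]
  by_cases h : ∀ y, y ∉ Set.range f → σ y = σ' y
  · rw [emb_apply_of _ h, emb_apply_of _ fun y hy => (h y hy).symm, conjTranspose_apply]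
  · rw [emb_apply_not _ h, emb_apply_not _ fun h' => h fun y hy => (h' y hy).symm, star_zero]

theorem emb_emb {f : ι → κ} {g : κ → ξ} (hg : g.Injective)
    (A : Matrix (ι → Fin d) (ι → Fin d) ℂ) : emb g (emb f A) = emb (g ∘ f) A := by
  ext σ σ'
  by_cases h : ∀ y, y ∉ Set.range (g ∘ f) → σ y = σ' y
  · rw [emb_apply_of _ h, emb_apply_of, emb_apply_of, Function.comp_assoc, Function.comp_assoc]
    · rintro y hy
      refine h _ ?_
      rintro ⟨x, hx⟩
      exact hy ⟨x, hg hx⟩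
    · rintro y hy
      exact h _ fun ⟨x, hx⟩ => hy ⟨f x, hx⟩
  · rw [emb_apply_not _ h]
    by_cases h1 : ∀ y, y ∉ Set.range g → σ y = σ' y
    · rw [emb_apply_of _ h1, emb_apply_not]
      intro h2
      refine h fun y hy => ?_
      by_cases hy1 : y ∈ Set.range g
      · obtain ⟨z, rfl⟩ := hy1
        exact h2 z fun ⟨x, hx⟩ => hy ⟨x, by simp [hx]⟩
      · exact h1 y hy1
    · rw [emb_apply_not _ h1]

variable [Fintype ι] [Fintype κ] [DecidableEq ι] [DecidableEq κ]

/-- The row of `σ` is supported on the configurations that agree with `σ` off the range of `f`;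
these are exactly the `Function.extend f τ σ`, one for each `τ`. All products with `emb f A` are
computed through this reindexing. -/
theorem sum_emb_mul {f : ι → κ} (hf : f.Injective) (A : Matrix (ι → Fin d) (ι → Fin d) ℂ)
    (σ : κ → Fin d) (g : (κ → Fin d) → ℂ) :
    ∑ σ', emb f A σ σ' * g σ' = ∑ τ, A (σ ∘ f) τ * g (Function.extend f τ σ) := by
  classical
  have h1 : ∀ τ : ι → Fin d, A (σ ∘ f) τ * g (Function.extend f τ σ) =
      emb f A σ (Function.extend f τ σ) * g (Function.extend f τ σ) := by
    intro τ
    rw [emb_apply_of, Function.extend_comp hf]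
    intro y hy
    rw [Function.extend_apply' _ _ _ hy]
  simp_rw [h1]
  rw [← Finset.sum_image (f := fun σ' => emb f A σ σ' * g σ')
    (g := fun τ => Function.extend f τ σ) (s := Finset.univ)
    (fun _ _ _ _ h => Function.extend_injective hf σ h)]
  symm
  refine Finset.sum_subset (Finset.subset_univ _) fun σ' _ h => ?_
  rw [emb_apply_not, zero_mul]
  intro h'
  refine h (Finset.mem_image.2 ⟨σ' ∘ f, Finset.mem_univ _, ?_⟩)
  ext1 y
  by_cases hy : y ∈ Set.range f
  · obtain ⟨x, rfl⟩ := hy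
    rw [hf.extend_apply]
    rfl
  · rw [Function.extend_apply' _ _ _ hy, h' y hy]

theorem emb_mulVec {f : ι → κ} (hf : f.Injective) (A : Matrix (ι → Fin d) (ι → Fin d) ℂ)
    (ψ : (κ → Fin d) → ℂ) (σ : κ → Fin d) :
    (emb f A *ᵥ ψ) σ = (A *ᵥ fun τ => ψ (Function.extend f τ σ)) (σ ∘ f) :=
  sum_emb_mul hf A σ ψ

theorem emb_mul {f : ι → κ} (hf : f.Injective) (A A' : Matrix (ι → Fin d) (ι → Fin d) ℂ) :
    emb f (A * A') = emb f A * emb f A' := by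
  ext σ σ'
  rw [mul_apply, sum_emb_mul hf A σ fun ρ => emb f A' ρ σ']
  by_cases h : ∀ y, y ∉ Set.range f → σ y = σ' y
  · rw [emb_apply_of _ h, mul_apply]
    refine Finset.sum_congr rfl fun τ _ => ?_
    rw [emb_apply_of, Function.extend_comp hf]
    intro y hy
    rw [Function.extend_apply' _ _ _ hy, h y hy]
  · rw [emb_apply_not _ h]
    symm
    refine Finset.sum_eq_zero fun τ _ => ?_
    rw [emb_apply_not, mul_zero]
    intro h'
    refine h fun y hy => ?_
    rw [← h' y hy, Function.extend_apply' _ _ _ hy]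

theorem emb_nonneg {f : ι → κ} (hf : f.Injective) {A : Matrix (ι → Fin d) (ι → Fin d) ℂ}
    (hA : 0 ≤ A) : 0 ≤ emb f A := by
  obtain ⟨C, rfl⟩ := CStarAlgebra.nonneg_iff_eq_star_mul_self.1 hA
  rw [emb_mul hf, star_eq_conjTranspose, emb_conjTranspose]
  exact star_mul_self_nonneg (emb f C)

theorem emb_mono {f : ι → κ} (hf : f.Injective) {A A' : Matrix (ι → Fin d) (ι → Fin d) ℂ}
    (h : A ≤ A') : emb f A ≤ emb f A' := by
  rw [← sub_nonneg, ← emb_sub]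
  exact emb_nonneg hf (sub_nonneg.2 h)

/-- For disjoint ranges, overwriting along `f` and overwriting along `g` are independent operations
on configurations, so the two double sums differ only in the order of summation. -/
theorem emb_commute [Fintype ξ] [DecidableEq ξ] {f : ι → κ} {g : ξ → κ} (hf : f.Injective)
    (hg : g.Injective) (hfg : ∀ x y, f x ≠ g y) (A : Matrix (ι → Fin d) (ι → Fin d) ℂ)
    (A' : Matrix (ξ → Fin d) (ξ → Fin d) ℂ) : Commute (emb f A) (emb g A') := by
  have key : ∀ (σ : κ → Fin d) (τ : ι → Fin d), Function.extend f τ σ ∘ g = σ ∘ g := by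
    intro σ τ
    ext1 y
    exact Function.extend_apply' _ _ _ fun ⟨x, hx⟩ => hfg x y hx
  have key' : ∀ (σ : κ → Fin d) (τ : ξ → Fin d), Function.extend g τ σ ∘ f = σ ∘ f := by
    intro σ τ
    ext1 y
    exact Function.extend_apply' _ _ _ fun ⟨x, hx⟩ => hfg y x hx.symm
  have key2 : ∀ (σ : κ → Fin d) (τ : ι → Fin d) (ρ : ξ → Fin d),
      Function.extend f τ (Function.extend g ρ σ) =
        Function.extend g ρ (Function.extend f τ σ) := by
    intro σ τ ρ
    ext1 y
    by_cases hy : y ∈ Set.range f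
    · obtain ⟨x, rfl⟩ := hy
      rw [hf.extend_apply, Function.extend_apply' _ _ _ fun ⟨x', hx'⟩ => hfg _ _ hx'.symm,
        hf.extend_apply]
    · rw [Function.extend_apply' (f := f) _ _ _ hy]
      by_cases hy' : y ∈ Set.range g
      · obtain ⟨x, rfl⟩ := hy'
        rw [hg.extend_apply, hg.extend_apply]
      · rw [Function.extend_apply' (f := g) _ _ _ hy', Function.extend_apply' (f := g) _ _ _ hy',
          Function.extend_apply' (f := f) _ _ _ hy]
  rw [Commute, SemiconjBy]
  refine Matrix.ext_of_mulVec_single fun σ₀ => ?_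
  ext σ
  rw [← mulVec_mulVec, ← mulVec_mulVec, emb_mulVec hf, emb_mulVec hg]
  simp only [mulVec, dotProduct]
  simp_rw [sum_emb_mul hg, sum_emb_mul hf, key, key', Finset.mul_sum]
  rw [Finset.sum_comm]
  simp_rw [key2]
  refine Finset.sum_congr rfl fun _ _ => Finset.sum_congr rfl fun _ _ => ?_
  ring

/-- A vector is annihilated by `emb f A` iff all its slices along `f` are annihilated by `A`. -/
theorem emb_mulVec_eq_zero_iff {f : ι → κ} (hf : f.Injective)
    (A : Matrix (ι → Fin d) (ι → Fin d) ℂ) (ψ : (κ → Fin d) → ℂ) :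
    emb f A *ᵥ ψ = 0 ↔ ∀ σ, (A *ᵥ fun τ => ψ (Function.extend f τ σ)) = 0 := by
  constructor
  · intro h σ
    ext τ
    have h1 := congrFun h (Function.extend f τ σ)
    rw [emb_mulVec hf, Function.extend_comp hf] at h1
    refine Eq.trans ?_ h1
    congr 2
    ext ρ
    congr 1
    ext1 y
    by_cases hy : y ∈ Set.range f
    · obtain ⟨x, rfl⟩ := hy
      rw [hf.extend_apply, hf.extend_apply]
    · simp only [Function.extend_apply' _ _ _ hy]
  · intro h
    ext σ
    rw [emb_mulVec hf, h]
    rfl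

end Emb

end SpinChain

namespace SpinChain

open scoped MatrixOrder InnerProductSpace
open Matrix

/-! ### Two projections whose kernels are nearly orthogonal modulo their intersection. -/

section Hilbert

variable {E : Type*} [NormedAddCommGroup E] [InnerProductSpace ℂ E] [FiniteDimensional ℂ E]

/-- Two orthogonal projections `T₁`, `T₂` whose kernels are at a small angle satisfy
`(T₁ + T₂)² ≥ (1 - ε) (T₁ + T₂)`. -/
theorem pair_estimate (T₁ T₂ : E →L[ℂ] E) (s₁ : ∀ x y, ⟪T₁ x, y⟫_ℂ = ⟪x, T₁ y⟫_ℂ)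
    (s₂ : ∀ x y, ⟪T₂ x, y⟫_ℂ = ⟪x, T₂ y⟫_ℂ) (i₁ : ∀ x, T₁ (T₁ x) = T₁ x)
    (i₂ : ∀ x, T₂ (T₂ x) = T₂ x) {ε : ℝ} (hε0 : 0 ≤ ε) (hε : ε ≤ 1)
    (h : ∀ u, T₂ u = 0 → ∃ f, T₁ f = 0 ∧ T₂ f = 0 ∧
      ∀ s, T₁ s = 0 → ‖⟪s, u - f⟫_ℂ‖ ≤ ε * ‖s‖ * ‖u‖) (x : E) :
    (1 - ε) * RCLike.re ⟪x, T₁ x + T₂ x⟫_ℂ ≤ ‖T₁ x + T₂ x‖ ^ 2 := by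
  set K : Submodule ℂ E := LinearMap.ker T₁.toLinearMap ⊓ LinearMap.ker T₂.toLinearMap with hK
  have hKmem : ∀ f, f ∈ K ↔ T₁ f = 0 ∧ T₂ f = 0 := by
    intro f
    simp [hK]
  -- Both sides of the estimate see only the component `y` of `x` orthogonal to the common kernel
  -- `K`.
  set r := K.starProjection x with hr
  have hrK : r ∈ K := K.starProjection_apply_mem x
  obtain ⟨r1, r2⟩ := (hKmem r).1 hrK
  set y := x - r with hy
  have hyK : ∀ f, f ∈ K → ⟪f, y⟫_ℂ = 0 := by
    intro f hf
    exact (K.sub_starProjection_mem_orthogonal x) f hf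
  have hx : x = y + r := by rw [hy]; abel
  have e1 : T₁ x = T₁ y := by rw [hx, map_add, r1, add_zero]
  have e2 : T₂ x = T₂ y := by rw [hx, map_add, r2, add_zero]
  have hr0 : ⟪r, T₁ y + T₂ y⟫_ℂ = 0 := by
    rw [inner_add_right, ← s₁, ← s₂, r1, r2]
    simp
  have e3 : ⟪x, T₁ x + T₂ x⟫_ℂ = ⟪y, T₁ y + T₂ y⟫_ℂ := by
    rw [e1, e2]
    conv_lhs => rw [hx]
    rw [inner_add_left, hr0, add_zero]
  rw [e3, e1, e2]
  set p := y - T₁ y with hp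
  set q := y - T₂ y with hq
  have hp1 : T₁ p = 0 := by rw [hp, map_sub, i₁, sub_self]
  have hq2 : T₂ q = 0 := by rw [hq, map_sub, i₂, sub_self]
  have hpK : ∀ f, f ∈ K → ⟪p, f⟫_ℂ = 0 := by
    intro f hf
    rw [← inner_conj_symm, hp, inner_sub_right, hyK f hf, ← s₁, ((hKmem f).1 hf).1]
    simp
  have hpq : ‖⟪p, q⟫_ℂ‖ ≤ ε * ‖p‖ * ‖q‖ := by
    obtain ⟨f, f1, f2, hf⟩ := h q hq2
    have := hf p hp1
    rwa [inner_sub_right, hpK f ((hKmem f).2 ⟨f1, f2⟩), sub_zero] at this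
  have hyp : RCLike.re ⟪y, p⟫_ℂ = ‖p‖ ^ 2 := by
    have : y = p + T₁ y := by rw [hp]; abel
    conv_lhs => rw [this]
    rw [inner_add_left, s₁, hp1, inner_zero_right, add_zero, inner_self_eq_norm_sq]
  have hyq : RCLike.re ⟪y, q⟫_ℂ = ‖q‖ ^ 2 := by
    have : y = q + T₂ y := by rw [hq]; abel
    conv_lhs => rw [this]
    rw [inner_add_left, s₂, hq2, inner_zero_right, add_zero, inner_self_eq_norm_sq]
  have hn1 : ‖p‖ ^ 2 + ‖q‖ ^ 2 ≤ ‖y‖ * ‖p + q‖ := by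
    rw [← hyp, ← hyq, ← map_add, ← inner_add_right]
    exact re_inner_le_norm y (p + q)
  have hn2 : ‖p + q‖ ^ 2 ≤ (1 + ε) * (‖p‖ ^ 2 + ‖q‖ ^ 2) := by
    rw [@norm_add_sq ℂ]
    have h1 : RCLike.re ⟪p, q⟫_ℂ ≤ ε * ‖p‖ * ‖q‖ := (RCLike.re_le_norm _).trans hpq
    nlinarith [mul_nonneg hε0 (sq_nonneg (‖p‖ - ‖q‖))]
  have hn3 : ‖p‖ ^ 2 + ‖q‖ ^ 2 ≤ (1 + ε) * ‖y‖ ^ 2 := by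
    by_cases h0 : ‖p‖ ^ 2 + ‖q‖ ^ 2 ≤ 0
    · exact h0.trans (by positivity)
    · push Not at h0
      refine le_of_mul_le_mul_right ?_ h0
      calc (‖p‖ ^ 2 + ‖q‖ ^ 2) * (‖p‖ ^ 2 + ‖q‖ ^ 2)
          ≤ (‖y‖ * ‖p + q‖) * (‖y‖ * ‖p + q‖) :=
            mul_self_le_mul_self h0.le hn1
        _ = ‖y‖ ^ 2 * ‖p + q‖ ^ 2 := by ring
        _ ≤ ‖y‖ ^ 2 * ((1 + ε) * (‖p‖ ^ 2 + ‖q‖ ^ 2)) := by gcongr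
        _ = _ := by ring
  set a := RCLike.re ⟪y, T₁ y + T₂ y⟫_ℂ with ha
  have ha1 : a = 2 * ‖y‖ ^ 2 - (‖p‖ ^ 2 + ‖q‖ ^ 2) := by
    have h1 : T₁ y + T₂ y = y + y - p - q := by rw [hp, hq]; abel
    rw [ha, h1, inner_sub_right, inner_sub_right, inner_add_right, map_sub, map_sub, map_add,
      hyp, hyq, inner_self_eq_norm_sq]
    ring
  have ha2 : (1 - ε) * ‖y‖ ^ 2 ≤ a := by rw [ha1]; linarith
  have ha3 : a ≤ ‖y‖ * ‖T₁ y + T₂ y‖ := re_inner_le_norm _ _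
  have ha0 : 0 ≤ a := le_trans (mul_nonneg (by linarith) (sq_nonneg _)) ha2
  -- Combine `(1 - ε) ‖y‖² ≤ a` with the square of the Cauchy-Schwarz bound `ha3`, and divide by `a`
  -- when it is nonzero.
  rcases ha0.eq_or_lt with h0 | h0
  · rw [← h0, mul_zero]
    positivity
  · refine le_of_mul_le_mul_right ?_ h0
    calc (1 - ε) * a * a = (1 - ε) * (a * a) := by ring
      _ ≤ (1 - ε) * ((‖y‖ * ‖T₁ y + T₂ y‖) * (‖y‖ * ‖T₁ y + T₂ y‖)) := by
          refine mul_le_mul_of_nonneg_left (mul_self_le_mul_self ha0 ha3) (by linarith)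
      _ = ((1 - ε) * ‖y‖ ^ 2) * ‖T₁ y + T₂ y‖ ^ 2 := by ring
      _ ≤ a * ‖T₁ y + T₂ y‖ ^ 2 := by gcongr
      _ = _ := by ring

end Hilbert

/-! ### Operator inequalities that yield spectral gaps. -/

section Order

variable {Ω : Type*} [Fintype Ω]

theorem inner_toLp (x y : Ω → ℂ) :
    ⟪WithLp.toLp 2 x, WithLp.toLp 2 y⟫_ℂ = star x ⬝ᵥ y := by
  rw [EuclideanSpace.inner_toLp_toLp, dotProduct_comm]

theorem _root_.Matrix.IsHermitian.dotProduct_mulVec_eq {M : Matrix Ω Ω ℂ} (hM : M.IsHermitian)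
    (x y : Ω → ℂ) : star x ⬝ᵥ M *ᵥ y = star (M *ᵥ x) ⬝ᵥ y := by
  rw [star_mulVec, hM.eq, dotProduct_mulVec]

theorem le_of_re_dotProduct {M N : Matrix Ω Ω ℂ} (hM : M.IsHermitian) (hN : N.IsHermitian)
    (h : ∀ x : Ω → ℂ, (star x ⬝ᵥ M *ᵥ x).re ≤ (star x ⬝ᵥ N *ᵥ x).re) : M ≤ N := by
  rw [Matrix.le_iff]
  refine PosSemidef.of_dotProduct_mulVec_nonneg (hN.sub hM) fun x => ?_
  have h1 := (hN.sub hM).im_star_dotProduct_mulVec_self x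
  rw [Complex.nonneg_iff]
  refine ⟨?_, h1.symm⟩
  rw [sub_mulVec, dotProduct_sub, Complex.sub_re]
  exact sub_nonneg.2 (h x)

theorem re_dotProduct_le {M N : Matrix Ω Ω ℂ} (h : M ≤ N) (x : Ω → ℂ) :
    (star x ⬝ᵥ M *ᵥ x).re ≤ (star x ⬝ᵥ N *ᵥ x).re := by
  have := (Matrix.le_iff.1 h).re_dotProduct_nonneg x
  rw [sub_mulVec, dotProduct_sub, map_sub] at this
  exact sub_nonneg.1 this

variable [DecidableEq Ω]

theorem pair_estimate_matrix {h₁ h₂ : Matrix Ω Ω ℂ} (s₁ : h₁.IsHermitian) (s₂ : h₂.IsHermitian)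
    (i₁ : h₁ * h₁ = h₁) (i₂ : h₂ * h₂ = h₂) {ε : ℝ} (hε0 : 0 ≤ ε) (hε : ε ≤ 1)
    (h : ∀ u : EuclideanSpace ℂ Ω, h₂ *ᵥ u.ofLp = 0 → ∃ f : EuclideanSpace ℂ Ω,
      h₁ *ᵥ f.ofLp = 0 ∧ h₂ *ᵥ f.ofLp = 0 ∧ ∀ s : EuclideanSpace ℂ Ω,
        h₁ *ᵥ s.ofLp = 0 → ‖⟪s, u - f⟫_ℂ‖ ≤ ε * ‖s‖ * ‖u‖) :
    (1 - ε) • (h₁ + h₂) ≤ (h₁ + h₂) * (h₁ + h₂) := by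
  have herm : (h₁ + h₂).IsHermitian := s₁.add s₂
  refine le_of_re_dotProduct ?_ ?_ fun x => ?_
  · rw [IsHermitian, conjTranspose_smul, herm.eq, star_trivial]
  · rw [IsHermitian, conjTranspose_mul, herm.eq]
  · have hz : ∀ (M : Matrix Ω Ω ℂ) (v : EuclideanSpace ℂ Ω),
        toEuclideanCLM (n := Ω) (𝕜 := ℂ) M v = 0 ↔ M *ᵥ v.ofLp = 0 := by
      intro M v
      rw [← ofLp_toEuclideanCLM]
      exact (WithLp.ofLp_eq_zero 2).symm
    have hs : ∀ (M : Matrix Ω Ω ℂ), M.IsHermitian → ∀ v w : EuclideanSpace ℂ Ω,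
        ⟪toEuclideanCLM (n := Ω) (𝕜 := ℂ) M v, w⟫_ℂ =
          ⟪v, toEuclideanCLM (n := Ω) (𝕜 := ℂ) M w⟫_ℂ := by
      intro M hM v w
      obtain ⟨v, rfl⟩ := (WithLp.equiv 2 _).symm.surjective v
      obtain ⟨w, rfl⟩ := (WithLp.equiv 2 _).symm.surjective w
      simp only [WithLp.equiv_symm_apply, toEuclideanCLM_toLp]
      rw [inner_toLp, inner_toLp, star_mulVec, hM.eq, dotProduct_mulVec]
    have hi : ∀ (M : Matrix Ω Ω ℂ), M * M = M → ∀ v : EuclideanSpace ℂ Ω,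
        toEuclideanCLM (n := Ω) (𝕜 := ℂ) M (toEuclideanCLM (n := Ω) (𝕜 := ℂ) M v) =
          toEuclideanCLM (n := Ω) (𝕜 := ℂ) M v := by
      intro M hM v
      conv_rhs => rw [← hM, map_mul]
      rfl
    have key := pair_estimate (toEuclideanCLM (n := Ω) (𝕜 := ℂ) h₁)
      (toEuclideanCLM (n := Ω) (𝕜 := ℂ) h₂) (hs _ s₁) (hs _ s₂) (hi _ i₁) (hi _ i₂) hε0 hε
      (by simpa only [hz] using h) (WithLp.toLp 2 x)
    have e1 : toEuclideanCLM (n := Ω) (𝕜 := ℂ) h₁ (WithLp.toLp 2 x) +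
        toEuclideanCLM (n := Ω) (𝕜 := ℂ) h₂ (WithLp.toLp 2 x) =
          WithLp.toLp 2 ((h₁ + h₂) *ᵥ x) := by
      rw [toEuclideanCLM_toLp, toEuclideanCLM_toLp, add_mulVec]
      rfl
    rw [e1, ← @inner_self_eq_norm_sq ℂ, inner_toLp, inner_toLp] at key
    rw [smul_mulVec, dotProduct_smul, Complex.smul_re, smul_eq_mul, ← mulVec_mulVec,
      herm.dotProduct_mulVec_eq x ((h₁ + h₂) *ᵥ x)]
    exact key

/-- A sum of projections, where neighbouring ones are almost commuting and the others commute,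
satisfies `H² ≥ (1 - 2ε) H`. -/
theorem sum_estimate {h : ℕ → Matrix Ω Ω ℂ} {q : ℕ} (hq : 1 ≤ q) {ε : ℝ} (hε : 0 ≤ ε)
    (herm : ∀ i < q, (h i).IsHermitian) (idem : ∀ i < q, h i * h i = h i)
    (comm : ∀ i j, i + 2 ≤ j → j < q → Commute (h i) (h j))
    (pair : ∀ i, i + 1 < q →
      (1 - ε) • (h i + h (i + 1)) ≤ (h i + h (i + 1)) * (h i + h (i + 1))) :
    (1 - 2 * ε) • (∑ i ∈ Finset.range q, h i) + ε • h (q - 1) ≤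
      (∑ i ∈ Finset.range q, h i) * ∑ i ∈ Finset.range q, h i := by
  have hpos : ∀ i < q, 0 ≤ h i := by
    intro i hi
    have := star_mul_self_nonneg (h i)
    rwa [star_eq_conjTranspose, (herm i hi).eq, idem i hi] at this
  have cpos : ∀ i j, i + 2 ≤ j → j < q → 0 ≤ h i * h j := by
    intro i j hij hj
    have := star_mul_self_nonneg (h i * h j)
    rw [star_eq_conjTranspose, conjTranspose_mul, (herm i (by omega)).eq, (herm j hj).eq,
      ← (comm i j hij hj).eq, mul_assoc, ← mul_assoc (h j) (h i), ← (comm i j hij hj).eq,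
      mul_assoc (h i), idem j hj, ← mul_assoc, idem i (by omega)] at this
    exact this
  suffices H : ∀ p, 1 ≤ p → p ≤ q →
      (1 - 2 * ε) • (∑ i ∈ Finset.range p, h i) + ε • h (p - 1) ≤
        (∑ i ∈ Finset.range p, h i) * ∑ i ∈ Finset.range p, h i from H q hq le_rfl
  intro p hp
  induction p, hp using Nat.le_induction with
  | base =>
    intro h1
    rw [Finset.sum_range_one, idem 0 h1, ← add_smul, ← sub_nonneg]
    have : h 0 - (1 - 2 * ε + ε) • h (1 - 1) = ε • h 0 := by
      rw [Nat.sub_self]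
      module
    rw [this]
    exact smul_nonneg hε (hpos 0 h1)
  | succ p hp ih =>
    intro h1
    have ih' := ih (by omega)
    obtain ⟨p, rfl⟩ : ∃ p', p = p' + 1 := ⟨p - 1, by omega⟩
    set S := ∑ i ∈ Finset.range p, h i with hS
    set P := h p with hP
    set Q := h (p + 1) with hQ
    rw [Finset.sum_range_succ, Finset.sum_range_succ _ p, ← hS, ← hP, ← hQ]
    rw [Finset.sum_range_succ, ← hS, ← hP, Nat.add_sub_cancel, ← hP] at ih'
    rw [Nat.add_sub_cancel, ← hQ]
    have pr := pair p (by omega)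
    rw [← hP, ← hQ] at pr
    have hPP : P * P = P := idem p (by omega)
    have hQQ : Q * Q = Q := idem (p + 1) (by omega)
    have c1 : 0 ≤ S * Q := by
      rw [hS, Finset.sum_mul]
      exact Finset.sum_nonneg fun i hi =>
        cpos _ _ (by have := Finset.mem_range.1 hi; omega) (by omega)
    have c2 : Q * S = S * Q := by
      rw [hS, Finset.sum_mul, Finset.mul_sum]
      refine Finset.sum_congr rfl fun i hi => ?_
      exact (comm i (p + 1) (by have := Finset.mem_range.1 hi; omega) (by omega)).eq.symm
    rw [← sub_nonneg] at ih' pr ⊢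
    -- The square of `P` occurs in both smaller squares and is subtracted once. The spare `ε • P`
    -- kept by the induction exactly completes the coefficient of `P`, and a new spare `ε • Q` is
    -- left over.
    have e : (S + P + Q) * (S + P + Q) - ((1 - 2 * ε) • (S + P + Q) + ε • Q) =
        ((S + P) * (S + P) - ((1 - 2 * ε) • (S + P) + ε • P)) +
        ((P + Q) * (P + Q) - (1 - ε) • (P + Q)) + (S * Q + S * Q) := by
      have e1 : (S + P + Q) * (S + P + Q) =
          (S + P) * (S + P) + (P + Q) * (P + Q) - P * P + S * Q + Q * S := by noncomm_ring
      rw [e1, c2, hPP]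
      module
    rw [e]
    exact add_nonneg (add_nonneg ih' pr) (add_nonneg c1 c1)

/-- If `A² ≥ g A` and `H ≥ c A`, where `ker A ⊆ ker H`, then `H` has no eigenvalue in
`(0, c g)`. -/
theorem spectrum_gap {A H : Matrix Ω Ω ℂ} (hA : 0 ≤ A) (hH : 0 ≤ H) {g c : ℝ} (hc : 0 ≤ c)
    (h1 : g • A ≤ A * A) (h2 : c • A ≤ H) (h3 : ∀ v, A *ᵥ v = 0 → H *ᵥ v = 0)
    {μ : ℝ} (hμ : μ ∈ spectrum ℝ H) (h0 : μ ≠ 0) : c * g ≤ μ := by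
  have hHh : H.IsHermitian := hH.posSemidef.1
  have hAh : A.IsHermitian := hA.posSemidef.1
  rw [hHh.spectrum_real_eq_range_eigenvalues] at hμ
  obtain ⟨i, rfl⟩ := hμ
  set μ := hHh.eigenvalues i with hμ
  set v : Ω → ℂ := (hHh.eigenvectorBasis i).ofLp with hv
  have hvv : star v ⬝ᵥ v = 1 := by
    rw [hv, ← inner_toLp]
    simp
  have hHv : H *ᵥ v = μ • v := hHh.mulVec_eigenvectorBasis i
  -- An eigenvector of `H` with nonzero eigenvalue is orthogonal to `ker H`, hence to `ker A`, so it
  -- lies in the range of the Hermitian matrix `A`.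
  obtain ⟨y, hy⟩ : ∃ y, A *ᵥ y = v := by
    set T := toEuclideanCLM (n := Ω) (𝕜 := ℂ) A with hT
    have hTadj : ContinuousLinearMap.adjoint T = T := by
      rw [← ContinuousLinearMap.star_eq_adjoint, hT, ← map_star, star_eq_conjTranspose, hAh.eq]
    have hmem : hHh.eigenvectorBasis i ∈ (LinearMap.ker T.toLinearMap)ᗮ := by
      intro w hw
      have hw1 : A *ᵥ w.ofLp = 0 := by
        have : T w = 0 := hw
        rw [← ofLp_toEuclideanCLM, ← hT, this]
        rfl
      have hw2 := h3 _ hw1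
      have : star w.ofLp ⬝ᵥ (H *ᵥ v) = 0 := by
        rw [hHh.dotProduct_mulVec_eq, hw2, star_zero, zero_dotProduct]
      rw [hHv, dotProduct_smul, smul_eq_zero] at this
      have h4 := this.resolve_left h0
      rw [hv, ← inner_toLp] at h4
      exact h4
    rw [ContinuousLinearMap.orthogonal_ker, hTadj] at hmem
    rw [(Submodule.closed_of_finiteDimensional _).submodule_topologicalClosure_eq] at hmem
    obtain ⟨y, hy⟩ := hmem
    refine ⟨y.ofLp, ?_⟩
    have hy' : T y = hHh.eigenvectorBasis i := hy
    rw [hv, ← hy', hT, ofLp_toEuclideanCLM]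
  -- Conjugate `h1` by the square root of `A`. Evaluated at `y`, this becomes `g ≤ ⟨v, A v⟩`.
  have h4 : g • (A * A) ≤ A * A * A := by
    have hs := CFC.sqrt_nonneg A
    have hsq : CFC.sqrt A * CFC.sqrt A = A := CFC.sqrt_mul_sqrt_self A hA
    have := (IsSelfAdjoint.of_nonneg hs).conjugate_nonneg (sub_nonneg.2 h1)
    rw [mul_sub, sub_mul, sub_nonneg, mul_smul_comm, smul_mul_assoc] at this
    set s := CFC.sqrt A
    have e1 : s * A * s = A * A := by rw [← hsq]; noncomm_ring
    have e2 : s * (A * A) * s = A * A * A := by rw [← hsq]; noncomm_ring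
    rwa [e1, e2] at this
  have h5 := re_dotProduct_le h4 y
  have e1 : star y ⬝ᵥ (A * A) *ᵥ y = 1 := by
    rw [← mulVec_mulVec, hy, hAh.dotProduct_mulVec_eq, hy, hvv]
  have e2 : star y ⬝ᵥ (A * A * A) *ᵥ y = star v ⬝ᵥ A *ᵥ v := by
    rw [mul_assoc, ← mulVec_mulVec, hAh.dotProduct_mulVec_eq, hy, ← mulVec_mulVec, hy]
  rw [smul_mulVec, dotProduct_smul, e1, e2] at h5
  have h6 := re_dotProduct_le h2 v
  rw [smul_mulVec, dotProduct_smul, hHv, dotProduct_smul, hvv] at h6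
  simp only [Complex.smul_re, Complex.one_re, smul_eq_mul, mul_one] at h5 h6
  exact (mul_le_mul_of_nonneg_left h5 hc).trans h6

/-- A continuous family of positive definite matrices over a compact set is uniformly bounded
below. -/
theorem exists_uniform_lower_bound {X : Type*} [TopologicalSpace X] {K : Set X}
    (hK : IsCompact K) {M : X → Matrix Ω Ω ℂ} (hM : ∀ i j, ContinuousOn (fun t => M t i j) K)
    (hpos : ∀ t ∈ K, (M t).PosDef) : ∃ c : ℝ, 0 < c ∧ ∀ t ∈ K, c • (1 : Matrix Ω Ω ℂ) ≤ M t := by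
  set S : Set (EuclideanSpace ℂ Ω) := Metric.sphere 0 1
  have hKS : IsCompact (K ×ˢ S) := hK.prod (isCompact_sphere _ _)
  set F : X × EuclideanSpace ℂ Ω → ℝ :=
    fun z => (star z.2.ofLp ⬝ᵥ M z.1 *ᵥ z.2.ofLp).re with hF
  have hFc : ContinuousOn F (K ×ˢ S) := by
    refine Complex.continuous_re.comp_continuousOn ?_
    simp only [dotProduct, mulVec, Pi.star_apply]
    refine continuousOn_finsetSum _ fun i _ => ContinuousOn.mul ?_ ?_
    · exact Continuous.continuousOn (by fun_prop)
    · refine continuousOn_finsetSum _ fun j _ => ContinuousOn.mul ?_ ?_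
      · exact (hM i j).comp continuousOn_fst fun z hz => hz.1
      · exact Continuous.continuousOn (by fun_prop)
  obtain ⟨c, hc, hcF⟩ : ∃ c : ℝ, 0 < c ∧ ∀ z ∈ K ×ˢ S, c ≤ F z := by
    rcases (K ×ˢ S).eq_empty_or_nonempty with he | hne
    · exact ⟨1, one_pos, by simp [he]⟩
    · obtain ⟨z, hz, hmin⟩ := hKS.exists_isMinOn hne hFc
      refine ⟨F z, ?_, fun w hw => hmin hw⟩
      refine (hpos z.1 hz.1).re_dotProduct_pos ?_
      intro h0
      have : z.2 = 0 := by
        ext i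
        exact congrFun h0 i
      have h1 := hz.2
      rw [this] at h1
      simp [S] at h1
  refine ⟨c, hc, fun t ht => le_of_re_dotProduct ?_ (hpos t ht).1 fun x => ?_⟩
  · rw [IsHermitian, conjTranspose_smul, conjTranspose_one, star_trivial]
  · by_cases hx : x = 0
    · simp [hx]
    set y := WithLp.toLp 2 x with hy
    have hy0 : 0 < ‖y‖ := norm_pos_iff.2 fun h => hx (by simpa [hy] using h)
    have h1 := hcF (t, ((‖y‖⁻¹ : ℝ) : ℂ) • y) ⟨ht, by
      simp only [S, mem_sphere_iff_norm, sub_zero, norm_smul]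
      simp [hy0.ne']⟩
    simp only [hF, WithLp.ofLp_smul, hy, mulVec_smul, star_smul, smul_dotProduct,
      dotProduct_smul] at h1
    rw [← hy] at h1
    have h2 : (star x ⬝ᵥ x).re = ‖y‖ ^ 2 := by
      rw [← @inner_self_eq_norm_sq ℂ, hy, inner_toLp]
      rfl
    rw [smul_mulVec, one_mulVec, dotProduct_smul, Complex.smul_re, h2]
    simp only [RCLike.star_def, Complex.conj_ofReal, smul_eq_mul, Complex.re_ofReal_mul] at h1
    rw [smul_eq_mul]
    field_simp at h1
    exact h1

end Order

end SpinChain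

namespace SpinChain

open Matrix

/-! ### The quantum Wielandt inequality. -/

section Wielandt

/-- Such a sequence gains at least one per step until it stops for good, and it cannot stop below a
value it later attains. It is applied to dimensions of increasing families of spaces of words. -/
theorem le_of_stationary_chain {f : ℕ → ℕ} (hmono : ∀ l, f l ≤ f (l + 1))
    (hst : ∀ l, f l = f (l + 1) → f (l + 1) = f (l + 2)) {N l₀ : ℕ} (hN : N ≤ f l₀) {l : ℕ}
    (hl : N ≤ f 0 + l) : N ≤ f l := by
  have hm : Monotone f := monotone_nat_of_le_succ hmono
  by_contra! hlt
  have hstrict : ∀ i < l, f i < f (i + 1) := by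
    intro i hi
    refine lt_of_le_of_ne (hmono i) fun he => ?_
    have hconst : ∀ j, f (i + j) = f i ∧ f (i + j + 1) = f i := by
      intro j
      induction j with
      | zero => exact ⟨rfl, he.symm⟩
      | succ j ih =>
        refine ⟨ih.2, ?_⟩
        have := hst (i + j) (ih.1.trans ih.2.symm)
        exact this.symm.trans ih.2
    have h1 := (hconst l₀).1
    have h2 : f l₀ ≤ f (i + l₀) := hm (by omega)
    have h3 : f i ≤ f l := hm hi.le
    omega
  have hgrow : ∀ i ≤ l, f 0 + i ≤ f i := by
    intro i
    induction i with
    | zero => simp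
    | succ i ih =>
      intro hi
      have := ih (by omega)
      have := hstrict i (by omega)
      omega
  have := hgrow l le_rfl
  omega

variable {k : ℕ}

local notation "Mat" => Matrix (Fin k) (Fin k) ℂ

theorem mul_top_of_pow_eq_top {S : Submodule ℂ Mat} {l : ℕ} (hl : 1 ≤ l) (h : S ^ l = ⊤) :
    S * ⊤ = ⊤ := by
  obtain ⟨l, rfl⟩ : ∃ l', l = l' + 1 := ⟨l - 1, by omega⟩
  rw [eq_top_iff]
  calc ⊤ = S * S ^ l := by rw [← h, pow_succ']
    _ ≤ S * ⊤ := mul_le_mul_right le_top S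

theorem pow_eq_top_of_le {S : Submodule ℂ Mat} (hS : S * ⊤ = ⊤) {l l' : ℕ} (h : S ^ l = ⊤)
    (hl : l ≤ l') : S ^ l' = ⊤ := by
  induction l', hl using Nat.le_induction with
  | base => exact h
  | succ j _ ih => rw [pow_succ', ih, hS]

/-- The span of all words of length between `1` and `j`. -/
def wordsUpTo (S : Submodule ℂ Mat) : ℕ → Submodule ℂ Mat
  | 0 => ⊥
  | j + 1 => S ⊔ S * wordsUpTo S j

theorem wordsUpTo_le_succ (S : Submodule ℂ Mat) (j : ℕ) :
    wordsUpTo S j ≤ wordsUpTo S (j + 1) := by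
  induction j with
  | zero => exact bot_le
  | succ j ih => exact sup_le_sup_left (mul_le_mul_right ih S) _

theorem pow_le_wordsUpTo (S : Submodule ℂ Mat) (j : ℕ) : S ^ (j + 1) ≤ wordsUpTo S (j + 1) := by
  induction j with
  | zero => rw [zero_add, pow_one]; exact le_sup_left
  | succ j ih =>
    rw [pow_succ']
    exact (mul_le_mul_right ih S).trans le_sup_right

theorem pow_mul_wordsUpTo_le (S P : Submodule ℂ Mat) (j i : ℕ)
    (h : ∀ l, i < l → l ≤ i + j → S ^ l ≤ P) : S ^ i * wordsUpTo S j ≤ P := by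
  induction j generalizing i with
  | zero => simp [wordsUpTo]
  | succ j ih =>
    rw [wordsUpTo, Submodule.mul_sup, ← mul_assoc, ← pow_succ]
    refine sup_le (h _ (by omega) (by omega)) (ih _ fun l h1 h2 => h l (by omega) (by omega))

/-- The recursion makes each space determine the next, so a repeated dimension repeats forever;
starting from dimension `0`, full dimension `k ^ 2` takes at most `k ^ 2` steps. -/
theorem wordsUpTo_eq_top {S : Submodule ℂ Mat} {l : ℕ} (hl : 1 ≤ l) (h : S ^ l = ⊤) :
    wordsUpTo S (k ^ 2) = ⊤ := by
  have hfr : Module.finrank ℂ Mat = k ^ 2 := by simp [Module.finrank_matrix, sq]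
  refine Submodule.eq_top_of_finrank_eq (le_antisymm (Submodule.finrank_le _) ?_)
  rw [hfr]
  refine le_of_stationary_chain (f := fun j => Module.finrank ℂ (wordsUpTo S j)) (l₀ := l)
    (fun j => Submodule.finrank_mono (wordsUpTo_le_succ S j)) (fun j hj => ?_) ?_ (by omega)
  · have := Submodule.eq_of_le_of_finrank_eq (wordsUpTo_le_succ S j) hj
    have h2 : wordsUpTo S (j + 2) = S ⊔ S * wordsUpTo S (j + 1) := rfl
    rw [h2, ← this]
    exact hj
  · obtain ⟨l, rfl⟩ : ∃ l', l = l' + 1 := ⟨l - 1, by omega⟩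
    have h1 := pow_le_wordsUpTo S l
    rw [h, top_le_iff] at h1
    rw [h1, finrank_top, hfr]

/-- Otherwise the trace would vanish on all words of length `1` to `k ^ 2`, hence on every matrix,
including the identity. -/
theorem exists_trace_ne_zero (hk : 1 ≤ k) {S : Submodule ℂ Mat} {l : ℕ} (hl : 1 ≤ l)
    (h : S ^ l = ⊤) : ∃ j, 1 ≤ j ∧ j ≤ k ^ 2 ∧ ∃ A ∈ S ^ j, A.trace ≠ 0 := by
  by_contra! hcon
  have h1 := pow_mul_wordsUpTo_le S (LinearMap.ker (Matrix.traceLinearMap (Fin k) ℂ ℂ)) (k ^ 2) 0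
    fun l h1 h2 A hA => hcon l h1 (by omega) A hA
  rw [pow_zero, one_mul, wordsUpTo_eq_top hl h] at h1
  have h2 : (1 : Mat).trace = 0 := h1 (Submodule.mem_top (x := (1 : Mat)))
  rw [trace_one, Fintype.card_fin] at h2
  have : k = 0 := by exact_mod_cast h2
  omega

theorem exists_eigenvector_of_trace_ne_zero {A : Mat} (h : A.trace ≠ 0) :
    ∃ (μ : ℂ) (φ : Fin k → ℂ), μ ≠ 0 ∧ φ ≠ 0 ∧ A *ᵥ φ = μ • φ := by
  obtain ⟨μ, hμ, hμ0⟩ : ∃ μ ∈ A.charpoly.roots, μ ≠ 0 := by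
    by_contra! hcon
    refine h ?_
    rw [Matrix.trace_eq_sum_roots_charpoly]
    exact Multiset.sum_eq_zero hcon
  have h1 : A.charpoly.IsRoot μ := (Polynomial.mem_roots'.1 hμ).2
  have h2 : Module.End.HasEigenvalue (Matrix.toLin' A) μ := by
    rw [Module.End.hasEigenvalue_iff_isRoot_charpoly, Matrix.charpoly_toLin']
    exact h1
  obtain ⟨φ, hφ⟩ := h2.exists_hasEigenvector
  exact ⟨μ, φ, hμ0, hφ.2, by simpa using hφ.apply_eq_smul⟩

/-- Because `A φ = μ φ` with `μ ≠ 0`, a vector reached from `φ` by words of length `l` is also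
reached by words of length `l + 1`. The reachable spaces grow from dimension at least `1`, so `k -
1` steps fill `ℂᵏ`. -/
theorem map_pow_mulVec_eq_top {V : Submodule ℂ Mat} {A : Mat} (hA : A ∈ V) {μ : ℂ}
    {φ : Fin k → ℂ} (hμ : μ ≠ 0) (hφ : φ ≠ 0) (hAφ : A *ᵥ φ = μ • φ) {j : ℕ} (hj : V ^ j = ⊤) :
    (V ^ (k - 1)).map ((Matrix.mulVecBilin ℂ ℂ).flip φ) = ⊤ := by
  set H : ℕ → Submodule ℂ (Fin k → ℂ) := fun l => (V ^ l).map ((Matrix.mulVecBilin ℂ ℂ).flip φ)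
  have hmem : ∀ l v, v ∈ H l ↔ ∃ y ∈ V ^ l, y *ᵥ φ = v := by
    intro l v
    simp [H, Submodule.mem_map]
  have hmono : ∀ l, H l ≤ H (l + 1) := by
    intro l v hv
    obtain ⟨y, hy, rfl⟩ := (hmem l v).1 hv
    refine (hmem _ _).2 ⟨μ⁻¹ • (y * A), Submodule.smul_mem _ _ ?_, ?_⟩
    · rw [pow_succ]
      exact Submodule.mul_mem_mul hy hA
    · rw [smul_mulVec, ← mulVec_mulVec, hAφ, mulVec_smul, smul_smul, inv_mul_cancel₀ hμ, one_smul]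
  have hφ0 : 1 ≤ Module.finrank ℂ (H 0) := by
    have hmem0 : φ ∈ H 0 := (hmem _ _).2 ⟨1, by rw [pow_zero]; exact Submodule.one_le.1 le_rfl,
      one_mulVec φ⟩
    rw [Nat.one_le_iff_ne_zero, Ne, Submodule.finrank_eq_zero]
    intro h0
    rw [h0] at hmem0
    exact hφ ((Submodule.mem_bot ℂ).1 hmem0)
  refine Submodule.eq_top_of_finrank_eq (le_antisymm (Submodule.finrank_le _) ?_)
  rw [Module.finrank_fin_fun]
  refine le_of_stationary_chain (f := fun l => Module.finrank ℂ (H l)) (l₀ := j)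
    (fun l => Submodule.finrank_mono (hmono l)) (fun l hl => ?_) ?_ (by omega)
  · have he := Submodule.eq_of_le_of_finrank_eq (hmono l) hl
    have : H (l + 1) = H (l + 2) := by
      refine le_antisymm (hmono _) fun v hv => ?_
      obtain ⟨z, hz, rfl⟩ := (hmem _ v).1 hv
      rw [pow_succ'] at hz
      refine Submodule.mul_induction_on hz (fun x hx y hy => ?_) fun x y hx hy => ?_
      · have h1 : y *ᵥ φ ∈ H l := by rw [he]; exact (hmem _ _).2 ⟨y, hy, rfl⟩
        obtain ⟨y', hy', hyy⟩ := (hmem _ _).1 h1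
        rw [← mulVec_mulVec, ← hyy, mulVec_mulVec]
        exact (hmem _ _).2 ⟨x * y', by rw [pow_succ']; exact Submodule.mul_mem_mul hx hy', rfl⟩
      · rw [add_mulVec]
        exact add_mem hx hy
    rw [this]
  · have : H j = ⊤ := by
      rw [eq_top_iff]
      intro v _
      obtain ⟨i, hi⟩ := Function.ne_iff.1 hφ
      refine (hmem _ _).2 ⟨vecMulVec v (Pi.single i (φ i)⁻¹), by rw [hj]; trivial, ?_⟩
      rw [vecMulVec_mulVec]
      have hi' : φ i ≠ 0 := hi
      ext j
      simp [hi']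
    rw [this, finrank_top, Module.finrank_fin_fun]

/-- Each of the `k` columns of `M * Y` lies in the range of `M`. -/
theorem finrank_range_mulLeft_le (M : Mat) :
    Module.finrank ℂ (LinearMap.range (LinearMap.mulLeft ℂ M)) ≤ M.rank * k := by
  have h1 : ∀ (X : LinearMap.range (LinearMap.mulLeft ℂ M)) (j : Fin k),
      (fun i => X.1 i j) ∈ LinearMap.range M.mulVecLin := by
    rintro ⟨_, Y, rfl⟩ j
    exact ⟨fun i => Y i j, by ext i; simp [mulVec, dotProduct, mul_apply]⟩
  let Ψ : LinearMap.range (LinearMap.mulLeft ℂ M) →ₗ[ℂ] (Fin k → LinearMap.range M.mulVecLin) :=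
    { toFun := fun X j => ⟨fun i => X.1 i j, h1 X j⟩
      map_add' := fun _ _ => rfl
      map_smul' := fun _ _ => rfl }
  have hΨ : Function.Injective Ψ := by
    intro X Y hXY
    ext i j
    have := congrFun (congrArg Subtype.val (congrFun hXY j)) i
    exact this
  have := LinearMap.finrank_le_finrank_of_injective hΨ
  rw [Module.finrank_pi_fintype] at this
  simpa [Matrix.rank, mul_comm] using this

/-- The rank of the powers starts at `k` and falls by at least one at each step before the first
repetition. -/
theorem exists_rank_stationary (A : Mat) :
    ∃ ν, (A ^ (ν + 1)).rank = (A ^ ν).rank ∧ (A ^ ν).rank + ν ≤ k := by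
  have hle : ∀ ν, (A ^ (ν + 1)).rank ≤ (A ^ ν).rank := by
    intro ν
    rw [pow_succ]
    exact Matrix.rank_mul_le_left _ _
  have hex : ∃ ν, (A ^ (ν + 1)).rank = (A ^ ν).rank := by
    by_contra! hcon
    have : ∀ ν, (A ^ ν).rank + ν ≤ k := by
      intro ν
      induction ν with
      | zero => simp
      | succ ν ih => have := lt_of_le_of_ne (hle ν) (hcon ν); omega
    have := this (k + 1)
    omega
  classical
  refine ⟨Nat.find hex, Nat.find_spec hex, ?_⟩
  have : ∀ ν ≤ Nat.find hex, (A ^ ν).rank + ν ≤ k := by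
    intro ν
    induction ν with
    | zero => simp
    | succ ν ih =>
      intro h
      have h1 := ih (by omega)
      have h2 := lt_of_le_of_ne (hle ν) (Nat.find_min hex (m := ν) (by omega))
      omega
  exact this _ le_rfl

/-- Equal ranks mean equal kernels of `A ^ ν` and `A ^ (ν + 1)`, so `A` is injective on the range of
`A ^ ν`. -/
theorem ker_pow_of_rank_eq {A : Mat} {ν : ℕ} (h : (A ^ (ν + 1)).rank = (A ^ ν).rank)
    {X : Mat} (hX : A * (A ^ ν * X) = 0) : A ^ ν * X = 0 := by
  have hk : LinearMap.ker (A ^ ν).mulVecLin = LinearMap.ker (A ^ (ν + 1)).mulVecLin := by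
    refine Submodule.eq_of_le_of_finrank_eq ?_ ?_
    · intro v hv
      rw [LinearMap.mem_ker, mulVecLin_apply] at hv ⊢
      rw [pow_succ', ← mulVec_mulVec, hv, mulVec_zero]
    · have h1 := LinearMap.finrank_range_add_finrank_ker (A ^ ν).mulVecLin
      have h2 := LinearMap.finrank_range_add_finrank_ker (A ^ (ν + 1)).mulVecLin
      simp only [Matrix.rank] at h
      omega
  have hcol : ∀ j, (A ^ ν) *ᵥ (fun i => X i j) = 0 := by
    intro j
    have : (fun i => X i j) ∈ LinearMap.ker (A ^ (ν + 1)).mulVecLin := by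
      rw [LinearMap.mem_ker, mulVecLin_apply, pow_succ']
      ext i
      have := congrFun (congrFun hX i) j
      rw [← mul_assoc] at this
      exact this
    rw [← hk] at this
    exact this
  ext i j
  exact congrFun (hcol j) i

/-- For `A ∈ V` whose powers from `ν` on have the same rank, all matrices in `A ^ ν ⬝ Mat` are
reached by `A ^ ν` times words of length `r k - 1`, where `r` is the rank of `A ^ ν`. -/
theorem map_mulLeft_pow_eq {V : Submodule ℂ Mat} {A : Mat} (hA : A ∈ V) {ν : ℕ}
    (hν : (A ^ (ν + 1)).rank = (A ^ ν).rank) (hA0 : A ^ ν ≠ 0) {j : ℕ} (hj : V ^ j = ⊤) :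
    (V ^ ((A ^ ν).rank * k - 1)).map (LinearMap.mulLeft ℂ (A ^ ν)) =
      LinearMap.range (LinearMap.mulLeft ℂ (A ^ ν)) := by
  set F : ℕ → Submodule ℂ Mat := fun l => (V ^ l).map (LinearMap.mulLeft ℂ (A ^ ν))
  have hle : ∀ l, F l ≤ LinearMap.range (LinearMap.mulLeft ℂ (A ^ ν)) := fun l =>
    LinearMap.map_le_range
  have hsub : ∀ l, (F l).map (LinearMap.mulLeft ℂ A) ≤ F (l + 1) := by
    rintro l _ ⟨_, ⟨x, hx, rfl⟩, rfl⟩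
    refine ⟨A * x, ?_, ?_⟩
    · rw [pow_succ']
      exact Submodule.mul_mem_mul hA hx
    · simp only [LinearMap.mulLeft_apply]
      rw [← mul_assoc, ← mul_assoc, pow_mul_comm']
  -- Left multiplication by `A` is injective on `F l`, so it embeds `F l` in `F (l + 1)`. If the
  -- dimensions agree, it is onto, and right multiplication by `V` passes this on to the next step.
  have hfr : ∀ l, Module.finrank ℂ ((F l).map (LinearMap.mulLeft ℂ A)) =
      Module.finrank ℂ (F l) := by
    intro l
    rw [← LinearMap.range_domRestrict]
    refine LinearMap.finrank_range_of_inj ((injective_iff_map_eq_zero _).2 ?_)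
    rintro ⟨_, x, hx, rfl⟩ h0
    exact Subtype.ext (ker_pow_of_rank_eq hν h0)
  refine Submodule.eq_of_le_of_finrank_le (hle _) ?_
  refine le_of_stationary_chain (f := fun l => Module.finrank ℂ (F l)) (l₀ := j)
    (fun l => ?_) (fun l hl => ?_) ?_ ?_
  · rw [← hfr l]
    exact Submodule.finrank_mono (hsub l)
  · have he : (F l).map (LinearMap.mulLeft ℂ A) = F (l + 1) :=
      Submodule.eq_of_le_of_finrank_eq (hsub l) ((hfr l).trans hl)
    have he2 : (F (l + 1)).map (LinearMap.mulLeft ℂ A) = F (l + 2) := by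
      refine le_antisymm (hsub _) ?_
      rintro _ ⟨x, hx, rfl⟩
      rw [SetLike.mem_coe, pow_succ] at hx
      refine Submodule.mul_induction_on hx (fun x hx y hy => ?_) fun x y hx hy => ?_
      · have h1 : A ^ ν * x ∈ F (l + 1) := ⟨x, hx, rfl⟩
        rw [← he] at h1
        obtain ⟨_, ⟨z, hz, rfl⟩, hz2⟩ := h1
        simp only [LinearMap.mulLeft_apply] at hz2 ⊢
        rw [← mul_assoc, ← hz2, mul_assoc, mul_assoc]
        exact ⟨A ^ ν * (z * y), ⟨z * y, by rw [pow_succ]; exact Submodule.mul_mem_mul hz hy, rfl⟩,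
          rfl⟩
      · rw [map_add]
        exact add_mem hx hy
    rw [← he2, hfr]
  · have : F j = LinearMap.range (LinearMap.mulLeft ℂ (A ^ ν)) := by
      simp only [F, hj, Submodule.map_top]
    rw [this]
  · have h1 : 1 ≤ Module.finrank ℂ (F 0) := by
      rw [Nat.one_le_iff_ne_zero, Ne, Submodule.finrank_eq_zero]
      intro h0
      have : A ^ ν ∈ F 0 := ⟨1, by rw [pow_zero]; exact Submodule.one_le.1 le_rfl, by simp⟩
      rw [h0] at this
      exact hA0 ((Submodule.mem_bot ℂ).1 this)
    have := finrank_range_mulLeft_le (A ^ ν)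
    omega

/-- With `ν ≤ k - r` and `r ≤ k - 1` the total is at most `k ^ 2`; the truncated `r * k - 1` is only
bounded by `r * k`, so `r = 0` needs no separate treatment. -/
theorem word_length_le {r ν k : ℕ} (h : r + 1 ≤ k) (hν : r + ν ≤ k) :
    (k - 1) + (ν + (r * k - 1)) ≤ k ^ 2 := by
  obtain ⟨s, rfl⟩ : ∃ s, k = r + 1 + s := ⟨k - (r + 1), by omega⟩
  have h1 : (r + 1 + s - 1) + (ν + (r * (r + 1 + s) - 1)) ≤
      (r + s) + ((s + 1) + r * (r + 1 + s)) := by omega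
  refine h1.trans ?_
  nlinarith [Nat.zero_le (r * s), Nat.zero_le (s * s)]

/-- An element with nonzero trace has an eigenvector `φ` with nonzero eigenvalue. Words reach any
column vector from `φ`, and a power of `A` followed by words realizes any row to the right of `φ`;
together they give all rank one matrices. -/
theorem exists_pow_eq_top_of_trace_ne_zero {V : Submodule ℂ Mat} {A : Mat}
    (hA : A ∈ V) (htr : A.trace ≠ 0) {j : ℕ} (hj : V ^ j = ⊤) : ∃ e ≤ k ^ 2, V ^ e = ⊤ := by
  obtain ⟨μ, φ, hμ, hφ, hAφ⟩ := exists_eigenvector_of_trace_ne_zero htr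
  obtain ⟨ν, hν, hνk⟩ := exists_rank_stationary A
  have hpow : ∀ i, A ^ i *ᵥ φ = μ ^ i • φ := by
    intro i
    induction i with
    | zero => simp
    | succ i ih => rw [pow_succ, ← mulVec_mulVec, hAφ, mulVec_smul, ih, smul_smul, pow_succ']
  have hA0 : A ^ ν ≠ 0 := by
    intro h0
    have := hpow ν
    rw [h0, zero_mulVec] at this
    exact smul_ne_zero (pow_ne_zero ν hμ) hφ this.symm
  have key := map_mulLeft_pow_eq hA hν hA0 hj
  set r := (A ^ ν).rank with hr
  have hmem : ∀ X, A ^ ν * X ∈ V ^ (ν + (r * k - 1)) := by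
    intro X
    have h1 : A ^ ν * X ∈ LinearMap.range (LinearMap.mulLeft ℂ (A ^ ν)) := ⟨X, rfl⟩
    rw [← key] at h1
    obtain ⟨Y, hY, hXY⟩ := h1
    rw [← hXY, pow_add]
    exact Submodule.mul_mem_mul (Submodule.pow_mem_pow _ hA ν) hY
  -- Full rank forces `ν = 0`, and `key` alone already says that `V ^ (k * k - 1)` is everything.
  -- Otherwise the detour through `φ` stays within `k ^ 2` letters.
  rcases (show r = k ∨ r + 1 ≤ k by omega) with h | h
  · have hν0 : ν = 0 := by omega
    refine ⟨ν + (r * k - 1), ?_, ?_⟩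
    · rw [hν0, h, sq]; omega
    · rw [eq_top_iff]
      intro X _
      have := hmem X
      rw [hν0, pow_zero, one_mul] at this
      rwa [hν0]
  · refine ⟨(k - 1) + (ν + (r * k - 1)), ?_, ?_⟩
    · exact word_length_le h hνk
    · have hvec : ∀ χ ψ : Fin k → ℂ, vecMulVec χ ψ ∈ V ^ ((k - 1) + (ν + (r * k - 1))) := by
        intro χ ψ
        have h1 := map_pow_mulVec_eq_top hA hμ hφ hAφ hj
        have h2 : χ ∈ (V ^ (k - 1)).map ((Matrix.mulVecBilin ℂ ℂ).flip φ) := by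
          rw [h1]; trivial
        obtain ⟨y, hy, hyχ⟩ := h2
        -- `A ^ ν` multiplies `φ` by `μ ^ ν`, and `y` then carries `φ` to `χ`.
        have h3 : vecMulVec χ ψ = y * (A ^ ν * ((μ ^ ν)⁻¹ • vecMulVec φ ψ)) := by
          rw [mul_smul_comm, mul_vecMulVec, hpow, ← smul_vecMulVec, smul_smul,
            inv_mul_cancel₀ (pow_ne_zero ν hμ), one_smul, mul_vecMulVec]
          congr 1
          exact hyχ.symm
        rw [h3, pow_add]
        exact Submodule.mul_mem_mul hy (hmem _)
      rw [eq_top_iff]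
      intro X _
      rw [matrix_eq_sum_single X]
      refine Submodule.sum_mem _ fun i _ => Submodule.sum_mem _ fun i' _ => ?_
      have : single i i' (X i i') = vecMulVec (Pi.single i (X i i')) (Pi.single i' 1) := by
        ext a b
        rw [single_apply, vecMulVec_apply, Pi.single_apply, Pi.single_apply, mul_ite, mul_one,
          mul_zero, ← ite_and]
        exact if_congr ⟨fun h => ⟨h.2.symm, h.1.symm⟩, fun h => ⟨h.2.symm, h.1.symm⟩⟩ rfl rfl
      rw [this]
      exact hvec _ _

/-- The quantum Wielandt inequality: if the words of some length span the matrix algebra, then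
so do the words of any length from `k ^ 4` on. -/
theorem pow_eq_top_of_wielandt (hk : 1 ≤ k) {S : Submodule ℂ Mat} {l : ℕ} (hl : 1 ≤ l)
    (h : S ^ l = ⊤) {N : ℕ} (hN : k ^ 4 ≤ N) : S ^ N = ⊤ := by
  obtain ⟨j, hj1, hj2, A, hA, htr⟩ := exists_trace_ne_zero hk hl h
  have hS := mul_top_of_pow_eq_top hl h
  have h1 : (S ^ j) ^ l = ⊤ := by
    rw [← pow_mul]
    exact pow_eq_top_of_le hS h (Nat.le_mul_of_pos_left l hj1)
  obtain ⟨e, he, hV⟩ := exists_pow_eq_top_of_trace_ne_zero hA htr h1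
  rw [← pow_mul] at hV
  refine pow_eq_top_of_le hS hV (le_trans ?_ hN)
  calc j * e ≤ k ^ 2 * k ^ 2 := Nat.mul_le_mul hj2 he
    _ = k ^ 4 := by ring

end Wielandt

end SpinChain

namespace SpinChain

open Matrix

/-! ### Words in a tuple and positivity of the map they define. -/

section Words

variable {n k : ℕ}

local notation "Mat" => Matrix (Fin k) (Fin k) ℂ

/-- The word `B_{μ_1} ⋯ B_{μ_N}`. -/
def word (B : Fin n → Mat) {N : ℕ} (μ : Fin N → Fin n) : Mat :=
  (List.ofFn fun i => B (μ i)).prod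

theorem word_zero (B : Fin n → Mat) (μ : Fin 0 → Fin n) : word B μ = 1 := by
  simp [word]

theorem word_cons (B : Fin n → Mat) {N : ℕ} (a : Fin n) (μ : Fin N → Fin n) :
    word B (Fin.cons a μ : Fin (N + 1) → Fin n) = B a * word B μ := by
  simp [word]

theorem word_append (B : Fin n → Mat) {M N : ℕ} (μ : Fin M → Fin n) (ν : Fin N → Fin n) :
    word B (Fin.append μ ν) = word B μ * word B ν := by
  rw [word, word, word, ← List.prod_append, ← List.ofFn_fin_append]
  congr 2
  ext1 i
  refine Fin.addCases (fun j => ?_) (fun j => ?_) i <;> simp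

theorem gammaMap_apply (B : Fin n → Mat) (N : ℕ) (C : Mat) (μ : Fin N → Fin n) :
    gammaMap B N C μ = (C * (word B μ)ᴴ).trace := by
  have h : (List.ofFn fun i : Fin N => (B (μ i.rev)).conjTranspose).prod = (word B μ)ᴴ := by
    rw [word, conjTranspose_list_prod]
    congr 1
    refine List.ext_getElem (by simp) fun i h1 h2 => ?_
    simp only [List.getElem_ofFn, List.getElem_reverse, List.getElem_map, List.length_map,
      List.length_ofFn]
    congr 3
    ext
    simp only [Fin.val_rev]
    omega
  simp only [gammaMap]
  rw [← h]
  rfl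

/-- The span of the matrices of the tuple. -/
def tupleSpan (B : Fin n → Mat) : Submodule ℂ Mat := Submodule.span ℂ (Set.range B)

theorem tupleSpan_pow (B : Fin n → Mat) (N : ℕ) :
    tupleSpan B ^ N = Submodule.span ℂ (Set.range fun μ : Fin N → Fin n => word B μ) := by
  induction N with
  | zero =>
    rw [pow_zero, Submodule.one_eq_span]
    congr 1
    ext x
    simp [word_zero]
  | succ N ih =>
    rw [pow_succ', ih, tupleSpan, Submodule.span_mul_span]
    congr 1
    ext x
    simp only [Set.mem_mul, Set.mem_range]
    constructor
    · rintro ⟨_, ⟨a, rfl⟩, _, ⟨μ, rfl⟩, rfl⟩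
      exact ⟨Fin.cons a μ, word_cons B a μ⟩
    · rintro ⟨μ, rfl⟩
      refine ⟨B (μ 0), ⟨μ 0, rfl⟩, word B (Fin.tail μ), ⟨Fin.tail μ, rfl⟩, ?_⟩
      rw [← word_cons, Fin.cons_self_tail]

theorem krausMap_apply (B : Fin n → Mat) (A : Mat) :
    krausMap B A = ∑ a, B a * A * (B a)ᴴ := by
  simp [krausMap, mul_assoc]

theorem krausMap_pow_apply (B : Fin n → Mat) (N : ℕ) (A : Mat) :
    (krausMap B ^ N) A = ∑ μ : Fin N → Fin n, word B μ * A * (word B μ)ᴴ := by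
  induction N with
  | zero => simp [word_zero]
  | succ N ih =>
    rw [pow_succ', Module.End.mul_apply, ih, krausMap_apply,
      ← (Fin.consEquiv fun _ => Fin n).sum_comp, Fintype.sum_prod_type]
    refine Finset.sum_congr rfl fun a _ => ?_
    rw [Finset.mul_sum, Finset.sum_mul]
    refine Finset.sum_congr rfl fun μ _ => ?_
    have : word B ((Fin.consEquiv fun _ => Fin n) (a, μ)) = B a * word B μ := word_cons B a μ
    rw [this, conjTranspose_mul]
    noncomm_ring

/-- The words of length `N` span the matrix algebra iff no nonzero matrix is orthogonal to them. -/
theorem tupleSpan_pow_eq_top_iff (B : Fin n → Mat) (N : ℕ) :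
    tupleSpan B ^ N = ⊤ ↔
      ∀ Z : Mat, (∀ μ : Fin N → Fin n, (Z * (word B μ)ᴴ).trace = 0) → Z = 0 := by
  constructor
  · intro h Z hZ
    have h1 : ∀ X : Mat, (Z * Xᴴ).trace = 0 := by
      intro X
      have hX : X ∈ tupleSpan B ^ N := by rw [h]; trivial
      rw [tupleSpan_pow] at hX
      induction hX using Submodule.span_induction with
      | mem x hx => obtain ⟨μ, rfl⟩ := hx; exact hZ μ
      | zero => simp
      | add x y _ _ hx hy => rw [conjTranspose_add, mul_add, trace_add, hx, hy, add_zero]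
      | smul c x _ hx => rw [conjTranspose_smul, mul_smul_comm, trace_smul, hx, smul_zero]
    exact trace_mul_conjTranspose_self_eq_zero_iff.1 (h1 Z)
  · intro h
    by_contra hne
    obtain ⟨f, hf0, hf⟩ := Submodule.exists_le_ker_of_lt_top _ (lt_top_iff_ne_top.2 hne)
    set Z : Mat := Matrix.of fun i j => star (f (single i j 1)) with hZ
    have hfZ : ∀ X : Mat, (Z * Xᴴ).trace = star (f X) := by
      intro X
      conv_rhs => rw [matrix_eq_sum_single X]
      simp only [map_sum, star_sum]
      simp only [trace, diag_apply, mul_apply, conjTranspose_apply]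
      refine Finset.sum_congr rfl fun i _ => Finset.sum_congr rfl fun j _ => ?_
      have : single i j (X i j) = X i j • single i j (1 : ℂ) := by simp
      rw [this, map_smul, smul_eq_mul, star_mul', hZ, of_apply, mul_comm]
    have hZ0 : Z = 0 := by
      refine h Z fun μ => ?_
      rw [hfZ]
      have : word B μ ∈ tupleSpan B ^ N := by
        rw [tupleSpan_pow]
        exact Submodule.subset_span ⟨μ, rfl⟩
      rw [LinearMap.mem_ker.1 (hf this), star_zero]
    refine hf0 (LinearMap.ext fun X => ?_)
    have := hfZ X
    rw [hZ0, zero_mul, trace_zero] at this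
    simpa using this.symm

/-- A linear map that sends nonzero positive semidefinite matrices to positive definite ones. -/
def StrictlyPositive (T : MatMap k) : Prop :=
  ∀ A : Mat, A.PosSemidef → A ≠ 0 → (T A).PosDef

theorem trace_mul_pos {A P : Mat} (hA : A.PosSemidef) (hA0 : A ≠ 0) (hP : P.PosDef) :
    0 < (A * P).trace := by
  open scoped MatrixOrder in
  obtain ⟨C, rfl⟩ := CStarAlgebra.nonneg_iff_eq_star_mul_self.1 hA.nonneg
  obtain ⟨R, hR⟩ := CStarAlgebra.nonneg_iff_eq_star_mul_self.1 hP.posSemidef.nonneg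
  rw [star_eq_conjTranspose] at *
  have hRu : IsUnit R := by
    have h1 := hP.isUnit
    rw [hR, Matrix.isUnit_iff_isUnit_det, det_mul] at h1
    exact (Matrix.isUnit_iff_isUnit_det _).2 (isUnit_of_mul_isUnit_right h1)
  have e : (Cᴴ * C * P).trace = ((R * Cᴴ)ᴴ * (R * Cᴴ)).trace := by
    rw [hR, conjTranspose_mul, conjTranspose_conjTranspose, mul_assoc, trace_mul_comm]
    congr 1
    noncomm_ring
  rw [e]
  refine lt_of_le_of_ne (posSemidef_conjTranspose_mul_self _).trace_nonneg (Ne.symm ?_)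
  rw [Ne, trace_conjTranspose_mul_self_eq_zero_iff]
  intro h0
  have h1 := hRu.mul_right_eq_zero.1 h0
  rw [conjTranspose_eq_zero] at h1
  exact hA0 (by rw [h1, mul_zero])

/-- If the quadratic form of the image vanishes at `v ≠ 0`, then `A` kills `(word B μ)ᴴ v` for every
word, hence `Xᴴ v` for every matrix `X`. These vectors exhaust `ℂᵏ`, so `A = 0`. -/
theorem strictlyPositive_of_pow_eq_top {B : Fin n → Mat} {N : ℕ} (h : tupleSpan B ^ N = ⊤) :
    StrictlyPositive (krausMap B ^ N) := by
  intro A hA hA0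
  have hsd : ((krausMap B ^ N) A).PosSemidef := by
    rw [krausMap_pow_apply]
    exact posSemidef_sum _ fun μ _ => hA.mul_mul_conjTranspose_same _
  refine PosDef.of_dotProduct_mulVec_pos hsd.1 fun v hv => ?_
  refine lt_of_le_of_ne (hsd.dotProduct_mulVec_nonneg v) (Ne.symm fun h0 => ?_)
  have hterm : ∀ μ : Fin N → Fin n, star v ⬝ᵥ (word B μ * A * (word B μ)ᴴ) *ᵥ v = 0 := by
    rw [krausMap_pow_apply, sum_mulVec, dotProduct_sum] at h0
    have := (Finset.sum_eq_zero_iff_of_nonneg fun μ _ =>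
      (hA.mul_mul_conjTranspose_same (word B μ)).dotProduct_mulVec_nonneg v).1 h0
    exact fun μ => this μ (Finset.mem_univ _)
  have hAw : ∀ μ : Fin N → Fin n, A *ᵥ ((word B μ)ᴴ *ᵥ v) = 0 := by
    intro μ
    rw [← hA.dotProduct_mulVec_zero_iff, ← hterm μ, star_mulVec, conjTranspose_conjTranspose,
      ← mulVec_mulVec, ← mulVec_mulVec, dotProduct_mulVec (star v)]
  refine hA0 ?_
  have hall : ∀ X : Mat, A *ᵥ (Xᴴ *ᵥ v) = 0 := by
    intro X
    have hX : X ∈ tupleSpan B ^ N := by rw [h]; trivial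
    rw [tupleSpan_pow] at hX
    induction hX using Submodule.span_induction with
    | mem x hx => obtain ⟨μ, rfl⟩ := hx; exact hAw μ
    | zero => simp
    | add x y _ _ hx hy => rw [conjTranspose_add, add_mulVec, mulVec_add, hx, hy, add_zero]
    | smul c x _ hx => rw [conjTranspose_smul, smul_mulVec, mulVec_smul, hx, smul_zero]
  obtain ⟨i, hi⟩ := Function.ne_iff.1 hv
  have hi' : v i ≠ 0 := hi
  have hw : ∀ w : Fin k → ℂ, A *ᵥ w = 0 := by
    intro w
    have := hall (vecMulVec w (Pi.single i (v i)⁻¹))ᴴ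
    rw [conjTranspose_conjTranspose, vecMulVec_mulVec] at this
    simpa [hi'] using this
  ext a b
  have := congrFun (hw (Pi.single b 1)) a
  simpa using this

theorem trace_mul_krausMap (B : Fin n → Mat) (A C : Mat) :
    (A * krausMap B C).trace = (krausMap (fun a => (B a)ᴴ) A * C).trace := by
  rw [krausMap_apply, krausMap_apply, Finset.mul_sum, Finset.sum_mul, trace_sum, trace_sum]
  refine Finset.sum_congr rfl fun a _ => ?_
  rw [conjTranspose_conjTranspose, ← mul_assoc, trace_mul_comm]
  congr 1
  noncomm_ring

theorem trace_mul_krausMap_pow (B : Fin n → Mat) (N : ℕ) (A C : Mat) :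
    (A * (krausMap B ^ N) C).trace = ((krausMap (fun a => (B a)ᴴ) ^ N) A * C).trace := by
  induction N generalizing A C with
  | zero => simp
  | succ N ih =>
    rw [pow_succ, Module.End.mul_apply, ih, trace_mul_krausMap, pow_succ', Module.End.mul_apply]

theorem krausMap_pow_posSemidef (B : Fin n → Mat) (N : ℕ) {A : Mat} (hA : A.PosSemidef) :
    ((krausMap B ^ N) A).PosSemidef := by
  rw [krausMap_pow_apply]
  exact posSemidef_sum _ fun μ _ => hA.mul_mul_conjTranspose_same _

/-- The dual of a strictly positive map is strictly positive. -/
theorem StrictlyPositive.dual {T T' : MatMap k} (hT : StrictlyPositive T)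
    (h : ∀ A C, (A * T C).trace = (T' A * C).trace)
    (hpos : ∀ A : Mat, A.PosSemidef → (T' A).PosSemidef) : StrictlyPositive T' := by
  intro A hA hA0
  refine PosDef.of_dotProduct_mulVec_pos (hpos A hA).1 fun v hv => ?_
  have h1 : star v ⬝ᵥ T' A *ᵥ v = (T' A * vecMulVec v (star v)).trace := by
    rw [mul_vecMulVec, trace_vecMulVec, dotProduct_comm]
  rw [h1, ← h]
  refine trace_mul_pos hA hA0 (hT _ (posSemidef_vecMulVec_self_star v) ?_)
  intro h0
  have : star v ⬝ᵥ v = 0 := by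
    rw [dotProduct_comm, ← trace_vecMulVec, h0, trace_zero]
  exact hv (dotProduct_star_self_eq_zero.1 this)

end Words

end SpinChain

namespace SpinChain

open Matrix Filter Topology

/-! ### Perron-Frobenius theory for strictly positive maps. -/

section PerronFrobenius

open scoped MatrixOrder Matrix.Norms.L2Operator

variable {k : ℕ}

local notation "Mat" => Matrix (Fin k) (Fin k) ℂ

theorem exists_smul_one_le {P : Mat} (hP : P.PosDef) : ∃ c : ℝ, 0 < c ∧ c • (1 : Mat) ≤ P := by
  obtain ⟨c, hc, h⟩ := exists_uniform_lower_bound (isCompact_singleton (x := (0 : ℝ)))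
    (M := fun _ => P) (fun _ _ => continuousOn_const) (fun _ _ => hP)
  exact ⟨c, hc, h 0 rfl⟩

theorem le_norm_smul_one {A : Mat} (hA : A.IsHermitian) : A ≤ ‖A‖ • (1 : Mat) := by
  have h : IsSelfAdjoint A := hA
  have := h.le_algebraMap_norm_self
  rwa [Algebra.algebraMap_eq_smul_one] at this

theorem exists_smul_le {P A : Mat} (hP : P.PosDef) (hA : A.IsHermitian) :
    ∃ ε : ℝ, 0 < ε ∧ ε • A ≤ P := by
  obtain ⟨c, hc, h⟩ := exists_smul_one_le hP
  refine ⟨c / (‖A‖ + 1), by positivity, ?_⟩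
  calc (c / (‖A‖ + 1)) • A ≤ (c / (‖A‖ + 1)) • (‖A‖ • (1 : Mat)) :=
        smul_le_smul_of_nonneg_left (le_norm_smul_one hA) (by positivity)
    _ = (c / (‖A‖ + 1) * ‖A‖) • (1 : Mat) := by rw [smul_smul]
    _ ≤ c • (1 : Mat) := by
        refine smul_le_smul_of_nonneg_right ?_ zero_le_one
        rw [div_mul_eq_mul_div, div_le_iff₀ (by positivity)]
        nlinarith [norm_nonneg A]
    _ ≤ P := h

theorem StrictlyPositive.nonneg {T : MatMap k} (hT : StrictlyPositive T) {A : Mat} (hA : 0 ≤ A) :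
    0 ≤ T A := by
  by_cases h : A = 0
  · rw [h, map_zero]
  · exact (hT A hA.posSemidef h).posSemidef.nonneg

theorem map_real_smul (T : MatMap k) (c : ℝ) (A : Mat) : T (c • A) = c • T A := by
  have : ∀ M : Mat, c • M = (c : ℂ) • M := fun M => (Complex.coe_smul c M).symm
  rw [this, this, map_smul]

theorem continuous_matMap (T : MatMap k) : Continuous T :=
  LinearMap.continuous_of_finiteDimensional T

theorem isCompact_nonneg_sphere : IsCompact {A : Mat | 0 ≤ A ∧ ‖A‖ = 1} := by
  have : {A : Mat | 0 ≤ A ∧ ‖A‖ = 1} = {A : Mat | 0 ≤ A} ∩ Metric.sphere 0 1 := by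
    ext A
    simp
  have hproper : ProperSpace Mat := FiniteDimensional.proper ℂ _
  rw [this]
  exact (isCompact_sphere _ _).inter_left isClosed_Ici

theorem normalize_nonneg {A : Mat} (hA : 0 ≤ A) (hA0 : A ≠ 0) :
    0 ≤ ‖A‖⁻¹ • A ∧ ‖‖A‖⁻¹ • A‖ = 1 := by
  refine ⟨smul_nonneg (by positivity) hA, ?_⟩
  rw [norm_smul, norm_inv, norm_norm, inv_mul_cancel₀ (norm_ne_zero_iff.2 hA0)]

/-- A strictly positive map has a positive definite eigenvector. -/
theorem StrictlyPositive.exists_eigenvector (hk : 1 ≤ k) {T : MatMap k}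
    (hT : StrictlyPositive T) : ∃ (ρ : ℝ) (X : Mat), 0 < ρ ∧ X.PosDef ∧ T X = ρ • X := by
  have hne : Nonempty (Fin k) := ⟨⟨0, hk⟩⟩
  have hproper : ProperSpace Mat := FiniteDimensional.proper ℂ _
  obtain ⟨C, hC⟩ : ∃ C : ℝ, ∀ A : Mat, 0 ≤ A ∧ ‖A‖ = 1 → ‖T A‖ ≤ C := by
    obtain ⟨C, hC⟩ := isCompact_nonneg_sphere.exists_bound_of_continuousOn
      (continuous_matMap T).continuousOn
    exact ⟨C, fun A hA => hC A hA⟩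
  -- Collatz-Wielandt: the eigenvalue is the largest `ρ` for which `ρ X ≤ T X` has a normalized
  -- solution `X ≥ 0`, and it is attained by compactness.
  set K : Set (Mat × ℝ) := {z | (0 ≤ z.1 ∧ ‖z.1‖ = 1) ∧ 0 ≤ z.2 ∧ z.2 • z.1 ≤ T z.1} with hK
  have hKc : IsCompact K := by
    refine (isCompact_nonneg_sphere.prod (isCompact_Icc (a := (0 : ℝ)) (b := C))).of_isClosed_subset
      ?_ ?_
    · refine IsClosed.inter ?_ (IsClosed.inter ?_ ?_)
      · exact isCompact_nonneg_sphere.isClosed.preimage continuous_fst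
      · exact isClosed_Ici.preimage continuous_snd
      · exact isClosed_le (continuous_snd.smul continuous_fst)
          ((continuous_matMap T).comp continuous_fst)
    · rintro ⟨A, r⟩ ⟨hA, hr, hle⟩
      refine ⟨hA, hr, ?_⟩
      have h1 := CStarAlgebra.norm_le_norm_of_nonneg_of_le (smul_nonneg hr hA.1) hle
      simp only at h1 hA hr
      rw [norm_smul, hA.2, mul_one, Real.norm_of_nonneg hr] at h1
      exact h1.trans (hC A hA)
  have hKne : K.Nonempty := by
    refine ⟨(‖(1 : Mat)‖⁻¹ • 1, 0), normalize_nonneg zero_le_one one_ne_zero, le_rfl, ?_⟩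
    simp only [zero_smul]
    exact hT.nonneg (normalize_nonneg zero_le_one one_ne_zero).1
  obtain ⟨⟨X, ρ⟩, ⟨⟨hX0, hX1⟩, hρ, hle⟩, hmax⟩ :=
    hKc.exists_isMaxOn hKne continuous_snd.continuousOn
  simp only at hX0 hX1 hρ hle
  have hXne : X ≠ 0 := by
    rintro rfl
    simp at hX1
  have hTX := hT X hX0.posSemidef hXne
  have hρpos : 0 < ρ := by
    obtain ⟨ε, hε, h⟩ := exists_smul_le hTX hX0.posSemidef.1
    exact hε.trans_le (hmax (a := (X, ε)) ⟨⟨hX0, hX1⟩, hε.le, h⟩)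
  have heig : T X = ρ • X := by
    by_contra hne
    have hD : 0 ≤ T X - ρ • X := sub_nonneg.2 hle
    -- If the inequality were not an equality, applying `T` to the difference would leave room for
    -- an `ε`, and the normalized `T X` would beat the maximal `ρ`.
    have hTD := hT _ hD.posSemidef (sub_ne_zero.2 hne)
    obtain ⟨ε, hε, h⟩ := exists_smul_le hTD hTX.1
    have hTXne : T X ≠ 0 := by
      intro h0
      have := hTX.re_dotProduct_pos (x := fun _ => 1)
        (fun h => by simpa using congrFun h ⟨0, hk⟩)
      rw [h0] at this
      simp at this
    have h2 : (ρ + ε) • T X ≤ T (T X) := by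
      rw [map_sub, map_real_smul, le_sub_iff_add_le] at h
      rw [add_smul, add_comm]
      exact h
    have h3 := hmax (a := (‖T X‖⁻¹ • T X, ρ + ε))
      ⟨normalize_nonneg (hT.nonneg hX0) hTXne, by positivity, by
        simp only
        rw [map_real_smul, smul_comm]
        exact smul_le_smul_of_nonneg_left h2 (by positivity)⟩
    have h4 : ρ + ε ≤ ρ := h3
    linarith
  refine ⟨ρ, X, hρpos, ?_, heig⟩
  have : X = ρ⁻¹ • T X := by rw [heig, smul_smul, inv_mul_cancel₀ hρpos.ne', one_smul]
  rw [this]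
  exact hTX.smul (inv_pos.2 hρpos)

/-- The real part of the pairing with `Y`. -/
noncomputable def pairing (Y : Mat) : Mat →ₗ[ℝ] ℝ where
  toFun C := (Y * C).trace.re
  map_add' C D := by rw [mul_add, trace_add, Complex.add_re]
  map_smul' c C := by
    rw [mul_smul_comm, trace_smul, Complex.smul_re, RingHom.id_apply]

theorem pairing_coe {Y A : Mat} (hY : Y.IsHermitian) (hA : A.IsHermitian) :
    ((pairing Y A : ℝ) : ℂ) = (Y * A).trace := by
  have h : star (Y * A).trace = (Y * A).trace := by
    rw [← trace_conjTranspose, conjTranspose_mul, hY.eq, hA.eq, trace_mul_comm]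
  exact (Complex.conj_eq_iff_re.1 h)

/-- A Doeblin minorization: on normalized positive semidefinite matrices `U` is bounded below by a
fixed multiple of the identity, by compactness, and homogeneity does the rest. It drives the
geometric contraction of the iterates. -/
theorem exists_doeblin {U : MatMap k} (hU : StrictlyPositive U) {X : Mat} (hX : 0 ≤ X) (Y : Mat) :
    ∃ δ : ℝ, 0 < δ ∧ δ ≤ 1 ∧ ∀ C : Mat, 0 ≤ C → (δ * pairing Y C) • X ≤ U C := by
  obtain ⟨c, hc, hcU⟩ := exists_uniform_lower_bound (isCompact_nonneg_sphere (k := k))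
    (M := fun A => U A)
    (fun i j => ((continuous_matMap U).matrix_elem i j).continuousOn)
    (fun A hA => hU A hA.1.posSemidef (by rintro rfl; simpa using hA.2))
  have hcont : Continuous (pairing Y) := LinearMap.continuous_of_finiteDimensional _
  obtain ⟨M, hM⟩ := (isCompact_nonneg_sphere (k := k)).exists_bound_of_continuousOn
    hcont.continuousOn
  set M' := max M 0
  have hM'0 : 0 ≤ M' := le_max_right _ _
  have hXn := norm_nonneg X
  refine ⟨min 1 (c / (M' * ‖X‖ + 1)), lt_min one_pos (by positivity), min_le_left _ _, ?_⟩
  set δ := min 1 (c / (M' * ‖X‖ + 1)) with hδ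
  have hδ0 : 0 < δ := lt_min one_pos (by positivity)
  have hδc : δ * (M' * ‖X‖) ≤ c := by
    have h1 : δ * (M' * ‖X‖ + 1) ≤ c := by
      rw [← le_div_iff₀ (by positivity)]
      exact min_le_right _ _
    nlinarith
  have hsph : ∀ C : Mat, 0 ≤ C → ‖C‖ = 1 → (δ * pairing Y C) • X ≤ U C := by
    intro C hC hC1
    have hp : pairing Y C ≤ M' :=
      (le_abs_self _).trans ((hM C ⟨hC, hC1⟩).trans (le_max_left _ _))
    calc (δ * pairing Y C) • X ≤ (δ * M') • X :=
          smul_le_smul_of_nonneg_right (mul_le_mul_of_nonneg_left hp hδ0.le) hX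
      _ ≤ (δ * M') • (‖X‖ • (1 : Mat)) :=
          smul_le_smul_of_nonneg_left (le_norm_smul_one hX.posSemidef.1) (by positivity)
      _ = (δ * (M' * ‖X‖)) • (1 : Mat) := by rw [smul_smul, mul_assoc]
      _ ≤ c • (1 : Mat) := smul_le_smul_of_nonneg_right hδc zero_le_one
      _ ≤ U C := hcU C ⟨hC, hC1⟩
  intro C hC
  by_cases h0 : C = 0
  · rw [h0, map_zero, map_zero, mul_zero, zero_smul]
  · have hn := normalize_nonneg hC h0
    have h1 := hsph _ hn.1 hn.2
    rw [map_real_smul, map_smul, smul_eq_mul, mul_left_comm, mul_smul] at h1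
    have h2 := smul_le_smul_of_nonneg_left h1 (norm_nonneg C)
    rwa [smul_smul, smul_smul, mul_inv_cancel₀ (norm_ne_zero_iff.2 h0), one_mul, smul_smul,
      mul_inv_cancel₀ (norm_ne_zero_iff.2 h0), one_smul] at h2

theorem tendsto_pow_hermitian {U : MatMap k} (hU : StrictlyPositive U) {X Y : Mat} (hX : X.PosDef)
    (hUX : U X = X) (hY : ∀ C, pairing Y (U C) = pairing Y C) (hXY : pairing Y X = 1) {A : Mat}
    (hA : A.IsHermitian) :
    Tendsto (fun j => (U ^ j) A) atTop (𝓝 (pairing Y A • X)) := by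
  obtain ⟨δ, hδ0, hδ1, hδ⟩ := exists_doeblin hU hX.posSemidef.nonneg Y
  set A₀ := A - pairing Y A • X with hA₀
  have hA₀h : A₀.IsHermitian := hA.sub (by
    rw [IsHermitian, conjTranspose_smul, hX.1.eq, star_trivial])
  have hA₀0 : pairing Y A₀ = 0 := by
    rw [hA₀, map_sub, map_smul, hXY, smul_eq_mul, mul_one, sub_self]
  have hpow : ∀ j, (U ^ j) A = (U ^ j) A₀ + pairing Y A • X := by
    intro j
    have hX' : (U ^ j) X = X := by
      induction j with
      | zero => simp
      | succ j ih => rw [pow_succ, Module.End.mul_apply, hUX, ih]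
    rw [hA₀, map_sub, map_real_smul, hX', sub_add_cancel]
  have hpair : ∀ j, pairing Y ((U ^ j) A₀) = 0 := by
    intro j
    induction j with
    | zero => simpa using hA₀0
    | succ j ih => rw [pow_succ', Module.End.mul_apply, hY, ih]
  obtain ⟨s, hs0, hs1, hs2⟩ : ∃ s : ℝ, 0 ≤ s ∧ 0 ≤ A₀ + s • X ∧ 0 ≤ s • X - A₀ := by
    obtain ⟨ε₁, h1, h1'⟩ := exists_smul_le hX hA₀h
    obtain ⟨ε₂, h2, h2'⟩ := exists_smul_le hX hA₀h.neg
    have hX0 := hX.posSemidef.nonneg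
    have e1 : A₀ ≤ ε₁⁻¹ • X := by
      have := smul_le_smul_of_nonneg_left h1' (inv_pos.2 h1).le
      rwa [smul_smul, inv_mul_cancel₀ h1.ne', one_smul] at this
    have e2 : -A₀ ≤ ε₂⁻¹ • X := by
      have := smul_le_smul_of_nonneg_left h2' (inv_pos.2 h2).le
      rwa [smul_smul, inv_mul_cancel₀ h2.ne', one_smul] at this
    have i1 : 0 < ε₁⁻¹ := inv_pos.2 h1
    have i2 : 0 < ε₂⁻¹ := inv_pos.2 h2
    refine ⟨ε₁⁻¹ + ε₂⁻¹, by positivity, ?_, ?_⟩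
    · have h3 : 0 ≤ ε₂⁻¹ • X - -A₀ := sub_nonneg.2 e2
      have : A₀ + (ε₁⁻¹ + ε₂⁻¹) • X = (ε₂⁻¹ • X - -A₀) + ε₁⁻¹ • X := by module
      rw [this]
      exact add_nonneg h3 (smul_nonneg i1.le hX0)
    · have h3 : 0 ≤ ε₁⁻¹ • X - A₀ := sub_nonneg.2 e1
      have : (ε₁⁻¹ + ε₂⁻¹) • X - A₀ = (ε₁⁻¹ • X - A₀) + ε₂⁻¹ • X := by module
      rw [this]
      exact add_nonneg h3 (smul_nonneg i2.le hX0)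
  -- With `r = s (1 - δ) ^ j`, both `r X ± U ^ j A₀` are positive semidefinite and pair to `r` with
  -- `Y`. The minorization lets `δ r X` be subtracted from their images under `U`, which leaves `(1
  -- - δ) r X ± U ^ (j + 1) A₀`.
  have hstep : ∀ j, 0 ≤ (U ^ j) A₀ + (s * (1 - δ) ^ j) • X ∧
      0 ≤ (s * (1 - δ) ^ j) • X - (U ^ j) A₀ := by
    intro j
    induction j with
    | zero => simpa using ⟨hs1, sub_nonneg.1 hs2⟩
    | succ j ih =>
      set r := s * (1 - δ) ^ j
      have hr : s * (1 - δ) ^ (j + 1) = r - δ * r := by simp only [r]; ring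
      rw [hr]
      have h1 := sub_nonneg.2 (hδ _ ih.1)
      have h2 := sub_nonneg.2 (hδ _ ih.2)
      rw [map_add U, map_add (pairing Y), hpair, map_smul (pairing Y), hXY, map_real_smul,
        hUX] at h1
      rw [map_sub U, map_sub (pairing Y), hpair, map_smul (pairing Y), hXY, map_real_smul,
        hUX] at h2
      rw [pow_succ', Module.End.mul_apply]
      constructor
      · convert h1 using 1
        simp only [smul_eq_mul]
        module
      · convert h2 using 1
        simp only [smul_eq_mul]
        module
  have hlim : Tendsto (fun j => s * (1 - δ) ^ j) atTop (𝓝 0) := by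
    have := (tendsto_pow_atTop_nhds_zero_of_lt_one (sub_nonneg.2 hδ1)
      (by linarith : 1 - δ < 1)).const_mul s
    rwa [mul_zero] at this
  have hlimX : Tendsto (fun j => (s * (1 - δ) ^ j) • X) atTop (𝓝 0) := by
    have := hlim.smul_const X
    rwa [zero_smul] at this
  have hsum : Tendsto (fun j => (U ^ j) A₀ + (s * (1 - δ) ^ j) • X) atTop (𝓝 0) := by
    refine squeeze_zero_norm (a := fun j => 2 * ‖(s * (1 - δ) ^ j) • X‖) (fun j => ?_) ?_
    · have hle : (U ^ j) A₀ + (s * (1 - δ) ^ j) • X ≤ (2 : ℝ) • ((s * (1 - δ) ^ j) • X) := by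
        rw [← sub_nonneg]
        have := (hstep j).2
        convert this using 1
        module
      have := CStarAlgebra.norm_le_norm_of_nonneg_of_le (hstep j).1 hle
      rwa [norm_smul, Real.norm_ofNat] at this
    · have := hlimX.norm.const_mul 2
      rwa [norm_zero, mul_zero] at this
  have hA₀lim : Tendsto (fun j => (U ^ j) A₀) atTop (𝓝 0) := by
    have := hsum.sub hlimX
    simpa using this
  simp_rw [hpow]
  have := hA₀lim.add_const (pairing Y A • X)
  rwa [zero_add] at this

/-- The Perron-Frobenius theorem for strictly positive maps: the iterates converge, after
normalization, to a map of rank one. -/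
theorem StrictlyPositive.exists_tendsto_pow (hk : 1 ≤ k) {T T' : MatMap k}
    (hT : StrictlyPositive T) (hT' : StrictlyPositive T')
    (h : ∀ A C, (A * T C).trace = (T' A * C).trace) :
    ∃ (ρ : ℝ) (X Y : Mat), 0 < ρ ∧ X.PosDef ∧ Y.PosDef ∧
      ∀ A, Tendsto (fun j => ρ ^ j • (T ^ j) A) atTop (𝓝 ((Y * A).trace • X)) := by
  obtain ⟨r, X, hr, hX, hTX⟩ := hT.exists_eigenvector hk
  obtain ⟨r', Y₀, hr', hY₀, hTY⟩ := hT'.exists_eigenvector hk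
  have hne : Nonempty (Fin k) := ⟨⟨0, hk⟩⟩
  have hXne : X ≠ 0 := by
    rintro rfl
    have := hX.re_dotProduct_pos (x := fun _ => 1) (fun h => by simpa using congrFun h ⟨0, hk⟩)
    simp at this
  have hY₀ne : Y₀ ≠ 0 := by
    rintro rfl
    have := hY₀.re_dotProduct_pos (x := fun _ => 1) (fun h => by simpa using congrFun h ⟨0, hk⟩)
    simp at this
  have htr : 0 < pairing Y₀ X := (Complex.pos_iff.1 (trace_mul_pos hY₀.posSemidef hY₀ne hX)).1
  have hpair : ∀ C, pairing Y₀ (T C) = r' * pairing Y₀ C := by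
    intro C
    change (Y₀ * T C).trace.re = r' * (Y₀ * C).trace.re
    rw [h, hTY, smul_mul_assoc, trace_smul, Complex.smul_re, smul_eq_mul]
  -- Pairing the two eigenvectors with each other identifies the eigenvalues of `T` and its dual.
  have hrr : r = r' := by
    have h1 := hpair X
    rw [hTX, map_smul, smul_eq_mul] at h1
    exact mul_right_cancel₀ htr.ne' h1
  subst hrr
  set Y := (pairing Y₀ X)⁻¹ • Y₀ with hY
  have hYpd : Y.PosDef := hY₀.smul (inv_pos.2 htr)
  have hYp : ∀ C, pairing Y C = (pairing Y₀ X)⁻¹ * pairing Y₀ C := by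
    intro C
    change (Y * C).trace.re = _ * (Y₀ * C).trace.re
    rw [hY, smul_mul_assoc, trace_smul, Complex.smul_re, smul_eq_mul]
  set U : MatMap k := ((r⁻¹ : ℝ) : ℂ) • T with hU
  have hUa : ∀ C, U C = r⁻¹ • T C := fun C => rfl
  have hUpow : ∀ j C, (U ^ j) C = (r⁻¹) ^ j • (T ^ j) C := by
    intro j C
    rw [hU, smul_pow, LinearMap.smul_apply, ← Complex.ofReal_pow, Complex.coe_smul]
  have hUs : StrictlyPositive U := fun A hA hA0 => by
    rw [hUa]
    exact (hT A hA hA0).smul (inv_pos.2 hr)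
  have hUX : U X = X := by rw [hUa, hTX, smul_smul, inv_mul_cancel₀ hr.ne', one_smul]
  have hUY : ∀ C, pairing Y (U C) = pairing Y C := by
    intro C
    rw [hUa, map_smul, hYp, hYp, hpair, smul_eq_mul, mul_left_comm, ← mul_assoc r⁻¹,
      inv_mul_cancel₀ hr.ne', one_mul]
  have hXY : pairing Y X = 1 := by rw [hYp, inv_mul_cancel₀ htr.ne']
  -- The `ρ` of the statement is the inverse of the Perron eigenvalue. A general `A` is split into
  -- Hermitian and anti-Hermitian parts.
  refine ⟨r⁻¹, X, Y, inv_pos.2 hr, hX, hYpd, fun A => ?_⟩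
  simp_rw [← hUpow]
  have hre : ((realPart A : selfAdjoint Mat) : Mat).IsHermitian := (realPart A).2
  have him : ((imaginaryPart A : selfAdjoint Mat) : Mat).IsHermitian := (imaginaryPart A).2
  have h1 := tendsto_pow_hermitian hUs hX hUX hUY hXY hre
  have h2 := tendsto_pow_hermitian hUs hX hUX hUY hXY him
  have h3 := h1.add (h2.const_smul Complex.I)
  have e1 : ∀ j, (U ^ j) A =
      (U ^ j) (realPart A : Mat) + Complex.I • (U ^ j) (imaginaryPart A : Mat) := by
    intro j
    rw [← map_smul, ← map_add, realPart_add_I_smul_imaginaryPart]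
  have e2 : (Y * A).trace • X = pairing Y (realPart A : Mat) • X +
      Complex.I • pairing Y (imaginaryPart A : Mat) • X := by
    conv_lhs => rw [← realPart_add_I_smul_imaginaryPart A]
    rw [mul_add, trace_add, mul_smul_comm, trace_smul, ← pairing_coe hYpd.1 hre,
      ← pairing_coe hYpd.1 him, add_smul, smul_assoc, Complex.coe_smul, Complex.coe_smul]
  simp_rw [e1]
  rw [e2]
  exact h3

end PerronFrobenius

end SpinChain

namespace SpinChain

open Matrix Filter Topology

/-! ### Gram matrices of long words. -/

section Gram

variable {n k : ℕ}

local notation "Mat" => Matrix (Fin k) (Fin k) ℂ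

/-- The Gram matrix of the entries of a family of matrices is entrywise `η`-close to the
identity. -/
def NearlyOrthonormal {β : Type*} [Fintype β] (w : β → Mat) (η : ℝ) : Prop :=
  ∀ a b c d : Fin k, ‖∑ μ, star (w μ a b) * w μ c d - if a = c ∧ b = d then 1 else 0‖ < η

/-- The squared Hilbert-Schmidt norm. -/
noncomputable def hsSq (Z : Mat) : ℝ := ∑ i, ∑ j, ‖Z i j‖ ^ 2

theorem hsSq_nonneg (Z : Mat) : 0 ≤ hsSq Z :=
  Finset.sum_nonneg fun _ _ => Finset.sum_nonneg fun _ _ => by positivity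

theorem hsSq_eq_zero {Z : Mat} (h : hsSq Z = 0) : Z = 0 := by
  ext i j
  have h1 := (Finset.sum_eq_zero_iff_of_nonneg fun i _ =>
    Finset.sum_nonneg fun j _ => by positivity).1 h i (Finset.mem_univ _)
  have h2 := (Finset.sum_eq_zero_iff_of_nonneg fun j _ => by positivity).1 h1 j
    (Finset.mem_univ _)
  simpa using h2

theorem hsSq_eq_trace (Z : Mat) : ((hsSq Z : ℝ) : ℂ) = (Zᴴ * Z).trace := by
  rw [trace, hsSq, Finset.sum_comm, Complex.ofReal_sum]
  refine Finset.sum_congr rfl fun i _ => ?_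
  rw [diag_apply, mul_apply, Complex.ofReal_sum]
  refine Finset.sum_congr rfl fun j _ => ?_
  rw [conjTranspose_apply, RCLike.star_def, mul_comm, Complex.mul_conj, Complex.normSq_eq_norm_sq]

theorem sum_norm_le (Z : Mat) : ∑ i, ∑ j, ‖Z i j‖ ≤ k * √(hsSq Z) := by
  rw [← abs_of_nonneg (Finset.sum_nonneg fun i _ => Finset.sum_nonneg fun j _ =>
    norm_nonneg (Z i j) : 0 ≤ ∑ i, ∑ j, ‖Z i j‖),
    ← abs_of_nonneg (by positivity : 0 ≤ (k : ℝ) * √(hsSq Z)), ← sq_le_sq, mul_pow,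
    Real.sq_sqrt (hsSq_nonneg Z), hsSq]
  simp_rw [← Fintype.sum_prod_type' (fun i j => ‖Z i j‖),
    ← Fintype.sum_prod_type' (fun i j => ‖Z i j‖ ^ 2)]
  have := sq_sum_le_card_mul_sum_sq (s := (Finset.univ : Finset (Fin k × Fin k)))
    (f := fun p => ‖Z p.1 p.2‖)
  simpa [sq] using this

/-- Expanding in entries, the difference is the deviation of the Gram matrix from the identity,
tested against `Z` and `Z'`. Each sum of absolute entries costs a factor `k` by Cauchy-Schwarz. -/
theorem NearlyOrthonormal.form_bound {β : Type*} [Fintype β] {w : β → Mat} {η : ℝ}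
    (h : NearlyOrthonormal w η) (Z Z' : Mat) :
    ‖∑ μ, star (Z * w μ).trace * (Z' * w μ).trace - (Zᴴ * Z').trace‖ ≤
      η * k ^ 2 * (√(hsSq Z) * √(hsSq Z')) := by
  have e1 : ∑ μ, star (Z * w μ).trace * (Z' * w μ).trace - (Zᴴ * Z').trace =
      ∑ b, ∑ a, ∑ d, ∑ c, star (Z b a) * Z' d c *
        (∑ μ, star (w μ a b) * w μ c d - if a = c ∧ b = d then 1 else 0) := by
    have e2 : ∀ b a d c, star (Z b a) * Z' d c *
        (∑ μ, star (w μ a b) * w μ c d - if a = c ∧ b = d then 1 else 0) =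
        ∑ μ, star (Z b a * w μ a b) * (Z' d c * w μ c d) -
          if a = c then (if b = d then star (Z b a) * Z' d c else 0) else 0 := by
      intro b a d c
      rw [mul_sub, Finset.mul_sum]
      congr 1
      · refine Finset.sum_congr rfl fun μ _ => ?_
        rw [star_mul']
        ring
      · split_ifs <;> simp_all
    simp_rw [e2, Finset.sum_sub_distrib]
    congr 1
    · have e3 : ∀ (Y : Mat) μ, (Y * w μ).trace = ∑ b, ∑ a, Y b a * w μ a b := by
        intro Y μ
        simp [trace, mul_apply]
      simp_rw [e3, star_sum, Finset.sum_mul, Finset.mul_sum]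
      rw [Finset.sum_comm]
      refine Finset.sum_congr rfl fun b _ => ?_
      rw [Finset.sum_comm]
      refine Finset.sum_congr rfl fun a _ => ?_
      rw [Finset.sum_comm]
      refine Finset.sum_congr rfl fun d _ => ?_
      rw [Finset.sum_comm]
    · simp only [Finset.sum_ite_eq, Finset.mem_univ, if_true]
      simp only [trace, diag_apply, mul_apply, conjTranspose_apply]
      rw [Finset.sum_comm]
  rw [e1]
  calc ‖∑ b, ∑ a, ∑ d, ∑ c, star (Z b a) * Z' d c *
        (∑ μ, star (w μ a b) * w μ c d - if a = c ∧ b = d then 1 else 0)‖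
      ≤ ∑ b, ∑ a, ∑ d, ∑ c, ‖Z b a‖ * ‖Z' d c‖ * η := by
        refine norm_sum_le_of_le _ fun b _ => norm_sum_le_of_le _ fun a _ =>
          norm_sum_le_of_le _ fun d _ => norm_sum_le_of_le _ fun c _ => ?_
        rw [norm_mul, norm_mul, norm_star]
        exact mul_le_mul_of_nonneg_left (h a b c d).le (by positivity)
    _ = (∑ b, ∑ a, ‖Z b a‖) * (∑ d, ∑ c, ‖Z' d c‖) * η := by
        simp_rw [Finset.sum_mul, Finset.mul_sum, Finset.sum_mul]
    _ ≤ (k * √(hsSq Z)) * (k * √(hsSq Z')) * η := by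
        rcases isEmpty_or_nonempty (Fin k) with hemp | ⟨⟨i⟩⟩
        · simp [hsSq]
        · have hη : 0 ≤ η := (norm_nonneg _).trans (h i i i i).le
          gcongr
          · exact sum_norm_le Z
          · exact sum_norm_le Z'
    _ = _ := by ring

/-- If the words of some length act strictly positively, then long words are nearly orthonormal in
suitable coordinates. -/
theorem exists_nearlyOrthonormal (hk : 1 ≤ k) (B : Fin n → Mat) {l : ℕ}
    (hT : StrictlyPositive (krausMap B ^ l)) {η : ℝ} (hη : 0 < η) :
    ∃ x y : Mat, IsUnit x ∧ IsUnit y ∧ ∃ j₀ : ℕ, ∀ j, j₀ ≤ j → ∃ c : ℂ, c ≠ 0 ∧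
      NearlyOrthonormal
        (fun μ : Fin (l * j) → Fin n => y * (c • (word B μ)ᴴ) * x) η := by
  have hT' := hT.dual (trace_mul_krausMap_pow B l) fun A hA => krausMap_pow_posSemidef _ l hA
  obtain ⟨ρ, X, Y, hρ, hX, hY, hlim⟩ :=
    hT.exists_tendsto_pow hk hT' (trace_mul_krausMap_pow B l)
  open scoped MatrixOrder in
  obtain ⟨RX, hRX⟩ := CStarAlgebra.nonneg_iff_eq_star_mul_self.1 hX.posSemidef.nonneg
  open scoped MatrixOrder in
  obtain ⟨RY, hRY⟩ := CStarAlgebra.nonneg_iff_eq_star_mul_self.1 hY.posSemidef.nonneg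
  rw [star_eq_conjTranspose] at hRX hRY
  have hdet : ∀ {P R : Mat}, P.PosDef → P = Rᴴ * R → IsUnit R := by
    intro P R hP hR
    have h1 := hP.isUnit
    rw [hR, Matrix.isUnit_iff_isUnit_det, det_mul] at h1
    exact (Matrix.isUnit_iff_isUnit_det _).2 (isUnit_of_mul_isUnit_right h1)
  have hRXu := hdet hX hRX
  have hRYu := hdet hY hRY
  -- The coordinates are chosen so that the limiting rank one map, built from `X` and `Y`, becomes
  -- the one built from two identity matrices.
  set x : Mat := RX⁻¹ with hx
  set y : Mat := (RYᴴ)⁻¹ with hy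
  have hRXd := (Matrix.isUnit_iff_isUnit_det _).1 hRXu
  have hRYd := (Matrix.isUnit_iff_isUnit_det _).1 hRYu
  have hRYd' : IsUnit RYᴴ.det := by rw [det_conjTranspose]; exact hRYd.star
  have hxX : xᴴ * X * x = 1 := by
    rw [hRX, hx, conjTranspose_nonsing_inv, ← mul_assoc,
      nonsing_inv_mul _ (by rw [det_conjTranspose]; exact hRXd.star), one_mul,
      mul_nonsing_inv _ hRXd]
  have hyY : y * Y * yᴴ = 1 := by
    rw [hRY, hy, conjTranspose_nonsing_inv, conjTranspose_conjTranspose, ← mul_assoc,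
      nonsing_inv_mul _ hRYd', one_mul, mul_nonsing_inv _ hRYd]
  refine ⟨x, y, ?_, ?_, ?_⟩
  · exact (Matrix.isUnit_nonsing_inv_iff).2 hRXu
  · exact (Matrix.isUnit_nonsing_inv_iff).2 ((Matrix.isUnit_iff_isUnit_det _).2 hRYd')
  have hev : ∀ a b c d : Fin k, ∀ᶠ j in atTop,
      ‖(xᴴ * (ρ ^ j • ((krausMap B ^ l) ^ j) (yᴴ * single a c 1 * y)) * x) b d -
        if a = c ∧ b = d then 1 else 0‖ < η := by
    intro a b c d
    have hcont : Continuous fun M : Mat => (xᴴ * M * x) b d :=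
      ((continuous_const.matrix_mul continuous_id).matrix_mul continuous_const).matrix_elem b d
    have h1 := (hcont.tendsto _).comp (hlim (yᴴ * single a c 1 * y))
    have h2 : (xᴴ * ((Y * (yᴴ * single a c 1 * y)).trace • X) * x) b d =
        if a = c ∧ b = d then 1 else 0 := by
      have h3 : (Y * (yᴴ * single a c 1 * y)).trace = if a = c then 1 else 0 := by
        have h4 : (Y * (yᴴ * single a c 1 * y)).trace =
            ((y * Y * yᴴ) * single a c 1).trace := by
          rw [mul_assoc yᴴ, ← mul_assoc, trace_mul_comm, mul_assoc (single a c (1 : ℂ)),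
            trace_mul_comm]
          congr 1
          noncomm_ring
        rw [h4, hyY, one_mul]
        split_ifs with hac
        · rw [hac, trace_single_eq_same]
        · rw [trace_single_eq_of_ne _ _ _ hac]
      rw [mul_smul_comm, smul_mul_assoc, hxX, h3, Matrix.smul_apply, one_apply]
      split_ifs <;> simp_all
    rw [h2] at h1
    have h5 := (h1.sub_const (if a = c ∧ b = d then (1 : ℂ) else 0)).norm
    rw [sub_self, norm_zero] at h5
    exact h5.eventually (gt_mem_nhds hη)
  have hall : ∀ᶠ j in atTop, ∀ a b c d : Fin k,
      ‖(xᴴ * (ρ ^ j • ((krausMap B ^ l) ^ j) (yᴴ * single a c 1 * y)) * x) b d -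
        if a = c ∧ b = d then 1 else 0‖ < η := by
    simp only [eventually_all]
    exact hev
  obtain ⟨j₀, hj₀⟩ := eventually_atTop.1 hall
  refine ⟨j₀, fun j hj => ⟨((√(ρ ^ j) : ℝ) : ℂ), ?_, fun a b c d => ?_⟩⟩
  · rw [Complex.ofReal_ne_zero]
    exact (Real.sqrt_pos.2 (pow_pos hρ j)).ne'
  -- The Gram entry for positions `(a, b)` and `(c, d)` is the `(b, d)` entry of the normalized
  -- iterate applied to the matrix unit at `(a, c)`, in the new coordinates. The scalar `√(ρ ^ j)`
  -- enters twice and supplies the factor `ρ ^ j`.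
  convert hj₀ j hj a b c d using 3
  rw [← pow_mul, krausMap_pow_apply, Finset.smul_sum, Finset.mul_sum, Finset.sum_mul,
    Matrix.sum_apply]
  refine Finset.sum_congr rfl fun μ _ => ?_
  set r : ℂ := ((√(ρ ^ j) : ℝ) : ℂ) with hr
  have hrr : (ρ ^ j : ℝ) • (word B μ * (yᴴ * single a c 1 * y) * (word B μ)ᴴ) =
      (star r * r) • (word B μ * (yᴴ * single a c 1 * y) * (word B μ)ᴴ) := by
    rw [hr, RCLike.star_def, Complex.conj_ofReal, ← Complex.ofReal_mul,
      Real.mul_self_sqrt (pow_pos hρ j).le, Complex.coe_smul]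
  rw [hrr]
  have h6 : xᴴ * ((star r * r) • (word B μ * (yᴴ * single a c 1 * y) * (word B μ)ᴴ)) * x =
      (y * (r • (word B μ)ᴴ) * x)ᴴ * single a c 1 * (y * (r • (word B μ)ᴴ) * x) := by
    rw [conjTranspose_mul, conjTranspose_mul, conjTranspose_smul, conjTranspose_conjTranspose]
    simp only [smul_mul_assoc, mul_smul_comm, smul_smul, mul_assoc]
    rw [mul_comm]
  rw [h6, mul_assoc, mul_apply, Finset.sum_eq_single a]
  · rw [conjTranspose_apply, single_mul_apply_same, one_mul]
  · intro i _ hi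
    rw [single_mul_apply_of_ne _ _ _ _ _ hi, mul_zero]
  · simp

theorem NearlyOrthonormal.eq_zero {β : Type*} [Fintype β] {w : β → Mat} {η : ℝ}
    (h : NearlyOrthonormal w η) (hη : η * k ^ 2 < 1) {Z : Mat}
    (hZ : ∀ μ, (Z * w μ).trace = 0) : Z = 0 := by
  have h1 := h.form_bound Z Z
  simp only [hZ, mul_zero, Finset.sum_const_zero, zero_sub, norm_neg] at h1
  rw [← hsSq_eq_trace, Complex.norm_real, Real.norm_of_nonneg (hsSq_nonneg Z),
    Real.mul_self_sqrt (hsSq_nonneg Z)] at h1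
  refine hsSq_eq_zero (le_antisymm ?_ (hsSq_nonneg Z))
  nlinarith [hsSq_nonneg Z]

/-- A matrix orthogonal to a nearly orthonormal family vanishes as soon as `η k² < 1`; here `η k² =
1 / 2`. The change of coordinates is invertible and does not affect spanning. -/
theorem exists_pow_eq_top (hk : 1 ≤ k) (B : Fin n → Mat) {l : ℕ} (hl : 0 < l)
    (hT : StrictlyPositive (krausMap B ^ l)) : ∃ N, 1 ≤ N ∧ tupleSpan B ^ N = ⊤ := by
  have hk' : (0 : ℝ) < k := by exact_mod_cast hk
  obtain ⟨x, y, hx, hy, j₀, h⟩ := exists_nearlyOrthonormal hk B hT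
    (η := 1 / (2 * k ^ 2)) (by positivity)
  obtain ⟨c, hc, hno⟩ := h (j₀ + 1) (by omega)
  refine ⟨l * (j₀ + 1), Nat.mul_pos hl (by omega), (tupleSpan_pow_eq_top_iff B _).2 ?_⟩
  intro Z hZ
  have h1 : x⁻¹ * Z * y⁻¹ = 0 := by
    refine hno.eq_zero (by field_simp; norm_num) fun μ => ?_
    have hxd := (Matrix.isUnit_iff_isUnit_det _).1 hx
    have hyd := (Matrix.isUnit_iff_isUnit_det _).1 hy
    have : x⁻¹ * Z * y⁻¹ * (y * (c • (word B μ)ᴴ) * x) = x⁻¹ * (c • (Z * (word B μ)ᴴ) * x) := by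
      rw [mul_assoc y, ← mul_assoc (x⁻¹ * Z * y⁻¹), mul_assoc (x⁻¹ * Z), nonsing_inv_mul _ hyd,
        mul_one, smul_mul_assoc, mul_smul_comm, smul_mul_assoc, mul_smul_comm]
      congr 1
      noncomm_ring
    rw [this, trace_mul_comm, mul_assoc, mul_nonsing_inv _ hxd, mul_one, trace_smul, hZ, smul_zero]
  have hxi : IsUnit x⁻¹ := (Matrix.isUnit_nonsing_inv_iff).2 hx
  have hyi : IsUnit y⁻¹ := (Matrix.isUnit_nonsing_inv_iff).2 hy
  exact hxi.mul_right_eq_zero.1 (hyi.mul_left_eq_zero.1 h1)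

/-- The words of length `N ≥ k ^ 4` of a primitive tuple span the matrix algebra. -/
theorem tupleSpan_pow_eq_top_of_primitive (hk : 1 ≤ k) {B : Fin n → Mat}
    (hB : B ∈ primitiveTuples n k) {N : ℕ} (hN : k ^ 4 ≤ N) : tupleSpan B ^ N = ⊤ := by
  obtain ⟨-, ⟨l, hl, hT⟩, -⟩ := hB
  obtain ⟨N₀, hN₀, h⟩ := exists_pow_eq_top hk B hl hT
  exact pow_eq_top_of_wielandt hk hN₀ h hN

end Gram

end SpinChain

namespace SpinChain

open Matrix Filter Topology

/-! ### The projection onto the orthogonal complement of the range of `Γ`. -/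

section Excitation

variable {n k : ℕ}

local notation "Mat" => Matrix (Fin k) (Fin k) ℂ

/-- The projection `1 - G_N`. -/
noncomputable def exProj (B : Fin n → Mat) (N : ℕ) : Matrix (Fin N → Fin n) (Fin N → Fin n) ℂ :=
  1 - groundProj B N

theorem groundProj_mulVec (B : Fin n → Mat) (N : ℕ) (v : (Fin N → Fin n) → ℂ) :
    groundProj B N *ᵥ v =
      ((LinearMap.range (gammaMap B N)).starProjection (WithLp.toLp 2 v)).ofLp := by
  rw [← WithLp.ofLp_toLp 2 v, ← ofLp_toEuclideanCLM, groundProj]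
  simp

theorem groundProj_mul_self (B : Fin n → Mat) (N : ℕ) :
    groundProj B N * groundProj B N = groundProj B N := by
  have h : IsIdempotentElem (LinearMap.range (gammaMap B N)).starProjection :=
    Submodule.isIdempotentElem_starProjection _
  rw [groundProj, ← map_mul, h.eq]

theorem exProj_isHermitian (B : Fin n → Mat) (N : ℕ) : (exProj B N).IsHermitian :=
  isHermitian_one.sub (groundProj_isHermitian B N)

theorem exProj_mul_self (B : Fin n → Mat) (N : ℕ) : exProj B N * exProj B N = exProj B N := by
  rw [exProj, sub_mul, mul_sub, mul_sub, groundProj_mul_self]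
  simp

open scoped MatrixOrder in
theorem exProj_nonneg (B : Fin n → Mat) (N : ℕ) : 0 ≤ exProj B N := by
  have := star_mul_self_nonneg (exProj B N)
  rwa [star_eq_conjTranspose, (exProj_isHermitian B N).eq, exProj_mul_self] at this

theorem exProj_mulVec_eq_zero_iff (B : Fin n → Mat) (N : ℕ) (v : (Fin N → Fin n) → ℂ) :
    exProj B N *ᵥ v = 0 ↔ ∃ C : Mat, ∀ μ, v μ = (C * (word B μ)ᴴ).trace := by
  rw [exProj, sub_mulVec, one_mulVec, groundProj_mulVec, sub_eq_zero]
  constructor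
  · intro h
    have h1 : WithLp.toLp 2 v ∈ LinearMap.range (gammaMap B N) := by
      rw [← Submodule.starProjection_eq_self_iff]
      exact (WithLp.ofLp_injective 2 h).symm
    obtain ⟨C, hC⟩ := h1
    refine ⟨C, fun μ => ?_⟩
    rw [← gammaMap_apply, hC]
  · rintro ⟨C, hC⟩
    have h1 : WithLp.toLp 2 v ∈ LinearMap.range (gammaMap B N) := by
      refine ⟨C, ?_⟩
      ext μ
      rw [gammaMap_apply, ← hC]
    rw [Submodule.starProjection_eq_self_iff.2 h1]

end Excitation

/-! ### Overlaps of block ground states in terms of their coefficient matrices. -/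

section Blocks

variable {k : ℕ}

local notation "Mat" => Matrix (Fin k) (Fin k) ℂ

section Total

variable {ι β Ω : Type*} [Fintype ι] [Fintype β] [Fintype Ω]

/-- The squared Hilbert-Schmidt norm of a family of matrices. -/
noncomputable def hsTotal (Z : ι → Mat) : ℝ := ∑ i, hsSq (Z i)

theorem hsTotal_nonneg (Z : ι → Mat) : 0 ≤ hsTotal Z :=
  Finset.sum_nonneg fun _ _ => hsSq_nonneg _

/-- The Hilbert-Schmidt inner product of families of matrices. -/
noncomputable def hsInner (Z Z' : ι → Mat) : ℂ := ∑ i, ((Z i)ᴴ * Z' i).trace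

theorem hsInner_self (Z : ι → Mat) : hsInner Z Z = (hsTotal Z : ℂ) := by
  simp only [hsInner, hsTotal, Complex.ofReal_sum, hsSq_eq_trace]

/-- For each fixed outer configuration `i`, the sum over the nearly orthonormal block reproduces the
trace form up to `δ`; Cauchy-Schwarz over `i` adds up the errors. Inner products of states can thus
be read off from their coefficients. -/
theorem NearlyOrthonormal.inner_close {wb : β → Mat} {η δ : ℝ} (hwb : NearlyOrthonormal wb η)
    (hδ : η * k ^ 2 ≤ δ) (hδ0 : 0 ≤ δ) (e : ι × β ≃ Ω) {s u : EuclideanSpace ℂ Ω} {Z Z' : ι → Mat}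
    (hs : ∀ i b, s (e (i, b)) = (Z i * wb b).trace)
    (hu : ∀ i b, u (e (i, b)) = (Z' i * wb b).trace) :
    ‖inner ℂ s u - hsInner Z Z'‖ ≤ δ * (√(hsTotal Z) * √(hsTotal Z')) := by
  have hinner : inner ℂ s u = ∑ i, ∑ b, star (Z i * wb b).trace * (Z' i * wb b).trace := by
    rw [PiLp.inner_apply, ← e.sum_comp, Fintype.sum_prod_type]
    refine Finset.sum_congr rfl fun i _ => Finset.sum_congr rfl fun b _ => ?_
    rw [hs, hu, RCLike.inner_apply, mul_comm]
    rfl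
  rw [hinner, hsInner, ← Finset.sum_sub_distrib]
  calc _ ≤ ∑ i, δ * (√(hsSq (Z i)) * √(hsSq (Z' i))) := by
        refine norm_sum_le_of_le _ fun i _ => ?_
        exact (hwb.form_bound _ _).trans (by gcongr)
    _ = δ * ∑ i, √(hsSq (Z i)) * √(hsSq (Z' i)) := by rw [Finset.mul_sum]
    _ ≤ δ * (√(hsTotal Z) * √(hsTotal Z')) := by
        refine mul_le_mul_of_nonneg_left ?_ hδ0
        have := Real.sum_mul_le_sqrt_mul_sqrt (Finset.univ : Finset ι)
          (fun i => √(hsSq (Z i))) (fun i => √(hsSq (Z' i)))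
        simp_rw [Real.sq_sqrt (hsSq_nonneg _)] at this
        exact this

theorem NearlyOrthonormal.sqrt_hsTotal_le {wb : β → Mat} {η δ : ℝ}
    (hwb : NearlyOrthonormal wb η) (hδ : η * k ^ 2 ≤ δ) (hδ0 : 0 ≤ δ) (hδ1 : δ < 1)
    (e : ι × β ≃ Ω) {s : EuclideanSpace ℂ Ω} {Z : ι → Mat}
    (hs : ∀ i b, s (e (i, b)) = (Z i * wb b).trace) :
    √(hsTotal Z) ≤ (√(1 - δ))⁻¹ * ‖s‖ := by
  have h1 := hwb.inner_close hδ hδ0 e hs hs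
  rw [hsInner_self, Real.mul_self_sqrt (hsTotal_nonneg Z), inner_self_eq_norm_sq_to_K] at h1
  have h2 : ((‖s‖ : ℝ) : ℂ) ^ 2 - (hsTotal Z : ℂ) = ((‖s‖ ^ 2 - hsTotal Z : ℝ) : ℂ) := by
    push_cast; rfl
  have h3 : |‖s‖ ^ 2 - hsTotal Z| ≤ δ * hsTotal Z := by
    rw [← Real.norm_eq_abs, ← Complex.norm_real, ← h2]
    exact h1
  have h4 : (1 - δ) * hsTotal Z ≤ ‖s‖ ^ 2 := by
    have := (abs_le.1 h3).1
    linarith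
  have h5 := Real.sqrt_le_sqrt h4
  rw [Real.sqrt_mul (by linarith), Real.sqrt_sq (norm_nonneg _)] at h5
  rwa [le_inv_mul_iff₀ (Real.sqrt_pos.2 (by linarith))]

/-- Pythagoras for the Hilbert-Schmidt inner product. -/
theorem hsTotal_sub_le {Z Z' : ι → Mat} (h : hsInner Z' (Z - Z') = 0) :
    hsTotal (Z - Z') ≤ hsTotal Z := by
  have h2 : hsInner (Z - Z') Z' = 0 := by
    have : hsInner (Z - Z') Z' = star (hsInner Z' (Z - Z')) := by
      simp only [hsInner, star_sum, ← trace_conjTranspose, conjTranspose_mul,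
        conjTranspose_conjTranspose]
    rw [this, h, star_zero]
  have h3 : hsInner Z Z = hsInner (Z - Z') (Z - Z') + hsInner (Z - Z') Z' +
      hsInner Z' (Z - Z') + hsInner Z' Z' := by
    simp only [hsInner, ← Finset.sum_add_distrib, Pi.sub_apply, ← trace_add]
    refine Finset.sum_congr rfl fun i _ => ?_
    congr 1
    rw [conjTranspose_sub]
    noncomm_ring
  rw [h, h2, hsInner_self, hsInner_self, hsInner_self, add_zero, add_zero] at h3
  have h4 : hsTotal Z = hsTotal (Z - Z') + hsTotal Z' := by exact_mod_cast h3
  linarith [hsTotal_nonneg Z']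

end Total

variable {α β γ Ω : Type*} [Fintype α] [Fintype β] [Fintype γ] [Fintype Ω]

/-- `F` is the least squares solution of `D a ≈ wa a * F`. The normal equations make the residual
orthogonal to every family `wa a * C c`, whatever the `C c` are. -/
theorem exists_hsInner_eq_zero (wa D : α → Mat) (wc : γ → Mat)
    (hK : IsUnit (∑ a, (wa a)ᴴ * wa a)) : ∃ F : Mat, ∀ C : γ → Mat,
      hsInner (fun p : α × γ => wa p.1 * C p.2)
        ((fun p => D p.1 * wc p.2) - fun p => wa p.1 * F * wc p.2) = 0 := by
  obtain ⟨K, hKe⟩ := hK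
  refine ⟨(↑K⁻¹ : Mat) * ∑ a, (wa a)ᴴ * D a, fun C => ?_⟩
  set F : Mat := (↑K⁻¹ : Mat) * ∑ a, (wa a)ᴴ * D a with hF
  have hKF : (∑ a, (wa a)ᴴ * wa a) * F = ∑ a, (wa a)ᴴ * D a := by
    rw [hF, ← hKe, Units.mul_inv_cancel_left]
  rw [hsInner, Fintype.sum_prod_type, Finset.sum_comm]
  refine Finset.sum_eq_zero fun c _ => ?_
  rw [← trace_sum]
  have : ∑ a, (wa a * C c)ᴴ * (D a * wc c - wa a * F * wc c) =
      (C c)ᴴ * ((∑ a, (wa a)ᴴ * D a) - (∑ a, (wa a)ᴴ * wa a) * F) * wc c := by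
    rw [Finset.sum_mul, ← Finset.sum_sub_distrib, Finset.mul_sum, Finset.sum_mul]
    refine Finset.sum_congr rfl fun a _ => ?_
    rw [conjTranspose_mul]
    noncomm_ring
  simp only [Pi.sub_apply]
  rw [this, hKF, sub_self, mul_zero, zero_mul, trace_zero]

/-- The `u` are the states with free left block `α`, the `s` those with free right block `γ`, and
`f` belongs to both kinds. The least squares choice of `F` makes the coefficients of `u - f` exactly
orthogonal to those of `s`. Near orthonormality on the shared block `β` turns this into a bound `δ`
relative to coefficient norms, and passing to vector norms costs `1 / (1 - δ)`. -/
theorem block_estimate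
    (e : α × β × γ ≃ Ω) (wa : α → Mat) (wb : β → Mat) (wc : γ → Mat)
    (hK : IsUnit (∑ a, (wa a)ᴴ * wa a)) {η δ : ℝ} (hwb : NearlyOrthonormal wb η)
    (hδ : η * k ^ 2 ≤ δ) (hδ0 : 0 ≤ δ) (hδ1 : δ < 1) (u : EuclideanSpace ℂ Ω) (D : α → Mat)
    (hu : ∀ a b c, u (e (a, b, c)) = (D a * wc c * wb b).trace) :
    ∃ (f : EuclideanSpace ℂ Ω) (F : Mat),
      (∀ a b c, f (e (a, b, c)) = (wa a * F * wc c * wb b).trace) ∧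
      ∀ (s : EuclideanSpace ℂ Ω) (C : γ → Mat),
        (∀ a b c, s (e (a, b, c)) = (wa a * C c * wb b).trace) →
          ‖inner ℂ s (u - f)‖ ≤ δ / (1 - δ) * ‖s‖ * ‖u‖ := by
  obtain ⟨F, hF⟩ := exists_hsInner_eq_zero wa D wc hK
  set Zu : α × γ → Mat := fun p => D p.1 * wc p.2 with hZu
  set Zf : α × γ → Mat := fun p => wa p.1 * F * wc p.2 with hZf
  let e' : (α × γ) × β ≃ Ω :=
    ((Equiv.prodAssoc α γ β).trans ((Equiv.refl α).prodCongr (Equiv.prodComm γ β))).trans e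
  have he' : ∀ a c b, e' ((a, c), b) = e (a, b, c) := fun a c b => rfl
  set f : EuclideanSpace ℂ Ω := WithLp.toLp 2 fun o =>
    (Zf (e'.symm o).1 * wb (e'.symm o).2).trace with hf
  have hfe : ∀ p b, f (e' (p, b)) = (Zf p * wb b).trace := by
    intro p b
    simp [hf]
  have hue : ∀ p b, u (e' (p, b)) = (Zu p * wb b).trace := fun p b => hu p.1 b p.2
  have hsub : ∀ p b, (u - f) (e' (p, b)) = ((Zu - Zf) p * wb b).trace := by
    intro p b
    rw [PiLp.sub_apply, hue, hfe, Pi.sub_apply, sub_mul, trace_sub]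
  refine ⟨f, F, fun a b c => hfe (a, c) b, fun s C hs => ?_⟩
  have hse : ∀ p b, s (e' (p, b)) = ((fun p : α × γ => wa p.1 * C p.2) p * wb b).trace :=
    fun p b => hs p.1 b p.2
  have h1 := hwb.inner_close hδ hδ0 e' hse hsub
  rw [hF, sub_zero] at h1
  have hpyth : hsTotal (Zu - Zf) ≤ hsTotal Zu := by
    refine hsTotal_sub_le ?_
    have := hF fun c => F * wc c
    simp only [← mul_assoc] at this
    exact this
  have h2 : √(hsTotal (Zu - Zf)) ≤ (√(1 - δ))⁻¹ * ‖u‖ :=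
    (Real.sqrt_le_sqrt hpyth).trans (hwb.sqrt_hsTotal_le hδ hδ0 hδ1 e' hue)
  have h3 := hwb.sqrt_hsTotal_le hδ hδ0 hδ1 e' hse
  calc ‖inner ℂ s (u - f)‖ ≤ δ * (((√(1 - δ))⁻¹ * ‖s‖) * ((√(1 - δ))⁻¹ * ‖u‖)) := by
        refine h1.trans (mul_le_mul_of_nonneg_left ?_ hδ0)
        exact mul_le_mul h3 h2 (Real.sqrt_nonneg _) (by positivity)
    _ = δ * ((√(1 - δ))⁻¹ * (√(1 - δ))⁻¹) * ‖s‖ * ‖u‖ := by ring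
    _ = δ / (1 - δ) * ‖s‖ * ‖u‖ := by
        rw [← mul_inv, Real.mul_self_sqrt (by linarith), div_eq_mul_inv]

end Blocks

/-! ### Windows of a chain and configurations split into three blocks. -/

section Windows

variable {n k : ℕ}

local notation "Mat" => Matrix (Fin k) (Fin k) ℂ

/-- The window of length `l` that starts at site `s` of a chain of length `N`. -/
def win (s l N : ℕ) (h : s + l ≤ N) (i : Fin l) : Fin N := ⟨s + i, by omega⟩

theorem win_injective (s l N : ℕ) (h : s + l ≤ N) : (win s l N h).Injective := by
  intro i j hij
  have := congrArg Fin.val hij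
  simp only [win] at this
  exact Fin.ext (by omega)

theorem win_comp_win {s l N y m : ℕ} (h : s + l ≤ N) (h' : y + m ≤ l) :
    win s l N h ∘ win y m l h' = win (s + y) m N (by omega) := by
  ext i
  simp [win, add_assoc]

theorem mem_range_win {s l N : ℕ} {h : s + l ≤ N} {y : Fin N} :
    y ∈ Set.range (win s l N h) ↔ s ≤ y ∧ (y : ℕ) < s + l := by
  constructor
  · rintro ⟨i, rfl⟩
    simp only [win]
    omega
  · rintro ⟨h1, h2⟩
    exact ⟨⟨y - s, by omega⟩, Fin.ext (by simp only [win]; omega)⟩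

theorem extend_eq {ι κ α : Type*} {f : ι → κ} (hf : f.Injective) {τ : ι → α} {σ ρ : κ → α}
    (h1 : ρ ∘ f = τ) (h2 : ∀ y, y ∉ Set.range f → σ y = ρ y) : Function.extend f τ σ = ρ := by
  ext1 y
  by_cases hy : y ∈ Set.range f
  · obtain ⟨x, rfl⟩ := hy
    rw [hf.extend_apply, ← h1]
    rfl
  · rw [Function.extend_apply' _ _ _ hy, h2 y hy]

/-- The configuration made of three consecutive blocks. -/
def join {a b c : ℕ} (α : Fin a → Fin n) (β : Fin b → Fin n) (γ : Fin c → Fin n) :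
    Fin (a + b + c) → Fin n := Fin.append (Fin.append α β) γ

theorem append_of_lt {a b : ℕ} (α : Fin a → Fin n) (β : Fin b → Fin n) (y : Fin (a + b))
    (h : (y : ℕ) < a) : Fin.append α β y = α ⟨y, h⟩ :=
  Fin.append_left α β ⟨y, h⟩

theorem append_of_le {a b : ℕ} (α : Fin a → Fin n) (β : Fin b → Fin n) (y : Fin (a + b))
    (h : a ≤ (y : ℕ)) : Fin.append α β y = β ⟨y - a, by omega⟩ := by
  have : y = Fin.natAdd a ⟨y - a, by omega⟩ := by ext; simp; omega
  conv_lhs => rw [this]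
  rw [Fin.append_right]

theorem join_left {a b c : ℕ} (α : Fin a → Fin n) (β : Fin b → Fin n) (γ : Fin c → Fin n)
    (y : Fin (a + b + c)) (h : (y : ℕ) < a) : join α β γ y = α ⟨y, h⟩ := by
  rw [join, append_of_lt _ _ _ (by omega), append_of_lt _ _ _ h]

theorem join_middle {a b c : ℕ} (α : Fin a → Fin n) (β : Fin b → Fin n) (γ : Fin c → Fin n)
    (y : Fin (a + b + c)) (h : a ≤ (y : ℕ)) (h' : (y : ℕ) < a + b) :
    join α β γ y = β ⟨y - a, by omega⟩ := by
  rw [join, append_of_lt _ _ _ h', append_of_le _ _ _ h]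

theorem join_right {a b c : ℕ} (α : Fin a → Fin n) (β : Fin b → Fin n) (γ : Fin c → Fin n)
    (y : Fin (a + b + c)) (h : a + b ≤ (y : ℕ)) :
    join α β γ y = γ ⟨y - (a + b), by omega⟩ := by
  rw [join, append_of_le _ _ _ h]

theorem word_join (B : Fin n → Mat) {a b c : ℕ} (α : Fin a → Fin n) (β : Fin b → Fin n)
    (γ : Fin c → Fin n) : word B (join α β γ) = word B α * word B β * word B γ := by
  rw [join, word_append, word_append]

/-- Configurations of a chain, split into three blocks. -/
def joinEquiv (a b c : ℕ) :
    (Fin a → Fin n) × (Fin b → Fin n) × (Fin c → Fin n) ≃ (Fin (a + b + c) → Fin n) where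
  toFun p := join p.1 p.2.1 p.2.2
  invFun σ := (fun i => σ ⟨i, by omega⟩, fun i => σ ⟨a + i, by omega⟩,
    fun i => σ ⟨a + b + i, by omega⟩)
  left_inv := by
    rintro ⟨α, β, γ⟩
    simp only [Prod.mk.injEq]
    refine ⟨?_, ?_, ?_⟩ <;> ext1 i
    · rw [join_left _ _ _ _ i.2]
    · rw [join_middle _ _ _ _ (by simp) (by simp)]
      congr 1; ext; simp
    · rw [join_right _ _ _ _ (by simp)]
      congr 1; ext; simp
  right_inv := by
    intro σ
    ext1 y
    rcases lt_or_ge (y : ℕ) a with h | h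
    · exact join_left _ _ _ y h
    rcases lt_or_ge (y : ℕ) (a + b) with h' | h'
    · exact (join_middle _ _ _ y h h').trans (congrArg σ (Fin.ext (by simp only; omega)))
    · exact (join_right _ _ _ y h').trans (congrArg σ (Fin.ext (by simp only; omega)))

theorem extend_win_left {a b c : ℕ} (α : Fin a → Fin n) (β : Fin b → Fin n) (γ : Fin c → Fin n)
    (h : 0 + (a + b) ≤ a + b + c) (τ : Fin (a + b) → Fin n) :
    Function.extend (win 0 (a + b) (a + b + c) h) τ (join α β γ) = Fin.append τ γ := by
  refine extend_eq (win_injective _ _ _ _) ?_ fun y hy => ?_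
  · ext1 i
    have : win 0 (a + b) (a + b + c) h i = Fin.castAdd c i := by ext; simp [win]
    rw [Function.comp_apply, this, Fin.append_left]
  · rw [mem_range_win] at hy
    rw [join]
    induction y using Fin.addCases with
    | left i => exact absurd ⟨Nat.zero_le _, by simp⟩ hy
    | right i => rw [Fin.append_right, Fin.append_right]

theorem extend_win_right {a b c : ℕ} (α : Fin a → Fin n) (β β' : Fin b → Fin n)
    (γ γ' : Fin c → Fin n) (h : a + (b + c) ≤ a + b + c) :
    Function.extend (win a (b + c) (a + b + c) h) (Fin.append β' γ') (join α β γ) =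
      join α β' γ' := by
  refine extend_eq (win_injective _ _ _ _) ?_ fun y hy => ?_
  · ext1 i
    rw [Function.comp_apply]
    rcases lt_or_ge (i : ℕ) b with hi | hi
    · rw [append_of_lt _ _ _ hi, join_middle _ _ _ _ (by simp [win]) (by simp [win, hi])]
      congr 1; ext; simp [win]
    · rw [append_of_le _ _ _ hi, join_right _ _ _ _ (by simp [win, hi])]
      congr 1; ext; simp only [win]; omega
  · rw [mem_range_win] at hy
    rw [join_left _ _ _ _ (by omega), join_left _ _ _ _ (by omega)]

theorem extend_win_middle {a b c : ℕ} (α : Fin a → Fin n) (β β' : Fin b → Fin n)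
    (γ : Fin c → Fin n) (h : a + b ≤ a + b + c) :
    Function.extend (win a b (a + b + c) h) β' (join α β γ) = join α β' γ := by
  refine extend_eq (win_injective _ _ _ _) ?_ fun y hy => ?_
  · ext1 i
    rw [Function.comp_apply, join_middle _ _ _ _ (by simp [win]) (by simp [win])]
    congr 1; ext; simp [win]
  · rw [mem_range_win] at hy
    rcases lt_or_ge (y : ℕ) a with h1 | h1
    · rw [join_left _ _ _ _ h1, join_left _ _ _ _ h1]
    · rw [join_right _ _ _ _ (by omega), join_right _ _ _ _ (by omega)]

end Windows

end SpinChain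

namespace SpinChain

open Matrix

/-! ### Preservation of positive definiteness at every word length. -/

section Words

variable {n k : ℕ}

local notation "Mat" => Matrix (Fin k) (Fin k) ℂ

/-- A vector in the kernel of the image is killed by all `(B μ)ᴴ`, hence by the adjoint of
everything in `tupleSpan B * ⊤`, which contains the identity. It makes the Gram matrices of words
invertible at any length, even one too short for the words to span. -/
theorem krausMap_posDef {B : Fin n → Mat} (hS : tupleSpan B * ⊤ = ⊤) {P : Mat} (hP : P.PosDef) :
    (krausMap B P).PosDef := by
  have hsd : (krausMap B P).PosSemidef := by
    rw [krausMap_apply]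
    exact posSemidef_sum _ fun μ _ => hP.posSemidef.mul_mul_conjTranspose_same _
  refine PosDef.of_dotProduct_mulVec_pos hsd.1 fun v hv => ?_
  refine lt_of_le_of_ne (hsd.dotProduct_mulVec_nonneg v) (Ne.symm fun h0 => hv ?_)
  have hw : ∀ μ, (B μ)ᴴ *ᵥ v = 0 := by
    rw [krausMap_apply, sum_mulVec, dotProduct_sum] at h0
    have := (Finset.sum_eq_zero_iff_of_nonneg fun μ _ =>
      (hP.posSemidef.mul_mul_conjTranspose_same (B μ)).dotProduct_mulVec_nonneg v).1 h0
    intro μ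
    by_contra hne
    have h1 := this μ (Finset.mem_univ _)
    have h2 := hP.dotProduct_mulVec_pos hne
    rw [star_mulVec, conjTranspose_conjTranspose] at h2
    rw [← mulVec_mulVec, ← mulVec_mulVec, dotProduct_mulVec (star v)] at h1
    exact h2.ne' h1
  have hall : ∀ X ∈ tupleSpan B * ⊤, Xᴴ *ᵥ v = 0 := by
    intro X hX
    induction hX using Submodule.mul_induction_on' with
    | mem_mul_mem s hs t _ =>
      have : sᴴ *ᵥ v = 0 := by
        induction hs using Submodule.span_induction with
        | mem x hx => obtain ⟨μ, rfl⟩ := hx; exact hw μ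
        | zero => simp
        | add x y _ _ hx hy => rw [conjTranspose_add, add_mulVec, hx, hy, add_zero]
        | smul c x _ hx => rw [conjTranspose_smul, smul_mulVec, hx, smul_zero]
      rw [conjTranspose_mul, ← mulVec_mulVec, this, mulVec_zero]
    | add x _ y _ hx hy => rw [conjTranspose_add, add_mulVec, hx, hy, add_zero]
  have := hall 1 (by rw [hS]; trivial)
  rwa [conjTranspose_one, one_mulVec] at this

theorem krausMap_pow_posDef {B : Fin n → Mat} (hS : tupleSpan B * ⊤ = ⊤) {P : Mat}
    (hP : P.PosDef) (a : ℕ) : ((krausMap B ^ a) P).PosDef := by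
  induction a with
  | zero => exact hP
  | succ a ih =>
    rw [pow_succ', Module.End.mul_apply]
    exact krausMap_posDef hS ih

end Words

/-! ### Translates of block operators within a chain. -/

section Term

variable {n : ℕ}

/-- The translate of an operator on `l` sites to the sites `s, …, s + l - 1` of a chain of length
`N` (zero if these are not all sites of the chain). -/
noncomputable def term (N s l : ℕ) (A : Matrix (Fin l → Fin n) (Fin l → Fin n) ℂ) :
    Matrix (Fin N → Fin n) (Fin N → Fin n) ℂ :=
  if h : s + l ≤ N then emb (win s l N h) A else 0

theorem term_of_le {N s l : ℕ} (h : s + l ≤ N) (A : Matrix (Fin l → Fin n) (Fin l → Fin n) ℂ) :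
    term N s l A = emb (win s l N h) A := dif_pos h

theorem term_of_lt {N s l : ℕ} (h : N < s + l) (A : Matrix (Fin l → Fin n) (Fin l → Fin n) ℂ) :
    term N s l A = 0 := dif_neg (by omega)

theorem term_term {N s l y m : ℕ} (h : s + l ≤ N) (h' : y + m ≤ l)
    (A : Matrix (Fin m → Fin n) (Fin m → Fin n) ℂ) :
    term N s l (term l y m A) = term N (s + y) m A := by
  rw [term_of_le h, term_of_le h', term_of_le (by omega), emb_emb (win_injective _ _ _ _),
    win_comp_win]

theorem term_self {N : ℕ} (A : Matrix (Fin N → Fin n) (Fin N → Fin n) ℂ) : term N 0 N A = A := by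
  rw [term_of_le (by omega)]
  have : win 0 N N (by omega) = id := by ext i; simp [win]
  ext σ σ'
  rw [emb_apply_of, this]
  · rfl
  · rw [this]
    simp

theorem term_add (N s l : ℕ) (A A' : Matrix (Fin l → Fin n) (Fin l → Fin n) ℂ) :
    term N s l (A + A') = term N s l A + term N s l A' := by
  unfold term
  split_ifs
  · exact emb_add _ _ _
  · simp

theorem term_smul (N s l : ℕ) (c : ℝ) (A : Matrix (Fin l → Fin n) (Fin l → Fin n) ℂ) :
    term N s l (c • A) = c • term N s l A := by
  unfold term
  split_ifs
  · exact emb_smul _ _ _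
  · simp

theorem term_mul (N s l : ℕ) (A A' : Matrix (Fin l → Fin n) (Fin l → Fin n) ℂ) :
    term N s l (A * A') = term N s l A * term N s l A' := by
  unfold term
  split_ifs
  · exact emb_mul (win_injective _ _ _ _) _ _
  · simp

theorem term_sum {ι : Type*} (N s l : ℕ) (t : Finset ι)
    (A : ι → Matrix (Fin l → Fin n) (Fin l → Fin n) ℂ) :
    term N s l (∑ i ∈ t, A i) = ∑ i ∈ t, term N s l (A i) := by
  unfold term
  split_ifs
  · exact emb_sum _ _ _
  · simp

open scoped MatrixOrder in
theorem term_mono (N s l : ℕ) {A A' : Matrix (Fin l → Fin n) (Fin l → Fin n) ℂ} (h : A ≤ A') :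
    term N s l A ≤ term N s l A' := by
  unfold term
  split_ifs
  · exact emb_mono (win_injective _ _ _ _) h
  · exact le_rfl

open scoped MatrixOrder in
theorem term_nonneg (N s l : ℕ) {A : Matrix (Fin l → Fin n) (Fin l → Fin n) ℂ} (h : 0 ≤ A) :
    0 ≤ term N s l A := by
  unfold term
  split_ifs
  · exact emb_nonneg (win_injective _ _ _ _) h
  · exact le_rfl

theorem term_isHermitian (N s l : ℕ) {A : Matrix (Fin l → Fin n) (Fin l → Fin n) ℂ}
    (h : A.IsHermitian) : (term N s l A).IsHermitian := by
  unfold term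
  split_ifs
  · rw [IsHermitian, ← emb_conjTranspose, h.eq]
  · exact isHermitian_zero

theorem term_commute (N : ℕ) {s l s' l' : ℕ} (h : s + l ≤ s')
    (A : Matrix (Fin l → Fin n) (Fin l → Fin n) ℂ)
    (A' : Matrix (Fin l' → Fin n) (Fin l' → Fin n) ℂ) :
    Commute (term N s l A) (term N s' l' A') := by
  unfold term
  split_ifs
  · refine emb_commute (win_injective _ _ _ _) (win_injective _ _ _ _) (fun x y hxy => ?_) _ _
    have := congrArg Fin.val hxy
    simp only [win] at this
    omega
  all_goals simp

/-- If an operator on `l` sites annihilates all vectors annihilated by another one, the same holds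
for their translates. -/
theorem term_mulVec_eq_zero {N s l : ℕ} {A A' : Matrix (Fin l → Fin n) (Fin l → Fin n) ℂ}
    (h : ∀ v, A *ᵥ v = 0 → A' *ᵥ v = 0) {ψ : (Fin N → Fin n) → ℂ}
    (hψ : term N s l A *ᵥ ψ = 0) : term N s l A' *ᵥ ψ = 0 := by
  unfold term at *
  split_ifs at *
  · rw [emb_mulVec_eq_zero_iff (win_injective _ _ _ _)] at hψ ⊢
    exact fun σ => h _ (hψ σ)
  · simp

end Term

/-! ### Overlapping blocks: the angle estimate and the intersection property. -/

section Blocks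

variable {n k : ℕ}

local notation "Mat" => Matrix (Fin k) (Fin k) ℂ

/-- The ground states of a chain are ground states of all of its blocks. -/
theorem term_mulVec_eq_zero_of_exProj (B : Fin n → Mat) {N s l : ℕ}
    {ψ : (Fin N → Fin n) → ℂ} (h : exProj B N *ᵥ ψ = 0) :
    term N s l (exProj B l) *ᵥ ψ = 0 := by
  rcases lt_or_ge N (s + l) with hN | hN
  · rw [term_of_lt hN, zero_mulVec]
  obtain ⟨c, rfl⟩ := Nat.exists_eq_add_of_le hN
  rw [exProj_mulVec_eq_zero_iff] at h
  obtain ⟨C, hC⟩ := h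
  rw [term_of_le (by omega), emb_mulVec_eq_zero_iff (win_injective _ _ _ _)]
  intro σ
  obtain ⟨⟨α, β, γ⟩, rfl⟩ := (joinEquiv s l c).surjective σ
  refine (exProj_mulVec_eq_zero_iff _ _ _).2 ⟨(word B α)ᴴ * (C * (word B γ)ᴴ), fun μ => ?_⟩
  change ψ (Function.extend _ _ (join α β γ)) = _
  rw [extend_win_middle, hC, word_join, conjTranspose_mul, conjTranspose_mul]
  rw [← mul_assoc, ← mul_assoc, trace_mul_comm]
  simp only [mul_assoc]

variable [NeZero n]

/-- Each fixed `γ` gives a state of the range of `Γ` on the first two blocks, with its own matrix `C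
γ`. Cyclicity of the trace puts `(word B β)ᴴ` last, as in the companion statement for the last two
blocks, so that the two forms can be compared on `β`. -/
theorem term_left_mulVec_eq_zero_iff (B : Fin n → Mat) (a b c : ℕ)
    (ψ : (Fin (a + b + c) → Fin n) → ℂ) :
    term (a + b + c) 0 (a + b) (exProj B (a + b)) *ᵥ ψ = 0 ↔ ∃ C : (Fin c → Fin n) → Mat,
      ∀ α β γ, ψ (join α β γ) = ((word B α)ᴴ * C γ * (word B β)ᴴ).trace := by
  rw [term_of_le (by omega), emb_mulVec_eq_zero_iff (win_injective _ _ _ _)]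
  have key : ∀ (C : Mat) (α : Fin a → Fin n) (β : Fin b → Fin n),
      (C * (word B (Fin.append α β))ᴴ).trace = ((word B α)ᴴ * C * (word B β)ᴴ).trace := by
    intro C α β
    rw [word_append, conjTranspose_mul, ← mul_assoc, trace_mul_comm, mul_assoc]
  constructor
  · intro h
    have h1 : ∀ γ : Fin c → Fin n, ∃ C : Mat, ∀ (α : Fin a → Fin n) (β : Fin b → Fin n),
        ψ (join α β γ) = ((word B α)ᴴ * C * (word B β)ᴴ).trace := by
      intro γ
      -- The filling `0` of the first two blocks is arbitrary: it is overwritten by the extension.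
      obtain ⟨C, hC⟩ := (exProj_mulVec_eq_zero_iff _ _ _).1 (h (join 0 0 γ))
      refine ⟨C, fun α β => ?_⟩
      rw [← key, ← hC, extend_win_left]
      rfl
    choose C hC using h1
    exact ⟨C, fun α β γ => hC γ α β⟩
  · rintro ⟨C, hC⟩ σ
    obtain ⟨⟨α, β, γ⟩, rfl⟩ := (joinEquiv a b c).surjective σ
    refine (exProj_mulVec_eq_zero_iff _ _ _).2 ⟨C γ, fun μ => ?_⟩
    obtain ⟨μ₁, μ₂, rfl⟩ : ∃ μ₁ μ₂, μ = Fin.append μ₁ μ₂ := ⟨_, _, (Fin.append_castAdd_natAdd).symm⟩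
    change ψ (Function.extend _ _ (join α β γ)) = _
    rw [extend_win_left, key, ← hC]
    rfl

theorem term_right_mulVec_eq_zero_iff (B : Fin n → Mat) (a b c : ℕ)
    (ψ : (Fin (a + b + c) → Fin n) → ℂ) :
    term (a + b + c) a (b + c) (exProj B (b + c)) *ᵥ ψ = 0 ↔ ∃ D : (Fin a → Fin n) → Mat,
      ∀ α β γ, ψ (join α β γ) = (D α * (word B γ)ᴴ * (word B β)ᴴ).trace := by
  rw [term_of_le (by omega), emb_mulVec_eq_zero_iff (win_injective _ _ _ _)]
  constructor
  · intro h
    have h1 : ∀ α : Fin a → Fin n, ∃ D : Mat, ∀ (β : Fin b → Fin n) (γ : Fin c → Fin n),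
        ψ (join α β γ) = (D * (word B γ)ᴴ * (word B β)ᴴ).trace := by
      intro α
      obtain ⟨C, hC⟩ := (exProj_mulVec_eq_zero_iff _ _ _).1 (h (join α 0 0))
      refine ⟨C, fun β γ => ?_⟩
      have := hC (Fin.append β γ)
      rw [extend_win_right, word_append, conjTranspose_mul, ← mul_assoc] at this
      exact this
    choose D hD using h1
    exact ⟨D, hD⟩
  · rintro ⟨D, hD⟩ σ
    obtain ⟨⟨α, β, γ⟩, rfl⟩ := (joinEquiv a b c).surjective σ
    refine (exProj_mulVec_eq_zero_iff _ _ _).2 ⟨D α, fun μ => ?_⟩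
    obtain ⟨μ₁, μ₂, rfl⟩ : ∃ μ₁ μ₂, μ = Fin.append μ₁ μ₂ := ⟨_, _, (Fin.append_castAdd_natAdd).symm⟩
    change ψ (Function.extend _ _ (join α β γ)) = _
    rw [extend_win_right, hD, word_append, conjTranspose_mul, ← mul_assoc]

open scoped MatrixOrder in
/-- The ground state projections of two overlapping blocks of a chain almost commute, if the
overlap is long enough. -/
theorem term_pair_estimate {B : Fin n → Mat} (hS : tupleSpan B * ⊤ = ⊤) (a : ℕ) {b : ℕ} (c : ℕ)
    {x y : Mat} (hx : IsUnit x) (hy : IsUnit y) {z : ℂ} (hz : z ≠ 0) {η : ℝ}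
    (hη : η * k ^ 2 ≤ 1 / 5)
    (hno : NearlyOrthonormal (fun μ : Fin b → Fin n => y * (z • (word B μ)ᴴ) * x) η) :
    (1 - 1 / 4 : ℝ) • (term (a + b + c) 0 (a + b) (exProj B (a + b)) +
        term (a + b + c) a (b + c) (exProj B (b + c))) ≤
      (term (a + b + c) 0 (a + b) (exProj B (a + b)) +
        term (a + b + c) a (b + c) (exProj B (b + c))) *
      (term (a + b + c) 0 (a + b) (exProj B (a + b)) +
        term (a + b + c) a (b + c) (exProj B (b + c))) := by
  refine pair_estimate_matrix (term_isHermitian _ _ _ (exProj_isHermitian _ _))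
    (term_isHermitian _ _ _ (exProj_isHermitian _ _))
    (by rw [← term_mul, exProj_mul_self]) (by rw [← term_mul, exProj_mul_self])
    (by norm_num) (by norm_num) fun u hu => ?_
  obtain ⟨x, rfl⟩ := hx
  obtain ⟨y, rfl⟩ := hy
  rw [term_right_mulVec_eq_zero_iff] at hu
  obtain ⟨D, hD⟩ := hu
  have hK : IsUnit (∑ α : Fin a → Fin n, ((↑x⁻¹ : Mat) * (word B α)ᴴ)ᴴ *
      ((↑x⁻¹ : Mat) * (word B α)ᴴ)) := by
    have hP : ((↑x⁻¹ : Mat)ᴴ * (↑x⁻¹ : Mat)).PosDef :=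
      Matrix.PosDef.conjTranspose_mul_self _ (Matrix.mulVec_injective_of_isUnit (Units.isUnit _))
    have h1 := (krausMap_pow_posDef hS hP a).isUnit
    rw [krausMap_pow_apply] at h1
    convert h1 using 2 with α
    simp only [conjTranspose_mul, conjTranspose_conjTranspose, mul_assoc]
  have trace_conj : ∀ M : Mat, ((↑x⁻¹ : Mat) * M * (x : Mat)).trace = M.trace := by
    intro M
    rw [trace_mul_comm, ← mul_assoc, Units.mul_inv, one_mul]
  have hu' : ∀ α β γ, u.ofLp (joinEquiv a b c (α, β, γ)) =
      ((z⁻¹ • ((↑x⁻¹ : Mat) * D α)) * ((word B γ)ᴴ * (↑y⁻¹ : Mat)) *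
        ((y : Mat) * (z • (word B β)ᴴ) * (x : Mat))).trace := by
    intro α β γ
    have e : (z⁻¹ • ((↑x⁻¹ : Mat) * D α)) * ((word B γ)ᴴ * (↑y⁻¹ : Mat)) *
        ((y : Mat) * (z • (word B β)ᴴ) * (x : Mat)) =
        (↑x⁻¹ : Mat) * (D α * (word B γ)ᴴ * (word B β)ᴴ) * (x : Mat) := by
      simp only [smul_mul_assoc, mul_smul_comm, smul_smul, mul_inv_cancel₀ hz, one_smul]
      simp only [mul_assoc, Units.inv_mul_cancel_left]
    rw [e, trace_conj, ← hD]
    rfl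
  -- Here `δ = 1 / 5`, so that `δ / (1 - δ) = 1 / 4`. The factors `x⁻¹`, `y⁻¹` and `z⁻¹` put into
  -- the outer blocks undo the change of coordinates on the middle one.
  obtain ⟨f, F, hf, hest⟩ := block_estimate (joinEquiv a b c)
    (fun α => (↑x⁻¹ : Mat) * (word B α)ᴴ) _ (fun γ => (word B γ)ᴴ * (↑y⁻¹ : Mat)) hK hno hη
    (by norm_num) (by norm_num) u _ hu'
  have hf' : ∀ α β γ, f.ofLp (join α β γ) =
      ((word B α)ᴴ * (z • F) * (word B γ)ᴴ * (word B β)ᴴ).trace := by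
    intro α β γ
    rw [← trace_conj ((word B α)ᴴ * (z • F) * (word B γ)ᴴ * (word B β)ᴴ)]
    refine (hf α β γ).trans (congrArg trace ?_)
    simp only [smul_mul_assoc, mul_smul_comm]
    simp only [mul_assoc, Units.inv_mul_cancel_left]
  refine ⟨f, ?_, ?_, fun s hs => ?_⟩
  · rw [term_left_mulVec_eq_zero_iff]
    refine ⟨fun γ => z • F * (word B γ)ᴴ, fun α β γ => ?_⟩
    rw [hf']
    simp only [mul_assoc]
  · rw [term_right_mulVec_eq_zero_iff]
    exact ⟨fun α => (word B α)ᴴ * (z • F), hf'⟩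
  · rw [term_left_mulVec_eq_zero_iff] at hs
    obtain ⟨C, hC⟩ := hs
    refine (hest s (fun γ => z⁻¹ • (C γ * (↑y⁻¹ : Mat))) fun α β γ => ?_).trans (by norm_num)
    refine (hC α β γ).trans ?_
    rw [← trace_conj]
    refine congrArg trace ?_
    simp only [smul_mul_assoc, mul_smul_comm, smul_smul, mul_inv_cancel₀ hz, one_smul]
    simp only [mul_assoc, Units.inv_mul_cancel_left]

/-- The intersection property of the ground state spaces. -/
theorem exProj_mulVec_eq_zero_of_blocks {B : Fin n → Mat} (hS : tupleSpan B * ⊤ = ⊤) {a b c : ℕ}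
    (hb : tupleSpan B ^ b = ⊤) {ψ : (Fin (a + b + c) → Fin n) → ℂ}
    (h1 : term (a + b + c) 0 (a + b) (exProj B (a + b)) *ᵥ ψ = 0)
    (h2 : term (a + b + c) a (b + c) (exProj B (b + c)) *ᵥ ψ = 0) :
    exProj B (a + b + c) *ᵥ ψ = 0 := by
  rw [term_left_mulVec_eq_zero_iff] at h1
  rw [term_right_mulVec_eq_zero_iff] at h2
  obtain ⟨C, hC⟩ := h1
  obtain ⟨D, hD⟩ := h2
  -- The words on the overlap span, so equality of the two trace expressions for all `β` is equality
  -- of the coefficients.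
  have hCD : ∀ α γ, (word B α)ᴴ * C γ = D α * (word B γ)ᴴ := by
    intro α γ
    rw [← sub_eq_zero]
    refine (tupleSpan_pow_eq_top_iff B b).1 hb _ fun β => ?_
    rw [sub_mul, trace_sub, ← hC, ← hD, sub_self]
  have hK := (krausMap_pow_posDef hS PosDef.one a).isUnit
  rw [krausMap_pow_apply] at hK
  obtain ⟨K, hK⟩ := hK
  -- Multiplying `hCD` by `word B α` and summing over `α` leaves the invertible `K` in front of `C
  -- γ`, which can then be solved for.
  set F : Mat := (↑K⁻¹ : Mat) * ∑ α : Fin a → Fin n, word B α * D α with hF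
  have hCF : ∀ γ, C γ = F * (word B γ)ᴴ := by
    intro γ
    have : (K : Mat) * C γ = (∑ α : Fin a → Fin n, word B α * D α) * (word B γ)ᴴ := by
      rw [hK, Finset.sum_mul, Finset.sum_mul]
      refine Finset.sum_congr rfl fun α _ => ?_
      rw [mul_one, mul_assoc, hCD, mul_assoc]
    rw [hF, mul_assoc, ← this, Units.inv_mul_cancel_left]
  rw [exProj_mulVec_eq_zero_iff]
  refine ⟨F, fun σ => ?_⟩
  obtain ⟨⟨α, β, γ⟩, rfl⟩ := (joinEquiv a b c).surjective σ
  change ψ (join α β γ) = (F * (word B (join α β γ))ᴴ).trace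
  rw [hC, hCF, word_join, conjTranspose_mul, conjTranspose_mul, mul_assoc, trace_mul_comm]
  simp only [mul_assoc]

end Blocks

/-! ### The kernel of the chain Hamiltonian. -/

section Chain

variable {n k : ℕ}

local notation "Mat" => Matrix (Fin k) (Fin k) ℂ

/-- The Hamiltonian of the chain of length `N`. -/
noncomputable def chainHam (B : Fin n → Mat) (m N : ℕ) : Matrix (Fin N → Fin n) (Fin N → Fin n) ℂ :=
  ∑ x ∈ Finset.range N, term N x m (exProj B m)

open scoped MatrixOrder in
theorem chainHam_nonneg (B : Fin n → Mat) (m N : ℕ) : 0 ≤ chainHam B m N :=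
  Finset.sum_nonneg fun _ _ => term_nonneg _ _ _ (exProj_nonneg B m)

theorem chainHam_mulVec_eq_zero_of_exProj (B : Fin n → Mat) {m N : ℕ}
    {ψ : (Fin N → Fin n) → ℂ} (h : exProj B N *ᵥ ψ = 0) : chainHam B m N *ᵥ ψ = 0 := by
  rw [chainHam, sum_mulVec]
  exact Finset.sum_eq_zero fun x _ => term_mulVec_eq_zero_of_exProj B h

variable [NeZero n]

/-- The blocks grow by one site at a time: two blocks of length `l ≥ m` shifted by one overlap in `l
- 1` sites. Spanning is therefore needed from length `m - 1` on, which is the origin of the bound `m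
≥ k ^ 4 + 1`. -/
theorem mulVec_eq_zero_of_forall_term {B : Fin n → Mat} {m : ℕ} (hm : 1 ≤ m)
    (hB : ∀ j, m ≤ j + 1 → tupleSpan B ^ j = ⊤) (hS : tupleSpan B * ⊤ = ⊤) {N : ℕ}
    {ψ : (Fin N → Fin n) → ℂ} (h : ∀ x < N, term N x m (exProj B m) *ᵥ ψ = 0) :
    ∀ l s, m ≤ l → s + l ≤ N → term N s l (exProj B l) *ᵥ ψ = 0 := by
  intro l s hl
  induction l, hl using Nat.le_induction generalizing s with
  | base => exact fun hs => h s (by omega)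
  | succ l hl ih =>
    intro hs
    obtain ⟨b, rfl⟩ : ∃ b, l = b + 1 := ⟨l - 1, by omega⟩
    have hi := ih s (by omega)
    have hi' := ih (s + 1) (by omega)
    -- The new length is brought to the form `a + b + c` with outer blocks of one site.
    obtain ⟨e, he⟩ : ∃ e, e = 1 + b + 1 := ⟨_, rfl⟩
    have e1 : b + 1 + 1 = e := by omega
    rw [e1] at hs ⊢
    subst he
    rw [← add_zero s, ← term_term (l := 1 + b + 1) (by omega) (by omega)] at hi
    rw [← term_term (l := 1 + b + 1) (by omega) (by omega)] at hi'
    rw [term_of_le hs, emb_mulVec_eq_zero_iff (win_injective _ _ _ _)] at hi hi' ⊢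
    intro σ
    refine exProj_mulVec_eq_zero_of_blocks hS (hB b (by omega)) ?_ (hi' σ)
    have := hi σ
    rwa [add_comm b 1] at this

/-- A zero energy state of a sum of positive terms has zero energy for each term, and growing the
blocks from length `m` reaches the whole chain. -/
theorem exProj_mulVec_eq_zero_of_chainHam {B : Fin n → Mat} {m : ℕ} (hm : 1 ≤ m)
    (hB : ∀ j, m ≤ j + 1 → tupleSpan B ^ j = ⊤) (hS : tupleSpan B * ⊤ = ⊤) {N : ℕ} (hN : m ≤ N)
    {ψ : (Fin N → Fin n) → ℂ} (h : chainHam B m N *ᵥ ψ = 0) : exProj B N *ᵥ ψ = 0 := by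
  have h1 : ∀ x < N, term N x m (exProj B m) *ᵥ ψ = 0 := by
    open scoped MatrixOrder in
    have hp : ∀ x, (term N x m (exProj B m)).PosSemidef :=
      fun x => (term_nonneg N x m (exProj_nonneg B m)).posSemidef
    have h2 : star ψ ⬝ᵥ chainHam B m N *ᵥ ψ = 0 := by rw [h, dotProduct_zero]
    rw [chainHam, sum_mulVec, dotProduct_sum] at h2
    have h3 := (Finset.sum_eq_zero_iff_of_nonneg fun x _ =>
      (hp x).dotProduct_mulVec_nonneg ψ).1 h2
    exact fun x hx => ((hp x).dotProduct_mulVec_zero_iff ψ).1 (h3 x (Finset.mem_range.2 hx))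
  have := mulVec_eq_zero_of_forall_term hm hB hS h1 N 0 hN (by omega)
  rwa [term_self] at this

end Chain

end SpinChain

namespace SpinChain

open Matrix

/-! ### Smooth families of matrices. -/

section Smooth

variable {ι κ ξ : Type*} {s : Set ℝ}

/-- All entries of a family of matrices are smooth. -/
def SmoothOn (A : ℝ → Matrix ι κ ℂ) (s : Set ℝ) : Prop :=
  ∀ i j, ContDiffOn ℝ ∞ (fun t => A t i j) s

theorem SmoothOn.mul [Fintype κ] {A : ℝ → Matrix ι κ ℂ} {A' : ℝ → Matrix κ ξ ℂ}
    (h : SmoothOn A s) (h' : SmoothOn A' s) : SmoothOn (fun t => A t * A' t) s := by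
  intro i j
  simp only [mul_apply]
  exact ContDiffOn.sum fun l _ => (h i l).mul (h' l j)

theorem SmoothOn.conjTranspose {A : ℝ → Matrix ι κ ℂ} (h : SmoothOn A s) :
    SmoothOn (fun t => (A t)ᴴ) s := by
  intro i j
  simp only [conjTranspose_apply]
  exact Complex.conjCLE.contDiff.comp_contDiffOn (h j i)

theorem SmoothOn.det [Fintype ι] [DecidableEq ι] {A : ℝ → Matrix ι ι ℂ} (h : SmoothOn A s) :
    ContDiffOn ℝ ∞ (fun t => (A t).det) s := by
  simp only [det_apply, Units.smul_def, zsmul_eq_mul]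
  exact ContDiffOn.sum fun σ _ => contDiffOn_const.mul (contDiffOn_prod fun i _ => h _ _)

theorem SmoothOn.inv [Fintype ι] [DecidableEq ι] {A : ℝ → Matrix ι ι ℂ} (h : SmoothOn A s)
    (h0 : ∀ t ∈ s, (A t).det ≠ 0) : SmoothOn (fun t => (A t)⁻¹) s := by
  intro i j
  simp only [inv_def, Ring.inverse_eq_inv', Matrix.smul_apply, smul_eq_mul, adjugate_apply]
  refine (h.det.inv h0).mul (SmoothOn.det fun i' j' => ?_)
  by_cases hi : i' = j
  · subst hi
    simp only [updateRow_self]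
    exact contDiffOn_const
  · simp only [updateRow_ne hi]
    exact h i' j'

end Smooth

/-! ### Smoothness of the ground state projections. -/

section Projections

variable {n k : ℕ}

local notation "Mat" => Matrix (Fin k) (Fin k) ℂ

theorem smoothOn_word {B : ℝ → Fin n → Mat} {s : Set ℝ} (hB : ∀ a, SmoothOn (fun t => B t a) s)
    {N : ℕ} (μ : Fin N → Fin n) : SmoothOn (fun t => word (B t) μ) s := by
  induction N with
  | zero =>
    simp only [word_zero]
    exact fun i j => contDiffOn_const
  | succ N ih =>
    rw [← Fin.cons_self_tail μ]
    simp only [word_cons]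
    exact (hB _).mul (ih _)

/-- The matrix of `Γ_N`. -/
def gammaMat (B : Fin n → Mat) (N : ℕ) : Matrix (Fin N → Fin n) (Fin k × Fin k) ℂ :=
  Matrix.of fun μ p => star (word B μ p.1 p.2)

theorem gammaMat_mulVec (B : Fin n → Mat) (N : ℕ) (v : Fin k × Fin k → ℂ) (μ : Fin N → Fin n) :
    (gammaMat B N *ᵥ v) μ = (Matrix.of (fun i j => v (i, j)) * (word B μ)ᴴ).trace := by
  simp only [mulVec, dotProduct, gammaMat, of_apply, trace, diag_apply, mul_apply,
    conjTranspose_apply, Fintype.sum_prod_type]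
  exact Finset.sum_congr rfl fun i _ => Finset.sum_congr rfl fun j _ => mul_comm _ _

theorem exProj_mulVec_eq_zero_iff' (B : Fin n → Mat) (N : ℕ) (v : (Fin N → Fin n) → ℂ) :
    exProj B N *ᵥ v = 0 ↔ ∃ w, v = gammaMat B N *ᵥ w := by
  rw [exProj_mulVec_eq_zero_iff]
  constructor
  · rintro ⟨C, hC⟩
    refine ⟨fun p => C p.1 p.2, ?_⟩
    ext μ
    rw [hC, gammaMat_mulVec]
    rfl
  · rintro ⟨w, rfl⟩
    exact ⟨_, gammaMat_mulVec B N w⟩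

theorem gammaMat_det_ne_zero {B : Fin n → Mat} {N : ℕ} (h : tupleSpan B ^ N = ⊤) :
    ((gammaMat B N)ᴴ * gammaMat B N).det ≠ 0 := by
  intro h0
  obtain ⟨v, hv, hv0⟩ := exists_mulVec_eq_zero_iff.2 h0
  rw [conjTranspose_mul_self_mulVec_eq_zero] at hv0
  have h1 : (Matrix.of fun i j => v (i, j) : Mat) = 0 := by
    refine (tupleSpan_pow_eq_top_iff B N).1 h _ fun μ => ?_
    rw [← gammaMat_mulVec, hv0]
    rfl
  exact hv (funext fun p => congrFun (congrFun h1 p.1) p.2)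

/-- The orthogonal projection onto the range of an injective `M` is a rational expression in `M` and
its adjoint. This makes its dependence on the tuple smooth. -/
theorem groundProj_eq {B : Fin n → Mat} {N : ℕ} (h : tupleSpan B ^ N = ⊤) :
    groundProj B N =
      gammaMat B N * ((gammaMat B N)ᴴ * gammaMat B N)⁻¹ * (gammaMat B N)ᴴ := by
  set M := gammaMat B N
  set P := M * (Mᴴ * M)⁻¹ * Mᴴ with hP
  have hPM : P * M = M := by
    rw [hP, Matrix.mul_assoc, Matrix.mul_assoc,
      nonsing_inv_mul _ (gammaMat_det_ne_zero h).isUnit, Matrix.mul_one]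
  have hEM : exProj B N * M = 0 := by
    refine Matrix.ext_of_mulVec_single fun p => ?_
    rw [← mulVec_mulVec, zero_mulVec]
    exact (exProj_mulVec_eq_zero_iff' B N _).2 ⟨_, rfl⟩
  have hPE : P * exProj B N = 0 := by
    have h1 := congrArg Matrix.conjTranspose hEM
    rw [conjTranspose_mul, (exProj_isHermitian B N).eq, conjTranspose_zero] at h1
    rw [hP, Matrix.mul_assoc, h1, Matrix.mul_zero]
  have hPG : P * groundProj B N = groundProj B N := by
    refine Matrix.ext_of_mulVec_single fun p => ?_
    obtain ⟨w, hw⟩ : ∃ w, groundProj B N *ᵥ Pi.single p 1 = M *ᵥ w := by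
      rw [← exProj_mulVec_eq_zero_iff', mulVec_mulVec, exProj, sub_mul, one_mul,
        groundProj_mul_self, sub_self, zero_mulVec]
    rw [← mulVec_mulVec, hw, mulVec_mulVec, hPM]
  have : P * (groundProj B N + exProj B N) = groundProj B N := by
    rw [mul_add, hPG, hPE, add_zero]
  rw [← this, exProj, add_sub_cancel, mul_one]

theorem smoothOn_exProj {B : ℝ → Fin n → Mat} {s : Set ℝ} (hB : ∀ a, SmoothOn (fun t => B t a) s)
    {N : ℕ} (h : ∀ t ∈ s, tupleSpan (B t) ^ N = ⊤) : SmoothOn (fun t => exProj (B t) N) s := by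
  have hM : SmoothOn (fun t => gammaMat (B t) N) s := fun μ p =>
    Complex.conjCLE.contDiff.comp_contDiffOn (smoothOn_word hB μ p.1 p.2)
  have h1 := (hM.mul ((hM.conjTranspose.mul hM).inv fun t ht =>
    gammaMat_det_ne_zero (h t ht))).mul hM.conjTranspose
  intro i j
  have h2 := (contDiffOn_const (c := (1 : Matrix (Fin N → Fin n) _ ℂ) i j)).sub (h1 i j)
  refine h2.congr fun t ht => ?_
  simp only [exProj, groundProj_eq (h t ht), Matrix.sub_apply]

end Projections

/-! ### Gap of the chains of bounded length, uniformly over a compact set. -/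

section LowerBound

variable {n k : ℕ}

local notation "Mat" => Matrix (Fin k) (Fin k) ℂ

theorem continuousOn_emb {ι κ : Type*} {s : Set ℝ} (f : ι → κ)
    {A : ℝ → Matrix (ι → Fin n) (ι → Fin n) ℂ} (h : ∀ i j, ContinuousOn (fun t => A t i j) s)
    (i j : κ → Fin n) : ContinuousOn (fun t => emb f (A t) i j) s := by
  by_cases hc : ∀ y, y ∉ Set.range f → i y = j y
  · simp only [emb_apply_of _ hc]
    exact h _ _
  · simp only [emb_apply_not _ hc]
    exact continuousOn_const

theorem continuousOn_chainHam {B : ℝ → Fin n → Mat} {s : Set ℝ} {m : ℕ}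
    (hE : SmoothOn (fun t => exProj (B t) m) s) (N : ℕ) (i j : Fin N → Fin n) :
    ContinuousOn (fun t => chainHam (B t) m N i j) s := by
  simp only [chainHam, Matrix.sum_apply]
  refine continuousOn_finsetSum _ fun x _ => ?_
  unfold term
  split_ifs
  · exact continuousOn_emb _ (fun i j => (hE i j).continuousOn) i j
  · exact continuousOn_const

theorem groundProj_mulVec_of_exProj {B : Fin n → Mat} {N : ℕ} {v : (Fin N → Fin n) → ℂ}
    (h : exProj B N *ᵥ v = 0) : groundProj B N *ᵥ v = v := by
  rw [exProj, sub_mulVec, one_mulVec, sub_eq_zero] at h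
  exact h.symm

open scoped MatrixOrder in
-- The kernel of `chainHam` is the range of `groundProj`, so their sum is positive definite, and
-- compactness gives it a uniform lower bound.
theorem exists_smul_exProj_le [NeZero n] {B : ℝ → Fin n → Mat} {s : Set ℝ} (hs : IsCompact s)
    (hBs : ∀ a, SmoothOn (fun t => B t a) s) {m : ℕ} (hm : 1 ≤ m)
    (hB : ∀ t ∈ s, ∀ j, m ≤ j + 1 → tupleSpan (B t) ^ j = ⊤)
    (hS : ∀ t ∈ s, tupleSpan (B t) * ⊤ = ⊤) {l : ℕ} (hl : m ≤ l) :
    ∃ c : ℝ, 0 < c ∧ ∀ t ∈ s, c • exProj (B t) l ≤ chainHam (B t) m l := by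
  have hE := smoothOn_exProj hBs fun t ht => hB t ht l (by omega)
  have hEm := smoothOn_exProj hBs fun t ht => hB t ht m (by omega)
  have hG0 : ∀ t, 0 ≤ groundProj (B t) l := by
    intro t
    have := star_mul_self_nonneg (groundProj (B t) l)
    rwa [star_eq_conjTranspose, (groundProj_isHermitian (B t) l).eq, groundProj_mul_self] at this
  obtain ⟨c, hc, h⟩ := exists_uniform_lower_bound hs
    (M := fun t => chainHam (B t) m l + (1 - exProj (B t) l)) (fun i j => by
      simp only [Matrix.add_apply, Matrix.sub_apply]
      exact (continuousOn_chainHam hEm l i j).add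
        (continuousOn_const.sub (hE i j).continuousOn)) (fun t ht => by
      rw [exProj, sub_sub_cancel]
      have h1 := (chainHam_nonneg (B t) m l).posSemidef
      have h2 := (hG0 t).posSemidef
      refine PosDef.of_dotProduct_mulVec_pos (h1.add h2).1 fun v hv => ?_
      refine lt_of_le_of_ne ((h1.add h2).dotProduct_mulVec_nonneg v) (Ne.symm fun h0 => hv ?_)
      rw [add_mulVec, dotProduct_add, add_eq_zero_iff_of_nonneg (h1.dotProduct_mulVec_nonneg v)
        (h2.dotProduct_mulVec_nonneg v), h1.dotProduct_mulVec_zero_iff,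
        h2.dotProduct_mulVec_zero_iff] at h0
      have h3 := exProj_mulVec_eq_zero_of_chainHam hm (hB t ht) (hS t ht) hl h0.1
      rw [← groundProj_mulVec_of_exProj h3, h0.2])
  refine ⟨c, hc, fun t ht => ?_⟩
  -- Conjugation by the excitation projection removes the ground state projection and leaves the
  -- Hamiltonian unchanged.
  have h1 := star_left_conjugate_le_conjugate (h t ht) (exProj (B t) l)
  have hH : chainHam (B t) m l * exProj (B t) l = chainHam (B t) m l := by
    have : chainHam (B t) m l * groundProj (B t) l = 0 := by
      refine Matrix.ext_of_mulVec_single fun p => ?_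
      rw [← mulVec_mulVec, zero_mulVec]
      refine chainHam_mulVec_eq_zero_of_exProj _ ?_
      rw [mulVec_mulVec, exProj, sub_mul, one_mul, groundProj_mul_self, sub_self, zero_mulVec]
    rw [exProj, mul_sub, this, mul_one, sub_zero]
  have hH' : exProj (B t) l * chainHam (B t) m l = chainHam (B t) m l := by
    have h2 := congrArg Matrix.conjTranspose hH
    rwa [conjTranspose_mul, (exProj_isHermitian _ _).eq,
      (chainHam_nonneg (B t) m l).posSemidef.1.eq] at h2
  rw [star_eq_conjTranspose, (exProj_isHermitian _ _).eq, mul_smul_comm, mul_one, smul_mul_assoc,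
    exProj_mul_self, mul_add, add_mul, hH', hH, mul_sub, mul_one, exProj_mul_self, sub_self,
    zero_mul, add_zero] at h1
  exact h1

open scoped MatrixOrder in
theorem exists_smul_exProj_le_of_finset [NeZero n] {B : ℝ → Fin n → Mat} {s : Set ℝ}
    (hs : IsCompact s)
    (hBs : ∀ a, SmoothOn (fun t => B t a) s) {m : ℕ} (hm : 1 ≤ m)
    (hB : ∀ t ∈ s, ∀ j, m ≤ j + 1 → tupleSpan (B t) ^ j = ⊤)
    (hS : ∀ t ∈ s, tupleSpan (B t) * ⊤ = ⊤) (F : Finset ℕ) (hF : ∀ l ∈ F, m ≤ l) :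
    ∃ c : ℝ, 0 < c ∧ ∀ l ∈ F, ∀ t ∈ s, c • exProj (B t) l ≤ chainHam (B t) m l := by
  induction F using Finset.induction_on with
  | empty => exact ⟨1, one_pos, by simp⟩
  | insert l F _ ih =>
    obtain ⟨c, hc, h⟩ := ih fun l hl => hF l (Finset.mem_insert_of_mem hl)
    obtain ⟨c', hc', h'⟩ :=
      exists_smul_exProj_le hs hBs hm hB hS (hF l (Finset.mem_insert_self _ _))
    refine ⟨min c c', lt_min hc hc', fun i hi t ht => ?_⟩
    rcases Finset.mem_insert.1 hi with rfl | hi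
    · exact (smul_le_smul_of_nonneg_right (min_le_right _ _) (exProj_nonneg _ _)).trans (h' t ht)
    · exact (smul_le_smul_of_nonneg_right (min_le_left _ _) (exProj_nonneg _ _)).trans (h i hi t ht)

end LowerBound

/-! ### Covering a long chain by overlapping blocks. -/

section Cover

variable {n k : ℕ}

local notation "Mat" => Matrix (Fin k) (Fin k) ℂ

/-- The length of the `i`-th block of a chain of `N` sites covered by `q` blocks that start at the
multiples of `p`. -/
def blockLength (N p q i : ℕ) : ℕ := if i + 1 < q then p + p else N - i * p

/-- The excitation projection of the `i`-th block. -/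
noncomputable def blockProj (B : Fin n → Mat) (N p q i : ℕ) :
    Matrix (Fin N → Fin n) (Fin N → Fin n) ℂ :=
  term N (i * p) (blockLength N p q i) (exProj B (blockLength N p q i))

variable {N p q : ℕ}

theorem blockLength_of_lt {i : ℕ} (h : i + 1 < q) : blockLength N p q i = p + p := if_pos h

theorem blockLength_last {i : ℕ} (h : i + 1 = q) : blockLength N p q i = N - i * p :=
  if_neg (by omega)

theorem block_le (hN : (q + 1) * p ≤ N) {i : ℕ} (hi : i < q) :
    i * p + blockLength N p q i ≤ N := by
  rcases Nat.lt_or_ge (i + 1) q with h | h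
  · rw [blockLength_of_lt h]
    calc i * p + (p + p) = (i + 2) * p := by ring
      _ ≤ (q + 1) * p := Nat.mul_le_mul_right p (by omega)
      _ ≤ N := hN
  · rw [blockLength_last (by omega)]
    have : i * p ≤ (q + 1) * p := Nat.mul_le_mul_right p (by omega)
    omega

theorem two_mul_le_blockLength (hN : (q + 1) * p ≤ N) {i : ℕ} (hi : i < q) :
    p + p ≤ blockLength N p q i := by
  rcases Nat.lt_or_ge (i + 1) q with h | h
  · rw [blockLength_of_lt h]
  · rw [blockLength_last (by omega)]
    have : i * p + (p + p) ≤ (q + 1) * p := by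
      calc i * p + (p + p) = (i + 2) * p := by ring
        _ ≤ (q + 1) * p := Nat.mul_le_mul_right p (by omega)
    omega

theorem blockLength_lt (hN' : N < (q + 2) * p) {i : ℕ} (hi : i < q) :
    blockLength N p q i < p + p + p := by
  have hp : 0 < p := Nat.pos_of_ne_zero (by rintro rfl; omega)
  rcases Nat.lt_or_ge (i + 1) q with h | h
  · rw [blockLength_of_lt h]
    omega
  · rw [blockLength_last (by omega)]
    have : (q + 2) * p = i * p + (p + p + p) := by
      have : q = i + 1 := by omega
      rw [this]
      ring
    omega

open scoped MatrixOrder in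
theorem half_smul_sum_blockProj_le [NeZero n] {B : Fin n → Mat} (hS : tupleSpan B * ⊤ = ⊤)
    {x y : Mat} (hx : IsUnit x) (hy : IsUnit y) {z : ℂ} (hz : z ≠ 0) {η : ℝ}
    (hη : η * k ^ 2 ≤ 1 / 5)
    (hno : NearlyOrthonormal (fun μ : Fin p → Fin n => y * (z • (word B μ)ᴴ) * x) η)
    (hq : 1 ≤ q) (hN : (q + 1) * p ≤ N) :
    (1 / 2 : ℝ) • ∑ i ∈ Finset.range q, blockProj B N p q i ≤
      (∑ i ∈ Finset.range q, blockProj B N p q i) *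
        ∑ i ∈ Finset.range q, blockProj B N p q i := by
  have h0 : ∀ i, 0 ≤ blockProj B N p q i := fun i => term_nonneg _ _ _ (exProj_nonneg _ _)
  -- Blocks two apart are disjoint and their projections commute. The factor `1 / 2` is `1 - 2 ε`.
  have h := sum_estimate (h := blockProj B N p q) hq (ε := 1 / 4) (by norm_num)
    (fun i _ => term_isHermitian _ _ _ (exProj_isHermitian _ _))
    (fun i _ => by rw [blockProj, ← term_mul, exProj_mul_self]) (fun i j hij hj => ?_)
    (fun i hi => ?_)
  · refine le_trans ?_ h
    rw [show (1 - 2 * (1 / 4) : ℝ) = 1 / 2 by norm_num]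
    exact le_add_of_nonneg_right (smul_nonneg (by norm_num) (h0 _))
  · refine term_commute _ ?_ _ _
    rw [blockLength_of_lt (by omega)]
    calc i * p + (p + p) = (i + 2) * p := by ring
      _ ≤ j * p := Nat.mul_le_mul_right p hij
  · have hle := block_le hN hi
    -- Block `i + 1` has length `p + c`, so it and block `i` cover `p + p + c` sites and overlap in
    -- `p`; this is `term_pair_estimate` with `a = b = p`.
    obtain ⟨c, hc⟩ := Nat.exists_eq_add_of_le
      ((Nat.le_add_right p p).trans (two_mul_le_blockLength hN hi))
    have hle' : i * p + (p + p + c) ≤ N := by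
      rw [hc] at hle
      calc i * p + (p + p + c) = (i + 1) * p + (p + c) := by ring
        _ ≤ N := hle
    have h1 := term_mono N (i * p) (p + p + c) (term_pair_estimate hS p c hx hy hz hη hno)
    rw [term_smul, term_mul, term_add, term_term hle' (by omega), term_term hle' (by omega)] at h1
    have e1 : blockProj B N p q i = term N (i * p + 0) (p + p) (exProj B (p + p)) := by
      rw [blockProj, blockLength_of_lt hi, add_zero]
    have e2 : blockProj B N p q (i + 1) = term N (i * p + p) (p + c) (exProj B (p + c)) := by
      rw [blockProj, hc, Nat.succ_mul]
    rw [e1, e2]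
    exact h1

theorem exists_block {m y : ℕ} (hm : m ≤ p) (hq : 1 ≤ q) (hy : y + m ≤ N)
    (hp : 1 ≤ p) : ∃ i < q, i * p ≤ y ∧ y + m ≤ i * p + blockLength N p q i := by
  rcases Nat.lt_or_ge (y / p + 1) q with h | h
  · refine ⟨y / p, by omega, Nat.div_mul_le_self y p, ?_⟩
    rw [blockLength_of_lt h]
    have := Nat.lt_div_mul_add (a := y) (b := p) hp
    omega
  · have h1 : (q - 1) * p ≤ y := (Nat.le_div_iff_mul_le hp).1 (by omega)
    refine ⟨q - 1, by omega, h1, ?_⟩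
    rw [blockLength_last (by omega)]
    omega

theorem term_mulVec_eq_zero_of_blockProj (B : Fin n → Mat) {m y i : ℕ} (hi : i * p ≤ y)
    (hy : y + m ≤ i * p + blockLength N p q i) (hN : i * p + blockLength N p q i ≤ N)
    {ψ : (Fin N → Fin n) → ℂ} (h : blockProj B N p q i *ᵥ ψ = 0) :
    term N y m (exProj B m) *ᵥ ψ = 0 := by
  obtain ⟨x, rfl⟩ := Nat.exists_eq_add_of_le hi
  rw [← term_term hN (by omega)]
  exact term_mulVec_eq_zero (fun v hv => term_mulVec_eq_zero_of_exProj B hv) h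

theorem chainHam_mulVec_eq_zero_of_blockProj (B : Fin n → Mat) {m : ℕ} (hm : m ≤ p) (hp : 1 ≤ p)
    (hq : 1 ≤ q) (hN : (q + 1) * p ≤ N) {ψ : (Fin N → Fin n) → ℂ}
    (h : ∀ i < q, blockProj B N p q i *ᵥ ψ = 0) : chainHam B m N *ᵥ ψ = 0 := by
  rw [chainHam, sum_mulVec]
  refine Finset.sum_eq_zero fun y _ => ?_
  rcases lt_or_ge N (y + m) with hy | hy
  · rw [term_of_lt hy, zero_mulVec]
  · obtain ⟨i, hi, hiy, hyi⟩ := exists_block hm hq hy hp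
    exact term_mulVec_eq_zero_of_blockProj B hiy hyi (block_le hN hi) (h i hi)

theorem term_chainHam (B : Fin n → Mat) {m s l : ℕ} (hm : 1 ≤ m) (hs : s + l ≤ N) :
    term N s l (chainHam B m l) = ∑ y ∈ Finset.range N,
      if s ≤ y ∧ y + m ≤ s + l then term N y m (exProj B m) else 0 := by
  rw [chainHam, term_sum]
  have h1 : ∀ x ∈ Finset.range l, term N s l (term l x m (exProj B m)) =
      if s ≤ s + x ∧ s + x + m ≤ s + l then term N (s + x) m (exProj B m) else 0 := by
    intro x _
    split_ifs with h
    · exact term_term hs (by omega) _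
    · rw [term_of_lt (by omega) (exProj B m)]
      rw [term_of_le hs, emb_zero]
  rw [Finset.sum_congr rfl h1, ← Finset.sum_image (g := fun x => s + x)
    (f := fun y => if s ≤ y ∧ y + m ≤ s + l then term N y m (exProj B m) else 0)
    (fun _ _ _ _ h => Nat.add_left_cancel h)]
  refine Finset.sum_subset (fun y hy => ?_) fun y _ hy => if_neg fun hc => hy ?_
  · obtain ⟨x, hx, rfl⟩ := Finset.mem_image.1 hy
    have := Finset.mem_range.1 hx
    exact Finset.mem_range.2 (by omega)
  · exact Finset.mem_image.2 ⟨y - s, Finset.mem_range.2 (by omega), by omega⟩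

/-- Apart from the last block, which may be longer, a block of length `2 p` that starts at `i p` can
contain the site `y` only for `i = y / p` or `i = y / p - 1`. -/
theorem card_blocks_le (m y : ℕ) (hm : 1 ≤ m) (hp : 1 ≤ p) :
    ((Finset.range q).filter fun i =>
      i * p ≤ y ∧ y + m ≤ i * p + blockLength N p q i).card ≤ 3 := by
  refine (Finset.card_le_card (t := {y / p - 1, y / p, q - 1}) fun i hi => ?_).trans
    Finset.card_le_three
  rw [Finset.mem_filter, Finset.mem_range] at hi
  obtain ⟨hi, h1, h2⟩ := hi
  simp only [Finset.mem_insert, Finset.mem_singleton]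
  rcases Nat.lt_or_ge (i + 1) q with h | h
  · rw [blockLength_of_lt h] at h2
    have h3 : i ≤ y / p := (Nat.le_div_iff_mul_le hp).2 h1
    have h4 : y / p < i + 2 := by
      rw [Nat.div_lt_iff_lt_mul hp]
      calc y < i * p + (p + p) := by omega
        _ = (i + 2) * p := by ring
    omega
  · omega

open scoped MatrixOrder in
theorem sum_term_chainHam_le (B : Fin n → Mat) {m : ℕ} (hm : 1 ≤ m) (hp : 1 ≤ p)
    (hN : (q + 1) * p ≤ N) :
    ∑ i ∈ Finset.range q, term N (i * p) (blockLength N p q i)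
      (chainHam B m (blockLength N p q i)) ≤ (3 : ℝ) • chainHam B m N := by
  rw [Finset.sum_congr rfl fun i hi =>
    term_chainHam B hm (block_le hN (Finset.mem_range.1 hi)), Finset.sum_comm, chainHam,
    Finset.smul_sum]
  refine Finset.sum_le_sum fun y _ => ?_
  rw [← Finset.sum_filter, Finset.sum_const, ← Nat.cast_smul_eq_nsmul ℝ]
  refine smul_le_smul_of_nonneg_right ?_ (term_nonneg _ _ _ (exProj_nonneg _ _))
  exact_mod_cast card_blocks_le m y hm hp

end Cover

end SpinChain

namespace SpinChain

open Matrix Filter Topology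

/-! ### The uniform gap of the chain Hamiltonians. -/

section Gap

variable {n k : ℕ}

local notation "Mat" => Matrix (Fin k) (Fin k) ℂ

/-- The image of the identity under `Γ` has energy `0`, and it is nonzero because the words of
length `N` span. -/
theorem isLeast_spectrum_chainHam (hk : 1 ≤ k) {B : Fin n → Mat} (m : ℕ) {N : ℕ}
    (hB : tupleSpan B ^ N = ⊤) : IsLeast (spectrum ℝ (chainHam B m N)) 0 := by
  open scoped MatrixOrder in
  have hpos : (chainHam B m N).PosSemidef := (chainHam_nonneg B m N).posSemidef
  constructor
  · rw [spectrum.zero_mem_iff]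
    intro hu
    have : Nonempty (Fin k) := ⟨⟨0, hk⟩⟩
    have h1 : exProj B N *ᵥ (fun μ => (1 * (word B μ)ᴴ).trace) = 0 :=
      (exProj_mulVec_eq_zero_iff _ _ _).2 ⟨1, fun μ => rfl⟩
    have h2 := chainHam_mulVec_eq_zero_of_exProj B (m := m) h1
    rw [← mulVec_zero (chainHam B m N)] at h2
    have h3 := Matrix.mulVec_injective_of_isUnit hu h2
    exact one_ne_zero ((tupleSpan_pow_eq_top_iff B N).1 hB 1 fun μ => congrFun h3 μ)
  · intro ν hν
    rw [hpos.1.spectrum_real_eq_range_eigenvalues] at hν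
    obtain ⟨i, rfl⟩ := hν
    exact hpos.eigenvalues_nonneg i

/-- The condition consists of finitely many strict inequalities between continuous functions. -/
theorem eventually_nearlyOrthonormal {β : Type*} [Fintype β] {w : ℝ → β → Mat} {s : Set ℝ}
    {t₀ : ℝ} (ht₀ : t₀ ∈ s) (hw : ∀ b, SmoothOn (fun t => w t b) s) {η : ℝ}
    (h : NearlyOrthonormal (w t₀) η) : ∀ᶠ t in 𝓝[s] t₀, NearlyOrthonormal (w t) η := by
  unfold NearlyOrthonormal at *
  simp only [eventually_all]
  intro a b c d
  have hc : ContinuousOn (fun t => ‖∑ μ, star (w t μ a b) * w t μ c d -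
      if a = c ∧ b = d then 1 else 0‖) s := by
    refine ContinuousOn.norm (ContinuousOn.sub (continuousOn_finsetSum _ fun μ _ => ?_)
      continuousOn_const)
    exact ((hw μ a b).continuousOn.star).mul (hw μ c d).continuousOn
  exact (hc t₀ ht₀).eventually (isOpen_Iio.mem_nhds (h a b c d))

variable [NeZero n]

open scoped MatrixOrder in
-- The block projections sum to `A` with `A² ≥ A / 2`. Every term of the Hamiltonian lies in at most
-- three blocks, whence `H ≥ (c / 3) A`, and `spectrum_gap` gives the product of the two constants.
theorem eigenvalue_ge_of_nearlyOrthonormal {B : Fin n → Mat} (hS : tupleSpan B * ⊤ = ⊤) {m p : ℕ}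
    (hm : 1 ≤ m) (hmp : m ≤ p) {x y : Mat} (hx : IsUnit x) (hy : IsUnit y) {z : ℂ} (hz : z ≠ 0)
    {η : ℝ} (hη : η * k ^ 2 ≤ 1 / 5)
    (hno : NearlyOrthonormal (fun μ : Fin p → Fin n => y * (z • (word B μ)ᴴ) * x) η) {c : ℝ}
    (hc : 0 < c) (hlow : ∀ l, p + p ≤ l → l < p + p + p → c • exProj B l ≤ chainHam B m l)
    {N : ℕ} (hN : p + p ≤ N) {ν : ℝ} (hν : ν ∈ spectrum ℝ (chainHam B m N)) (h0 : ν ≠ 0) :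
    c / 6 ≤ ν := by
  have hp : 1 ≤ p := hm.trans hmp
  have h2 : 2 ≤ N / p := (Nat.le_div_iff_mul_le hp).2 (by omega)
  -- This number of blocks gives the last one a length from `2 p` to below `3 p`, so only finitely
  -- many block lengths occur for all `N`.
  obtain ⟨q, hq⟩ : ∃ q, N / p = q + 1 := ⟨N / p - 1, by omega⟩
  have hq1 : 1 ≤ q := by omega
  have hN1 : (q + 1) * p ≤ N := by
    rw [← hq]
    exact Nat.div_mul_le_self N p
  have hN2 : N < (q + 2) * p := by
    have := Nat.lt_div_mul_add (a := N) (b := p) hp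
    rw [hq] at this
    calc N < (q + 1) * p + p := this
      _ = (q + 2) * p := by ring
  set A := ∑ i ∈ Finset.range q, blockProj B N p q i with hA
  have hpos : ∀ i, 0 ≤ blockProj B N p q i := fun i => term_nonneg _ _ _ (exProj_nonneg _ _)
  have hA0 : 0 ≤ A := Finset.sum_nonneg fun i _ => hpos i
  have h1 := half_smul_sum_blockProj_le hS hx hy hz hη hno hq1 hN1
  have hcA : (c / 3) • A ≤ chainHam B m N := by
    have h3 : c • A ≤ (3 : ℝ) • chainHam B m N := by
      refine le_trans ?_ (sum_term_chainHam_le B hm hp hN1)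
      rw [hA, Finset.smul_sum]
      refine Finset.sum_le_sum fun i hi => ?_
      have hi' := Finset.mem_range.1 hi
      rw [blockProj, ← term_smul]
      exact term_mono _ _ _ (hlow _ (two_mul_le_blockLength hN1 hi') (blockLength_lt hN2 hi'))
    have h4 := smul_le_smul_of_nonneg_left h3 (by norm_num : (0 : ℝ) ≤ 3⁻¹)
    rw [smul_smul, smul_smul, inv_mul_cancel₀ (by norm_num), one_smul] at h4
    rwa [div_eq_inv_mul]
  have hker : ∀ v, A *ᵥ v = 0 → chainHam B m N *ᵥ v = 0 := by
    intro v hv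
    refine chainHam_mulVec_eq_zero_of_blockProj B hmp hp hq1 hN1 fun i hi => ?_
    have h2 : star v ⬝ᵥ A *ᵥ v = 0 := by rw [hv, dotProduct_zero]
    rw [hA, sum_mulVec, dotProduct_sum] at h2
    have h3 := (Finset.sum_eq_zero_iff_of_nonneg fun i _ =>
      (hpos i).posSemidef.dotProduct_mulVec_nonneg v).1 h2
    exact ((hpos i).posSemidef.dotProduct_mulVec_zero_iff v).1 (h3 i (Finset.mem_range.2 hi))
  have := spectrum_gap hA0 (chainHam_nonneg B m N) (by positivity) h1 hcA hker hν h0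
  linarith

/-- Coordinates and a block length that make the words nearly orthonormal at `t₀` still do so at
nearby parameters. They give one gap and one minimal length near `t₀`; finitely many neighbourhoods
suffice. -/
theorem chainHam_uniform_gap (hk : 1 ≤ k) {B : ℝ → Fin n → Mat} {s : Set ℝ} (hs : IsCompact s)
    (hBs : ∀ a, SmoothOn (fun t => B t a) s) {L m : ℕ} (hL : 1 ≤ L) (hm : L + 1 ≤ m)
    (hB : ∀ t ∈ s, tupleSpan (B t) ^ L = ⊤) :
    ∃ γ : ℝ, 0 < γ ∧ ∃ N₀ : ℕ, ∀ t ∈ s, ∀ N, N₀ ≤ N →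
      ∀ ν ∈ spectrum ℝ (chainHam (B t) m N), ν ≠ 0 → γ ≤ ν := by
  have hS : ∀ t ∈ s, tupleSpan (B t) * ⊤ = ⊤ := fun t ht => mul_top_of_pow_eq_top hL (hB t ht)
  have hB' : ∀ t ∈ s, ∀ j, m ≤ j + 1 → tupleSpan (B t) ^ j = ⊤ := fun t ht j hj =>
    pow_eq_top_of_le (hS t ht) (hB t ht) (by omega)
  have main : ∃ γ : ℝ, 0 < γ ∧ ∃ N₀ : ℕ, ∀ t ∈ s, t ∈ s → ∀ N, N₀ ≤ N →
      ∀ ν ∈ spectrum ℝ (chainHam (B t) m N), ν ≠ 0 → γ ≤ ν := by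
    refine hs.induction_on (p := fun s' => ∃ γ : ℝ, 0 < γ ∧ ∃ N₀ : ℕ, ∀ t ∈ s', t ∈ s → ∀ N,
      N₀ ≤ N → ∀ ν ∈ spectrum ℝ (chainHam (B t) m N), ν ≠ 0 → γ ≤ ν) ?_ ?_ ?_ ?_
    · exact ⟨1, one_pos, 0, by simp⟩
    · rintro s₁ s₂ h12 ⟨γ, hγ, N₀, h⟩
      exact ⟨γ, hγ, N₀, fun t ht => h t (h12 ht)⟩
    · rintro s₁ s₂ ⟨γ₁, hγ₁, N₁, h₁⟩ ⟨γ₂, hγ₂, N₂, h₂⟩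
      refine ⟨min γ₁ γ₂, lt_min hγ₁ hγ₂, max N₁ N₂, ?_⟩
      rintro t (ht | ht) hts N hN ν hν h0
      · exact (min_le_left _ _).trans (h₁ t ht hts N ((le_max_left _ _).trans hN) ν hν h0)
      · exact (min_le_right _ _).trans (h₂ t ht hts N ((le_max_right _ _).trans hN) ν hν h0)
    · intro t₀ ht₀
      have hk' : (0 : ℝ) < k := by exact_mod_cast hk
      obtain ⟨x, y, hx, hy, j₀, hj⟩ := exists_nearlyOrthonormal hk (B t₀)
        (strictlyPositive_of_pow_eq_top (hB t₀ ht₀)) (η := 1 / (5 * k ^ 2)) (by positivity)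
      obtain ⟨z, hz, hno⟩ := hj (max j₀ m) (le_max_left _ _)
      -- Perron-Frobenius is applied to the `L`-th power of the map, so overlaps have lengths
      -- divisible by `L`; the maximum ensures `m ≤ p`.
      set p := L * max j₀ m with hp
      have hmp : m ≤ p := (le_max_right j₀ m).trans (Nat.le_mul_of_pos_left _ hL)
      have hev := eventually_nearlyOrthonormal (s := s) ht₀
        (w := fun t (μ : Fin p → Fin n) => y * (z • (word (B t) μ)ᴴ) * x) (fun μ => by
          have hconst : ∀ M : Mat, SmoothOn (fun _ => M) s := fun M i j => contDiffOn_const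
          have h1 := ((hconst y).mul (smoothOn_word hBs μ).conjTranspose).mul (hconst (z • x))
          simpa only [mul_smul_comm, smul_mul_assoc] using h1) hno
      obtain ⟨c, hc, hlow⟩ := exists_smul_exProj_le_of_finset hs hBs (by omega : 1 ≤ m) hB' hS
        (Finset.Ico (p + p) (p + p + p)) fun l hl => by
          have := (Finset.mem_Ico.1 hl).1
          omega
      refine ⟨{t | NearlyOrthonormal
        (fun μ : Fin p → Fin n => y * (z • (word (B t) μ)ᴴ) * x) (1 / (5 * k ^ 2))}, hev,
        c / 6, by positivity, p + p, fun t ht hts N hN ν hν h0 => ?_⟩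
      refine eigenvalue_ge_of_nearlyOrthonormal (hS t hts) (by omega) hmp hx hy hz ?_ ht hc
        (fun l h1 h2 => hlow l (Finset.mem_Ico.2 ⟨h1, h2⟩) t hts) hN hν h0
      field_simp
      norm_num
  obtain ⟨γ, hγ, N₀, h⟩ := main
  exact ⟨γ, hγ, N₀, fun t ht => h t ht ht⟩

end Gap

end SpinChain

namespace SpinChain

open Matrix

/-! ### From interactions on the integers to chains of `N` sites. -/

section Interactions

variable {n k : ℕ}

local notation "Mat" => Matrix (Fin k) (Fin k) ℂ

/-- Shows that the left end chosen in `parentInteraction` is the actual one. -/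
theorem interval_left_unique {m : ℕ} (hm : 1 ≤ m) {z z' : ℤ}
    (h : Finset.Icc z (z + m - 1) = Finset.Icc z' (z' + m - 1)) : z = z' := by
  have h1 : z ∈ Finset.Icc z' (z' + m - 1) := by
    rw [← h, Finset.mem_Icc]
    omega
  have h2 : z' ∈ Finset.Icc z (z + m - 1) := by
    rw [h, Finset.mem_Icc]
    omega
  rw [Finset.mem_Icc] at h1 h2
  omega

theorem parentInteraction_apply (B : Fin n → Mat) {m : ℕ} (hm : 1 ≤ m) {X : Finset ℤ} {z : ℤ}
    (h : X = Finset.Icc z (z + m - 1)) (σ σ' : X → Fin n) :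
    (parentInteraction B m).toFun X σ σ' =
      exProj B m (fun i => σ ⟨z + (i : ℤ), add_mem_interval h i⟩)
        (fun i => σ' ⟨z + (i : ℤ), add_mem_interval h i⟩) := by
  have hex : ∃ x : ℤ, X = Finset.Icc x (x + m - 1) := ⟨z, h⟩
  have hz : hex.choose = z := interval_left_unique hm (hex.choose_spec.symm.trans h)
  simp only [parentInteraction, dif_pos hex, submatrix_apply, hz]
  rfl

theorem parentInteraction_eq_zero (B : Fin n → Mat) {m : ℕ} {X : Finset ℤ}
    (h : ¬ ∃ x : ℤ, X = Finset.Icc x (x + m - 1)) : (parentInteraction B m).toFun X = 0 :=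
  dif_neg h

theorem shiftSet_Icc (j z : ℤ) (m : ℕ) :
    shiftSet j (Finset.Icc z (z + m - 1)) = Finset.Icc (z + j) (z + j + m - 1) := by
  ext w
  simp only [shiftSet, Finset.mem_map, Finset.mem_Icc, addRightEmbedding_apply]
  constructor
  · rintro ⟨a, ha, rfl⟩
    omega
  · intro hw
    exact ⟨w - j, by omega, by omega⟩

theorem shiftSet_neg_shiftSet (j : ℤ) (X : Finset ℤ) : shiftSet (-j) (shiftSet j X) = X := by
  ext w
  simp [shiftSet]

theorem parentInteraction_mem (B : Fin n → Mat) {m : ℕ} (hm : 1 ≤ m) :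
    parentInteraction B m ∈ interactionsOfLength n m := by
  refine ⟨fun X => ?_, fun j X => ?_, fun X hX => ?_⟩
  · by_cases h : ∃ x : ℤ, X = Finset.Icc x (x + m - 1)
    · open scoped MatrixOrder in
      obtain ⟨z, hz⟩ := h
      have e : (parentInteraction B m).toFun X = (exProj B m).submatrix
          (fun σ i => σ ⟨z + (i : ℤ), add_mem_interval hz i⟩)
          (fun σ i => σ ⟨z + (i : ℤ), add_mem_interval hz i⟩) := by
        ext σ σ'
        exact parentInteraction_apply B hm hz σ σ'
      rw [e]
      exact (exProj_nonneg B m).posSemidef.submatrix _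
    · rw [parentInteraction_eq_zero B h]
      exact PosSemidef.zero
  · by_cases h : ∃ x : ℤ, X = Finset.Icc x (x + m - 1)
    · obtain ⟨z, hz⟩ := h
      have hz' : shiftSet j X = Finset.Icc (z + j) (z + j + m - 1) := by rw [hz, shiftSet_Icc]
      ext σ σ'
      rw [parentInteraction_apply B hm hz', shift, of_apply, parentInteraction_apply B hm hz]
      simp only [add_right_comm z j]
    · have h' : ¬ ∃ x : ℤ, shiftSet j X = Finset.Icc x (x + m - 1) := by
        rintro ⟨z, hz⟩
        refine h ⟨z + -j, ?_⟩
        rw [← shiftSet_Icc, ← hz, shiftSet_neg_shiftSet]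
      rw [parentInteraction_eq_zero B h, parentInteraction_eq_zero B h']
      rfl
  · refine parentInteraction_eq_zero B ?_
    rintro ⟨z, rfl⟩
    refine hX.not_ge (Metric.diam_le_of_forall_dist_le (Nat.cast_nonneg m) fun a ha b hb => ?_)
    rw [Finset.mem_coe, Finset.mem_Icc] at ha hb
    rw [Int.dist_eq, ← Int.cast_sub, ← Int.cast_abs]
    have : |a - b| ≤ (m : ℤ) := abs_le.2 (by omega)
    exact_mod_cast this

theorem mem_Icc_of_lt_card {x y : ℤ} {i : ℕ} (hi : i < (Finset.Icc x y).card) :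
    x + (i : ℤ) ∈ Finset.Icc x y := by
  rw [Int.card_Icc] at hi
  rw [Finset.mem_Icc]
  omega

/-- The sites of an interval, numbered from left to right. -/
noncomputable def siteEquiv (x y : ℤ) : Fin (Finset.Icc x y).card ≃ Finset.Icc x y :=
  Equiv.ofBijective (fun i => ⟨x + (i : ℤ), mem_Icc_of_lt_card i.2⟩) <| by
    constructor
    · intro i j hij
      have := congrArg Subtype.val hij
      simp only at this
      exact Fin.ext (by omega)
    · rintro ⟨w, hw⟩
      have hw' := Finset.mem_Icc.1 hw
      exact ⟨⟨(w - x).toNat, by rw [Int.card_Icc]; omega⟩, Subtype.ext (by simp only; omega)⟩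

theorem siteEquiv_apply (x y : ℤ) (i : Fin (Finset.Icc x y).card) :
    siteEquiv x y i = ⟨x + (i : ℤ), mem_Icc_of_lt_card i.2⟩ := rfl

theorem spectrum_emb_equiv {ι κ : Type*} [Fintype ι] [Fintype κ] [DecidableEq ι] [DecidableEq κ]
    (e : ι ≃ κ) (A : Matrix (ι → Fin n) (ι → Fin n) ℂ) :
    spectrum ℝ (emb e A) = spectrum ℝ A := by
  have h : emb e A = Matrix.reindexAlgEquiv ℝ ℂ (e.arrowCongr (Equiv.refl (Fin n))) A := by
    ext σ σ'
    rw [emb_apply_of]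
    · rfl
    · intro y hy
      exact absurd (e.surjective y) hy
  rw [h, AlgEquiv.spectrum_eq]

theorem emb_term_eq_embed (B : Fin n → Mat) {m : ℕ} (hm : 1 ≤ m) {x y : ℤ} {s : ℕ}
    (hs : s + m ≤ (Finset.Icc x y).card)
    (h : Finset.Icc (x + s) (x + s + m - 1) ⊆ Finset.Icc x y) :
    emb (siteEquiv x y) (term (Finset.Icc x y).card s m (exProj B m)) =
      embed h ((parentInteraction B m).toFun _) := by
  rw [term_of_le hs, emb_emb (siteEquiv x y).injective]
  ext σ σ'
  have hr : ∀ w : Finset.Icc x y, w ∉ Set.range (siteEquiv x y ∘ win s m _ hs) ↔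
      (w : ℤ) ∉ Finset.Icc (x + s) (x + s + m - 1) := by
    intro w
    rw [not_iff_not, Finset.mem_Icc]
    constructor
    · rintro ⟨i, rfl⟩
      simp only [Function.comp_apply, siteEquiv_apply, win]
      push_cast
      omega
    · rintro ⟨h1, h2⟩
      refine ⟨⟨((w : ℤ) - (x + s)).toNat, by omega⟩, Subtype.ext ?_⟩
      simp only [Function.comp_apply, siteEquiv_apply, win]
      push_cast
      omega
  by_cases hc : ∀ w : Finset.Icc x y, (w : ℤ) ∉ Finset.Icc (x + s) (x + s + m - 1) → σ w = σ' w
  · rw [emb_apply_of _ fun w hw => hc w ((hr w).1 hw), embed, of_apply, if_pos hc,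
      parentInteraction_apply B hm rfl]
    congr 1 <;>
    · ext1 i
      simp only [Function.comp_apply, siteEquiv_apply, win]
      congr 2
      push_cast
      ring
  · rw [emb_apply_not _ fun h' => hc fun w hw => h' w ((hr w).2 hw), embed, of_apply, if_neg hc]

theorem hamiltonian_parentInteraction (B : Fin n → Mat) {m : ℕ} (hm : 1 ≤ m) (x y : ℤ) :
    (parentInteraction B m).hamiltonian (Finset.Icc x y) =
      emb (siteEquiv x y) (chainHam B m (Finset.Icc x y).card) := by
  classical
  set N := (Finset.Icc x y).card with hN
  set F : Finset ℤ → LocalAlg n (Finset.Icc x y) := fun X =>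
    if h : X ⊆ Finset.Icc x y then embed h ((parentInteraction B m).toFun X) else 0 with hF
  set g : ℕ → Finset ℤ := fun s => Finset.Icc (x + s) (x + s + m - 1) with hg
  have hginj : g.Injective := fun s s' h => by
    have := interval_left_unique hm h
    omega
  have h1 : (parentInteraction B m).hamiltonian (Finset.Icc x y) =
      ∑ X ∈ (Finset.Icc x y).powerset, F X := by
    rw [Interaction.hamiltonian, ← Finset.sum_attach (Finset.Icc x y).powerset]
    refine Finset.sum_congr rfl fun X _ => ?_
    rw [hF]
    simp only
    rw [dif_pos (Finset.mem_powerset.1 X.2)]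
  have h2 : emb (siteEquiv x y) (chainHam B m N) = ∑ X ∈ (Finset.range N).image g, F X := by
    rw [Finset.sum_image fun _ _ _ _ h => hginj h, chainHam, emb_sum]
    refine Finset.sum_congr rfl fun s hs => ?_
    by_cases hsm : s + m ≤ N
    · have hsub : g s ⊆ Finset.Icc x y := by
        rw [hN, Int.card_Icc] at hsm
        exact Finset.Icc_subset_Icc (by omega) (by omega)
      rw [hF]
      simp only
      rw [dif_pos hsub]
      exact emb_term_eq_embed B hm hsm hsub
    · rw [term_of_lt (by omega), emb_zero, hF]
      simp only
      rw [dif_neg]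
      intro hsub
      have h1 := Finset.card_le_card hsub
      have h3 : x + s + m - 1 ∈ Finset.Icc x y := hsub (by rw [hg, Finset.mem_Icc]; omega)
      rw [hN, Int.card_Icc] at hsm
      rw [Finset.mem_Icc] at h3
      omega
  rw [h1, h2]
  trans ∑ X ∈ (Finset.Icc x y).powerset ∪ (Finset.range N).image g, F X
  · refine Finset.sum_subset Finset.subset_union_left fun X _ hX => ?_
    exact dif_neg fun h => hX (Finset.mem_powerset.2 h)
  · refine (Finset.sum_subset Finset.subset_union_right fun X hX hXg => ?_).symm
    rw [Finset.mem_union, or_iff_left hXg, Finset.mem_powerset] at hX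
    rw [hF]
    simp only
    rw [dif_pos hX, parentInteraction_eq_zero]
    · ext σ σ'
      simp [embed]
    · rintro ⟨z, rfl⟩
      have hz := Finset.mem_Icc.1 (hX (Finset.left_mem_Icc.2 (by omega)))
      refine hXg (Finset.mem_image.2 ⟨(z - x).toNat, Finset.mem_range.2 ?_, ?_⟩)
      · rw [hN, Int.card_Icc]
        omega
      · have : x + ((z - x).toNat : ℤ) = z := by omega
        simp only [hg, this]

theorem spectrum_hamiltonian_parentInteraction (B : Fin n → Mat) {m : ℕ} (hm : 1 ≤ m) (x y : ℤ) :
    spectrum ℝ ((parentInteraction B m).hamiltonian (Finset.Icc x y)) =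
      spectrum ℝ (chainHam B m (Finset.Icc x y).card) := by
  rw [hamiltonian_parentInteraction B hm, spectrum_emb_equiv]

theorem isUniformlyGappedPath_parentInteraction [NeZero n] (hk : 1 ≤ k) {B : ℝ → Fin n → Mat}
    (hBs : ∀ a, SmoothOn (fun t => B t a) (Set.Icc 0 1)) {L m : ℕ} (hL : 1 ≤ L) (hm : L + 1 ≤ m)
    (hB : ∀ t ∈ Set.Icc (0 : ℝ) 1, tupleSpan (B t) ^ L = ⊤) :
    IsUniformlyGappedPath fun t => parentInteraction (B t) m := by
  obtain ⟨γ, hγ, N₀, h⟩ := chainHam_uniform_gap hk isCompact_Icc hBs hL hm hB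
  -- The smallest eigenvalue is always `0`, so the intervals degenerate to a point. Length at least
  -- `L` makes the words span, which provides a nonzero ground state.
  refine ⟨γ, hγ, max N₀ L, fun _ => 0, fun _ => 0, contDiffOn_const, contDiffOn_const, ?_⟩
  intro t ht x y _ hN
  rw [spectrum_hamiltonian_parentInteraction _ (by omega)]
  refine ⟨0, isLeast_spectrum_chainHam hk m ?_, ⟨le_rfl, le_rfl⟩, fun μ hμ h0 => ?_⟩
  · exact pow_eq_top_of_le (mul_top_of_pow_eq_top hL (hB t ht)) (hB t ht)
      ((le_max_right _ _).trans hN)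
  · rw [zero_add]
    exact h t ht _ ((le_max_left _ _).trans hN) μ hμ h0

theorem IsUniformlyGappedPath.isGapped {Φ : ℝ → Interaction n} (h : IsUniformlyGappedPath Φ)
    {t : ℝ} (ht : t ∈ Set.Icc (0 : ℝ) 1) : (Φ t).IsGapped := by
  obtain ⟨γ, hγ, N₀, a, b, -, -, h⟩ := h
  refine ⟨γ, hγ, N₀, fun x y hxy hN => ?_⟩
  obtain ⟨e, he, hab, hgap⟩ := h t ht x y hxy hN
  refine ⟨e, he, fun μ hμ h0 => ?_⟩
  linarith [hgap μ hμ h0, hab.2]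

section

open scoped Matrix.Norms.L2Operator

theorem SmoothOn.contDiffOn {ι : Type*} [Fintype ι] [DecidableEq ι] {A : ℝ → Matrix ι ι ℂ}
    {s : Set ℝ} (h : SmoothOn A s) : ContDiffOn ℝ ∞ A s := by
  let F : (ι → ι → ℂ) →ₗ[ℝ] Matrix ι ι ℂ := (Matrix.ofLinearEquiv ℝ).toLinearMap
  exact F.toContinuousLinearMap.contDiff.comp_contDiffOn
    (f := fun t i j => A t i j) (contDiffOn_pi.2 fun i => contDiffOn_pi.2 fun j => h i j)

theorem SmoothOn.isPiecewiseC1 {ι : Type*} [Fintype ι] [DecidableEq ι] {A : ℝ → Matrix ι ι ℂ}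
    (h : SmoothOn A (Set.Icc 0 1)) : IsPiecewiseC1 A := by
  refine ⟨h.contDiffOn.continuousOn, 1, fun i => i, by simp, by simp, by simp, fun i hi => ?_⟩
  obtain rfl : i = 0 := by omega
  simpa using h.contDiffOn.of_le (by exact_mod_cast le_top)

theorem isPiecewiseC1Path_parentInteraction {B : ℝ → Fin n → Mat}
    (hBs : ∀ a, SmoothOn (fun t => B t a) (Set.Icc 0 1)) {m : ℕ} (hm : 1 ≤ m)
    (hB : ∀ t ∈ Set.Icc (0 : ℝ) 1, tupleSpan (B t) ^ m = ⊤) :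
    IsPiecewiseC1Path fun t => parentInteraction (B t) m := by
  intro X
  refine SmoothOn.isPiecewiseC1 fun σ σ' => ?_
  by_cases h : ∃ x : ℤ, X = Finset.Icc x (x + m - 1)
  · obtain ⟨z, hz⟩ := h
    simp only [parentInteraction_apply _ hm hz]
    exact smoothOn_exProj hBs hB _ _
  · simp only [parentInteraction_eq_zero _ h]
    exact contDiffOn_const

end

end Interactions

/-! ### A path of tuples along which the words span. -/

section Path

variable {n k : ℕ}

local notation "Mat" => Matrix (Fin k) (Fin k) ℂ

/-- A polynomial function. -/
def IsPolynomialFun (f : ℂ → ℂ) : Prop := ∃ P : Polynomial ℂ, ∀ w, f w = P.eval w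

theorem IsPolynomialFun.mul {f g : ℂ → ℂ} (hf : IsPolynomialFun f) (hg : IsPolynomialFun g) :
    IsPolynomialFun fun w => f w * g w := by
  obtain ⟨P, hP⟩ := hf
  obtain ⟨Q, hQ⟩ := hg
  exact ⟨P * Q, fun w => by simp only [hP, hQ, Polynomial.eval_mul]⟩

theorem IsPolynomialFun.const (c : ℂ) : IsPolynomialFun fun _ => c :=
  ⟨Polynomial.C c, fun w => by rw [Polynomial.eval_C]⟩

theorem IsPolynomialFun.sum {ι : Type*} {s : Finset ι} {f : ι → ℂ → ℂ}
    (h : ∀ i, IsPolynomialFun (f i)) : IsPolynomialFun fun w => ∑ i ∈ s, f i w := by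
  choose P hP using h
  exact ⟨∑ i ∈ s, P i, fun w => by simp only [hP, Polynomial.eval_finsetSum]⟩

theorem IsPolynomialFun.prod {ι : Type*} {s : Finset ι} {f : ι → ℂ → ℂ}
    (h : ∀ i, IsPolynomialFun (f i)) : IsPolynomialFun fun w => ∏ i ∈ s, f i w := by
  choose P hP using h
  exact ⟨∏ i ∈ s, P i, fun w => by simp only [hP, Polynomial.eval_prod]⟩

theorem isPolynomialFun_det {ι : Type*} [Fintype ι] [DecidableEq ι] {A : ℂ → Matrix ι ι ℂ}
    (h : ∀ i j, IsPolynomialFun fun w => A w i j) : IsPolynomialFun fun w => (A w).det := by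
  simp only [det_apply, Units.smul_def, zsmul_eq_mul]
  exact IsPolynomialFun.sum fun σ =>
    (IsPolynomialFun.const _).mul (IsPolynomialFun.prod fun i => h _ _)

theorem isPolynomialFun_word {B : ℂ → Fin n → Mat}
    (hB : ∀ a i j, IsPolynomialFun fun w => B w a i j) {N : ℕ} (μ : Fin N → Fin n) :
    ∀ i j, IsPolynomialFun fun w => word (B w) μ i j := by
  induction N with
  | zero =>
    simp only [word_zero]
    exact fun i j => IsPolynomialFun.const _
  | succ N ih =>
    intro i j
    rw [← Fin.cons_self_tail μ]
    simp only [word_cons, mul_apply]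
    exact IsPolynomialFun.sum fun l => (hB _ _ _).mul (ih _ _ _)

/-- The complex line through two tuples. -/
def tupleLine (B B' : Fin n → Mat) (w : ℂ) (a : Fin n) : Mat := B a + w • (B' a - B a)

theorem tupleLine_zero (B B' : Fin n → Mat) : tupleLine B B' 0 = B := by
  ext a
  simp [tupleLine]

theorem tupleLine_one (B B' : Fin n → Mat) : tupleLine B B' 1 = B' := by
  ext a
  simp [tupleLine]

/-- The words of length `N` span along the complex line through two tuples, up to finitely many
points. -/
theorem exists_finset_tupleLine {B : Fin n → Mat} (B' : Fin n → Mat) {N : ℕ}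
    (h : tupleSpan B ^ N = ⊤) :
    ∃ R : Finset ℂ, ∀ w, w ∉ R → tupleSpan (tupleLine B B' w) ^ N = ⊤ := by
  -- The second factor is frozen at `B`: the entries of `(gammaMat _ N)ᴴ` are polynomial in `w`,
  -- whereas the full Gram determinant would also involve the conjugate of `w`. A nonzero value
  -- still forces injectivity at `w`.
  obtain ⟨P, hP⟩ : IsPolynomialFun fun w =>
      ((gammaMat (tupleLine B B' w) N)ᴴ * gammaMat B N).det := by
    refine isPolynomialFun_det fun i j => ?_
    simp only [mul_apply]
    refine IsPolynomialFun.sum fun μ => IsPolynomialFun.mul ?_ (IsPolynomialFun.const _)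
    simp only [conjTranspose_apply, gammaMat, of_apply, star_star]
    refine isPolynomialFun_word (fun a i j => ?_) μ _ _
    refine ⟨Polynomial.C (B a i j) + Polynomial.X * Polynomial.C (B' a i j - B a i j), fun w => ?_⟩
    simp [tupleLine]
  have hP0 : P.eval 0 ≠ 0 := by
    rw [← hP]
    simp only [tupleLine_zero]
    exact gammaMat_det_ne_zero h
  have hPne : P ≠ 0 := by
    rintro rfl
    simp at hP0
  refine ⟨P.roots.toFinset, fun w hw => ?_⟩
  rw [Multiset.mem_toFinset, Polynomial.mem_roots hPne, Polynomial.IsRoot, ← hP] at hw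
  rw [tupleSpan_pow_eq_top_iff]
  intro Z hZ
  have h1 : gammaMat (tupleLine B B' w) N *ᵥ (fun p => Z p.1 p.2) = 0 := by
    ext μ
    rw [gammaMat_mulVec]
    exact hZ μ
  have h2 : ((gammaMat (tupleLine B B' w) N)ᴴ * gammaMat B N)ᴴ *ᵥ (fun p => Z p.1 p.2) = 0 := by
    rw [conjTranspose_mul, conjTranspose_conjTranspose, ← mulVec_mulVec, h1, mulVec_zero]
  have h3 := eq_zero_of_mulVec_eq_zero (by rwa [det_conjTranspose, star_ne_zero]) h2
  ext i j
  exact congrFun h3 (i, j)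

/-- An arc from `0` to `1` in the complex plane. -/
noncomputable def arc (c t : ℝ) : ℂ := ⟨t, c * (t * (1 - t))⟩

/-- A point of `R` with real part in `(0, 1)` lies on the arc for just one value of `c`, so finitely
many values are excluded. -/
theorem exists_arc (R : Finset ℂ) :
    ∃ c : ℝ, ∀ t ∈ Set.Icc (0 : ℝ) 1, t ≠ 0 → t ≠ 1 → arc c t ∉ R := by
  obtain ⟨c, hc⟩ := Infinite.exists_notMem_finset (R.image fun ζ => ζ.im / (ζ.re * (1 - ζ.re)))
  refine ⟨c, fun t _ h0 h1 hR => hc (Finset.mem_image.2 ⟨_, hR, ?_⟩)⟩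
  have : 1 - t ≠ 0 := sub_ne_zero.2 (Ne.symm h1)
  simp only [arc]
  field_simp

theorem contDiff_arc (c : ℝ) : ContDiff ℝ ∞ (arc c) := by
  have h : arc c = fun t : ℝ => (t : ℂ) + ((c * (t * (1 - t)) : ℝ) : ℂ) * Complex.I := by
    ext1 t
    rw [arc, Complex.mk_eq_add_mul_I]
  rw [h]
  exact Complex.ofRealCLM.contDiff.add ((Complex.ofRealCLM.contDiff.comp
    (contDiff_const.mul (contDiff_id.mul (contDiff_const.sub contDiff_id)))).mul contDiff_const)

theorem exists_smooth_path {B B' : Fin n → Mat} {N : ℕ} (h : tupleSpan B ^ N = ⊤)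
    (h' : tupleSpan B' ^ N = ⊤) : ∃ P : ℝ → Fin n → Mat, P 0 = B ∧ P 1 = B' ∧
      (∀ a, SmoothOn (fun t => P t a) (Set.Icc 0 1)) ∧
      ∀ t ∈ Set.Icc (0 : ℝ) 1, tupleSpan (P t) ^ N = ⊤ := by
  obtain ⟨R, hR⟩ := exists_finset_tupleLine B' h
  obtain ⟨c, hc⟩ := exists_arc R
  have hP0 : tupleLine B B' (arc c 0) = B := by
    rw [show arc c 0 = 0 by simp [arc, Complex.ext_iff], tupleLine_zero]
  have hP1 : tupleLine B B' (arc c 1) = B' := by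
    rw [show arc c 1 = 1 by simp [arc, Complex.ext_iff], tupleLine_one]
  refine ⟨fun t => tupleLine B B' (arc c t), hP0, hP1, fun a i j => ?_, fun t ht => ?_⟩
  · simp only [tupleLine, Matrix.add_apply, Matrix.smul_apply, smul_eq_mul]
    exact (contDiff_const.add ((contDiff_arc c).mul contDiff_const)).contDiffOn
  · by_cases h0 : t = 0
    · simp only [h0, hP0, h]
    by_cases h1 : t = 1
    · simp only [h1, hP1, h']
    exact hR _ (hc t ht h0 h1)

end Path

end SpinChain

theorem lemma4p1 (n k m : ℕ) (hn : 2 ≤ n) (hk : 1 ≤ k) (hm : k ^ 4 + 1 ≤ m)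
    (B B' : Fin n → Matrix (Fin k) (Fin k) ℂ)
    (hB : B ∈ SpinChain.primitiveTuples n k) (hB' : B' ∈ SpinChain.primitiveTuples n k) :
    SpinChain.C1EquivalentIn m
      (SpinChain.parentInteraction B m) (SpinChain.parentInteraction B' m) := by
  have : NeZero n := ⟨by omega⟩
  have hL : 1 ≤ k ^ 4 := Nat.one_le_pow _ _ hk
  have hm1 : 1 ≤ m := by omega
  -- Primitivity enters only at the endpoints; inside the path only spanning at length `k ^ 4` is
  -- kept.
  obtain ⟨P, rfl, rfl, hPs, hP⟩ := SpinChain.exists_smooth_path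
    (SpinChain.tupleSpan_pow_eq_top_of_primitive hk hB le_rfl)
    (SpinChain.tupleSpan_pow_eq_top_of_primitive hk hB' le_rfl)
  have hgap := SpinChain.isUniformlyGappedPath_parentInteraction hk hPs hL hm hP
  have hmem := fun t => SpinChain.parentInteraction_mem (P t) hm1
  have hpath : SpinChain.GappedPathConnected m (SpinChain.parentInteraction (P 0) m)
      (SpinChain.parentInteraction (P 1) m) :=
    ⟨fun t => SpinChain.parentInteraction (P t) m, fun t _ => hmem t,
      SpinChain.isPiecewiseC1Path_parentInteraction hPs hm1 fun t ht =>
        SpinChain.pow_eq_top_of_le (SpinChain.mul_top_of_pow_eq_top hL (hP t ht)) (hP t ht)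
          (by omega), rfl, rfl, hgap⟩
  exact ⟨hmem 0, hmem 1, ⟨⟨(hmem 0).1, (hmem 0).2.1, m, (hmem 0).2.2⟩,
    ⟨(hmem 1).1, (hmem 1).2.1, m, (hmem 1).2.2⟩, hgap.isGapped ⟨le_rfl, zero_le_one⟩,
    hgap.isGapped ⟨zero_le_one, le_rfl⟩, m, hpath⟩, hpath⟩
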